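/- **Setting.** Let $D$ be a nonempty finite set and $k$ a positive semidefinite kernel on $D$ with $k(x,x)=1$ for all $x$. Let $f$ be a centred Gaussian process on $D$ with covariance $k$. At time $t=1,2,\dots$ a point $x_t\in D$ is queried at unit cost, and $y_t=f(x_t)+z_t$ is observed, with $z_t$ i.i.d. $N(0,\sigma^2)$, $\sigma>0$, independent of $f$. Let $\mu_t,\sigma_t^2$ be the Gaussian posterior mean and variance after time $t$, and let $\sigma^2_{t|S}$ be the posterior variance if a finite collection $S$ of points (repetitions allowed) is also observed. Assume that, for all selected points $x_1,\dots,x_t$ and every $x\in D$, the variance reduction $S\mapsto\sigma_t^2(x)-\sigma^2_{t|S}(x)$ is submodular. **Algorithm (TruVaR).** The parameters are $\bar\delta>0$, $r=\tfrac12$, $\eta_{(1)}=1$, $\eta_{(i)}=r^{i-1}\eta_{(1)}$, and $\beta_{(i)}>0$ for $i\ge1$. Start with epoch $i=1$, $M_0=D$, $H_0=L_0=\emptyset$. At time $t$: 1. Query $x_t\in D$ maximizing $\sum_{\bar x\in M_{t-1}}\max\{\beta_{(i)}\sigma_{t-1}^2(\bar x),\eta_{(i)}^2\}-\sum_{\bar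 x\in M_{t-1}}\max\{\beta_{(i)}\sigma_{t-1|x}^2(\bar x),\eta_{(i)}^2\}$ over $x\in D$, with ties broken by a rule depending only on past observations. 2. Put $u_t=\mu_t+\beta_{(i)}^{1/2}\sigma_t$ and $\ell_t=\mu_t-\beta_{(i)}^{1/2}\sigma_t$. For Bayesian optimization (BO), set $M_t=\{x\in M_{t-1}:u_t(x)\ge\max_{M_{t-1}}\ell_t\}$. For level-set estimation (LSE) with threshold $h$, set $M_t=\{x\in M_{t-1}:u_t(x)\ge h\ge\ell_t(x)\}$, $H_t=H_{t-1}\cup\{x\in M_{t-1}:\ell_t(x)>h\}$ and $L_t=L_{t-1}\cup\{x\in M_{t-1}:u_t(x)<h\}$. 3. While $M_t\neq\emptyset$ and $\max_{x\in M_t}\beta_{(i)}^{1/2}\sigma_t(x)\le(1+\bar\delta)\eta_{(i)}$, increase $i$ by one. **$\epsilon$-accuracy after time $t$.** For BO: $M_t$ contains every maximizer $x^*$ of $f$, and $f(x^*)-f(x)\le\epsilon$ for all $x\in M_t$. For LSE: $f>h$ on $H_t$, $f<h$ on $L_t$, and $|f-h|\le\epsilon/2$ on $M_t$. **Notation.**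 For integers $T\ge1$ put $\gamma_T=\max_{x_1,\dots,x_T\in D}\frac12\log\det\big(I+\sigma^{-2}[k(x_i,x_j)]_{i,j}\big)$, $\beta_T=2\log\frac{|D|T^2\pi^2}{6\delta}$ and $C_1=\frac1{\log(1+\sigma^{-2})}$. **Claim.** Let $0<\epsilon<4(1+\bar\delta)$ and $\delta\in(0,1)$. There is a sequence $(\beta_{(i)})$, bounded below by a positive constant and not depending on $T$, such that for BO and for LSE with any threshold $h$, with probability at least $1-\delta$, $\epsilon$-accuracy holds after time $T$ for every integer $T\ge1$ satisfying $$T\ \ge\ \Big(C_1\gamma_T\beta_T\frac{96(1+\bar\delta)^2}{\epsilon^2}+2\Big\lceil\log_2\frac{8(1+\bar\delta)}{\epsilon}\Big\rceil\Big)\log\frac{16(1+\bar\delta)^2|D|\beta_T}{\bar\delta^2\epsilon^2}.$$ This condition has the form $T\ge\Omega^*\big(\frac{C_1\gamma_T\beta_T}{\epsilon^2}+1\big)$, in the following sense. There is a constant $K>0$ depending only on $\bar\delta$ such that, for every integer $T\ge1$, the right-hand side is at most $K\big(\frac{C_1\gamma_T\beta_T}{\epsilon^2}+1\big)\big(1+\log^+\tfrac1\epsilon+\log|D|+\log^+\beta_T\big)^2$.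 Moreover, the right-hand side is at least $\frac{C_1\gamma_T\beta_T}{\epsilon^2}+1$ whenever its logarithmic factor $\log\frac{16(1+\bar\delta)^2|D|\beta_T}{\bar\delta^2\epsilon^2}$ is at least $1$. -/

import Mathlib

open MeasureTheory ProbabilityTheory
open scoped Matrix

noncomputable section

namespace TruVaR

/-! ### Gaussian process posteriors (homoscedastic noise of variance `s2`) -/

section Posterior

variable {D : Type*}

/-- Gram matrix `K = [k(x_i, x_j)]` of the points `x_1, …, x_t`. -/
def gram (k : D → D → ℝ) {t : ℕ} (X : Fin t → D) : Matrix (Fin t) (Fin t) ℝ :=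
  Matrix.of fun i j => k (X i) (X j)

/-- The vector `k_t(a) = [k(x_i, a)]`. -/
def kvec (k : D → D → ℝ) {t : ℕ} (X : Fin t → D) (a : D) : Fin t → ℝ :=
  fun i => k (X i) a

/-- Posterior mean at `a` after observing the values `y` at the points `X`. -/
def postMean (k : D → D → ℝ) (s2 : ℝ) {t : ℕ} (X : Fin t → D) (y : Fin t → ℝ) (a : D) : ℝ :=
  kvec k X a ⬝ᵥ ((gram k X + s2 • (1 : Matrix (Fin t) (Fin t) ℝ))⁻¹ *ᵥ y)

/-- Posterior variance at `a` after observing the points `X`. The posterior variance after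
observing further points `S` (duplicates allowed) is `postVar k s2 (Fin.append X S) a`. -/
def postVar (k : D → D → ℝ) (s2 : ℝ) {t : ℕ} (X : Fin t → D) (a : D) : ℝ :=
  k a a - kvec k X a ⬝ᵥ
    ((gram k X + s2 • (1 : Matrix (Fin t) (Fin t) ℝ))⁻¹ *ᵥ kvec k X a)

/-- Variance reduction `ψ(S) = σ_t²(a) - σ_{t|S}²(a)`, given the already selected points `X`. -/
def varReduction (k : D → D → ℝ) (s2 : ℝ) {t m : ℕ} (X : Fin t → D) (a : D) (S : Fin m → D) : ℝ :=
  postVar k s2 X a - postVar k s2 (Fin.append X S) a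

/-- Submodularity (diminishing returns) of the variance reduction, for all selected points `X` and
all query points `a`: adding `b` to a collection `S` gains at least as much as adding `b` to a
larger collection `S ∪ R`. Collections may contain duplicates. -/
def SubmodularVarReduction (k : D → D → ℝ) (s2 : ℝ) : Prop :=
  ∀ (t m n : ℕ) (X : Fin t → D) (a : D) (S : Fin m → D) (R : Fin n → D) (b : D),
    varReduction k s2 X a (Fin.append (Fin.append S R) ![b])
        - varReduction k s2 X a (Fin.append S R)
      ≤ varReduction k s2 X a (Fin.append S ![b]) - varReduction k s2 X a S

/-- Maximum mutual information `γ_T = max_{x_1, …, x_T} ½ log det (I + σ⁻² K_T)`. -/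
def gamma (k : D → D → ℝ) (s2 : ℝ) (T : ℕ) : ℝ :=
  ⨆ X : Fin T → D,
    (1 / 2) * Real.log (1 + s2⁻¹ • gram k X : Matrix (Fin T) (Fin T) ℝ).det

end Posterior

/-! ### The algorithm -/

/-- The two problems: Bayesian optimization, and level-set estimation with threshold `h`. -/
inductive Problem where
  | bo : Problem
  | lse (h : ℝ) : Problem

/-- Parameters of the algorithm: noise variance, `η₍₁₎`, `r`, `δ̄`, and `β₍ᵢ₎` for `i ≥ 1`. -/
structure Params where
  s2 : ℝ
  eta1 : ℝ
  r : ℝ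
  dbar : ℝ
  beta : ℕ → ℝ

/-- Target confidence `η₍ᵢ₎ = η₍₁₎ rⁱ⁻¹` of epoch `i ≥ 1`. -/
def Params.eta (p : Params) (i : ℕ) : ℝ := p.eta1 * p.r ^ (i - 1)

/-- State after some time step: the sets `M_t`, `H_t`, `L_t` (the last two are used only in
level-set estimation), and the number of the current epoch. -/
structure State (D : Type*) where
  M : Finset D
  H : Finset D
  L : Finset D
  epoch : ℕ

section Algorithm

variable {D : Type*}

/-- Upper confidence bound `μ + β^{1/2} σ`. -/
def ucb (k : D → D → ℝ) (s2 b : ℝ) {t : ℕ} (X : Fin t → D) (y : Fin t → ℝ) (a : D) : ℝ :=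
  postMean k s2 X y a + √b * √(postVar k s2 X a)

/-- Lower confidence bound `μ - β^{1/2} σ`. -/
def lcb (k : D → D → ℝ) (s2 b : ℝ) {t : ℕ} (X : Fin t → D) (y : Fin t → ℝ) (a : D) : ℝ :=
  postMean k s2 X y a - √b * √(postVar k s2 X a)

open Classical in
/-- The update of `(M, H, L)` from the selected points and observations, with the `β` of the current
epoch; the epoch number is left as it is. -/
def updateSets (pb : Problem) (k : D → D → ℝ) (p : Params) {t : ℕ} (X : Fin t → D) (y : Fin t → ℝ)
    (s : State D) : State D :=
  let u := ucb k p.s2 (p.beta s.epoch) X y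
  let l := lcb k p.s2 (p.beta s.epoch) X y
  match pb with
  | .bo => { s with M := {a ∈ s.M | ∀ c ∈ s.M, l c ≤ u a} }
  | .lse h =>
    { s with
      M := {a ∈ s.M | h ≤ u a ∧ l a ≤ h}
      H := s.H ∪ {a ∈ s.M | h < l a}
      L := s.L ∪ {a ∈ s.M | u a < h} }

/-- The condition of the `while` loop: `max_{a ∈ M_t} β₍ᵢ₎^{1/2} σ_t(a) ≤ (1 + δ̄) η₍ᵢ₎`. -/
def EpochDone (k : D → D → ℝ) (p : Params) {t : ℕ} (X : Fin t → D) (M : Finset D) (i : ℕ) : Prop :=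
  ∀ a ∈ M, √(p.beta i) * √(postVar k p.s2 X a) ≤ (1 + p.dbar) * p.eta i

open Classical in
/-- The epoch number when the `while` loop that is entered with epoch number `i` is left. (If `M_t`
is empty, every point is classified and nothing is left to do; the epoch number is then kept.) -/
def nextEpoch (k : D → D → ℝ) (p : Params) {t : ℕ} (X : Fin t → D) (M : Finset D) (i : ℕ) : ℕ :=
  if hj : ∃ j, i ≤ j ∧ ¬ EpochDone k p X M j then Nat.find hj else i

/-- The state after `t` time steps, when the queried points are `x 0, x 1, …` and the observed
values are `y 0, y 1, …` (entry `s` belongs to time step `s + 1`). -/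
def state [Fintype D] (pb : Problem) (k : D → D → ℝ) (p : Params) (x : ℕ → D) (y : ℕ → ℝ) :
    ℕ → State D
  | 0 => { M := Finset.univ, H := ∅, L := ∅, epoch := 1 }
  | t + 1 =>
    let X : Fin (t + 1) → D := fun i => x i
    let s := updateSets pb k p X (fun i => y i) (state pb k p x y t)
    { s with epoch := nextEpoch k p X s.M s.epoch }

/-- The acquisition function (unit costs) at `a`, when the points `X` have been queried and the
state is `s`: the reduction of the sum of truncated variances over `M` caused by querying `a`. -/
def acq (k : D → D → ℝ) (p : Params) {t : ℕ} (X : Fin t → D) (s : State D) (a : D) : ℝ :=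
  (∑ b ∈ s.M, max (p.beta s.epoch * postVar k p.s2 X b) (p.eta s.epoch ^ 2))
    - ∑ b ∈ s.M, max (p.beta s.epoch * postVar k p.s2 (Fin.append X ![a]) b) (p.eta s.epoch ^ 2)

/-- Accuracy of the sets in a state, for the function `f`. -/
def Accurate (pb : Problem) (ε : ℝ) (f : D → ℝ) (s : State D) : Prop :=
  match pb with
  | .bo => ∀ xs, (∀ c, f c ≤ f xs) → xs ∈ s.M ∧ ∀ a ∈ s.M, f xs - f a ≤ ε
  | .lse h => (∀ a ∈ s.H, h < f a) ∧ (∀ a ∈ s.L, f a < h) ∧ ∀ a ∈ s.M, |f a - h| ≤ ε / 2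

end Algorithm

/-! ### Random model -/

section Model

variable {D Ω : Type*} [MeasurableSpace Ω]

/-- `f` is a centred Gaussian process with kernel `k`, and the noise variables `z 0, z 1, …` are
i.i.d. `N(0, s2)` and independent of `f`. -/
structure IsModel (P : Measure Ω) (k : D → D → ℝ) (s2 : ℝ) (f : D → Ω → ℝ) (z : ℕ → Ω → ℝ) :
    Prop where
  measurable_f : ∀ a, Measurable (f a)
  measurable_z : ∀ t, Measurable (z t)
  gaussian_f : IsGaussianProcess f P
  mean_f : ∀ a, ∫ ω, f a ω ∂P = 0
  cov_f : ∀ a b, cov[f a, f b; P] = k a b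
  law_z : ∀ t, Measure.map (z t) P = gaussianReal 0 s2.toNNReal
  indep_z : iIndepFun z P
  indep_f_z : IndepFun (fun ω a => f a ω) (fun ω t => z t ω) P

/-- The noisy observation at time step `t + 1`. -/
def obs (f : D → Ω → ℝ) (z : ℕ → Ω → ℝ) (x : ℕ → Ω → D) (t : ℕ) (ω : Ω) : ℝ :=
  f (x t ω) ω + z t ω

/-- The state after `t` time steps, at the outcome `ω`. -/
def runState [Fintype D] (pb : Problem) (k : D → D → ℝ) (p : Params) (f : D → Ω → ℝ)
    (z : ℕ → Ω → ℝ) (x : ℕ → Ω → D) (ω : Ω) (t : ℕ) : State D :=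
  state pb k p (fun s => x s ω) (fun s => obs f z x s ω) t

/-- `x 0, x 1, …` are the points queried in a run of the algorithm: each maximizes the current
acquisition function, and ties are broken by any rule that uses only the past observations. -/
structure IsRun [Fintype D] (pb : Problem) (k : D → D → ℝ) (p : Params) (f : D → Ω → ℝ)
    (z : ℕ → Ω → ℝ) (x : ℕ → Ω → D) : Prop where
  greedy : ∀ t ω a,
    acq k p (fun i : Fin t => x i ω) (runState pb k p f z x ω t) a
      ≤ acq k p (fun i : Fin t => x i ω) (runState pb k p f z x ω t) (x t ω)
  nonanticipating : ∀ t d,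
    MeasurableSet[⨆ s : Fin t, MeasurableSpace.comap (obs f z x s) inferInstance] {ω | x t ω = d}

end Model

/-! ### The threshold on the time horizon -/

/-- `β_T = 2 log (|D| T² π² / (6 δ))`, where `n = |D|`. -/
def betaT (n : ℕ) (δ : ℝ) (T : ℕ) : ℝ :=
  2 * Real.log (n * (T : ℝ) ^ 2 * Real.pi ^ 2 / (6 * δ))

/-- `C₁ = 1 / log (1 + σ⁻²)`. -/
def C1 (σ : ℝ) : ℝ := 1 / Real.log (1 + (σ ^ 2)⁻¹)

/-- `log (16 (1 + δ̄)² |D| β_T / (δ̄² ε²))`. -/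
def logFactor (n : ℕ) (dbar ε δ : ℝ) (T : ℕ) : ℝ :=
  Real.log (16 * (1 + dbar) ^ 2 * n * betaT n δ T / (dbar ^ 2 * ε ^ 2))

/-- The right-hand side of the condition on `T`. -/
def threshold {D : Type*} [Fintype D] (k : D → D → ℝ) (σ dbar ε δ : ℝ) (T : ℕ) : ℝ :=
  (C1 σ * gamma k (σ ^ 2) T * betaT (Fintype.card D) δ T * (96 * (1 + dbar) ^ 2 / ε ^ 2)
      + 2 * (⌈Real.logb 2 (8 * (1 + dbar) / ε)⌉ : ℝ))
    * logFactor (Fintype.card D) dbar ε δ T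

/-- The rate `C₁ γ_T β_T / ε² + 1`. -/
def rate {D : Type*} [Fintype D] (k : D → D → ℝ) (σ ε δ : ℝ) (T : ℕ) : ℝ :=
  C1 σ * gamma k (σ ^ 2) T * betaT (Fintype.card D) δ T / ε ^ 2 + 1

end TruVaR

end

/-
The posterior mean is the best linear predictor and the posterior variance its mean squared error.
The residual `f a - μ a` at fixed query points is uncorrelated with, hence independent of, the
observations, so the Gaussian confidence bounds stay valid for adaptively chosen queries. A union
bound over the time steps makes all of them hold simultaneously.

By submodularity, a greedy query closes a `1 / m` fraction of the gap between the current truncated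
variance and the one reached by any design of `m` points, so an epoch of target `η` ends after about
`m log (|D| β / ((2 δ̄ + δ̄²) η²))` steps, where `m` is the size of a design of variances at most
`η² / β`. Uncertainty sampling yields designs of `m` points with all variances at most
`2 C₁ γ_m / m`.

Let `T` be the smallest horizon satisfying the condition. With `β` proportional to `4 ^ (-i)` up to
the epoch whose accuracy is `ε`, the targets `η / √β` of these epochs coincide, and the first epoch,
which lasts less than `T` steps, completes all of them. After that, `β` grows geometrically, so that
the failure probabilities of the remaining steps are summable. A constant factor `κ ≤ 2` in front of
`β_T` pays for these later steps; it has to be smaller when `|D| ≤ 3`.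
When `16 β_T ≤ ε²`, the prior confidence intervals are already short enough: with `β = β_T` the
first epoch ends at once, and the later `β` are so large that their failure probabilities sum to
`δ / 3` at most.
-/

namespace TruVaR

section PosteriorVariance

variable {D : Type*} {k : D → D → ℝ} {s2 : ℝ} {t m : ℕ}

/-- Covariance matrix `K + s2 • I` of the noisy observations at the points `X`; an abbreviation, so
that `postMean` and `postVar` contain it definitionally. -/
abbrev noisyGram (k : D → D → ℝ) (s2 : ℝ) (X : Fin t → D) : Matrix (Fin t) (Fin t) ℝ :=
  gram k X + s2 • 1

/-- Mean squared error of the linear predictor of `f a` that puts the weights `w` on the noisy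
observations at the points `X`. -/
def linMse (k : D → D → ℝ) (s2 : ℝ) (X : Fin t → D) (a : D) (w : Fin t → ℝ) : ℝ :=
  k a a - 2 * (w ⬝ᵥ kvec k X a) + w ⬝ᵥ (noisyGram k s2 X *ᵥ w)

/-- The weights that the posterior mean at `a` puts on the observations. -/
noncomputable def optWeights (k : D → D → ℝ) (s2 : ℝ) (X : Fin t → D) (a : D) : Fin t → ℝ :=
  (noisyGram k s2 X)⁻¹ *ᵥ kvec k X a

theorem kernel_symm (hk : (Matrix.of k).PosSemidef) (a b : D) : k a b = k b a := by
  simpa using hk.isHermitian.apply b a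

theorem gram_posSemidef (hk : (Matrix.of k).PosSemidef) (X : Fin t → D) :
    (gram k X).PosSemidef :=
  hk.submatrix X

theorem noisyGram_posDef (hk : (Matrix.of k).PosSemidef) (hs : 0 < s2) (X : Fin t → D) :
    (noisyGram k s2 X).PosDef :=
  Matrix.PosDef.posSemidef_add (gram_posSemidef hk X) (Matrix.PosDef.one.smul hs)

theorem noisyGram_transpose (hk : (Matrix.of k).PosSemidef) (X : Fin t → D) :
    (noisyGram k s2 X)ᵀ = noisyGram k s2 X := by
  have : (gram k X)ᵀ = gram k X := Matrix.ext fun i j => kernel_symm hk (X j) (X i)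
  rw [Matrix.transpose_add, this, Matrix.transpose_smul, Matrix.transpose_one]

theorem noisyGram_comp {g : Fin m → Fin t} (hg : g.Injective) (X : Fin t → D) :
    noisyGram k s2 (X ∘ g) = (noisyGram k s2 X).submatrix g g := by
  ext i j
  simp [gram, Matrix.one_apply, hg.eq_iff]

theorem dotProduct_noisyGram_mulVec_nonneg (hk : (Matrix.of k).PosSemidef) (hs : 0 < s2)
    (X : Fin t → D) (w : Fin t → ℝ) : 0 ≤ w ⬝ᵥ (noisyGram k s2 X *ᵥ w) := by
  simpa using (noisyGram_posDef hk hs X).posSemidef.dotProduct_mulVec_nonneg w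

theorem dotProduct_noisyGram_mulVec_comm (hk : (Matrix.of k).PosSemidef) (X : Fin t → D)
    (v w : Fin t → ℝ) : v ⬝ᵥ (noisyGram k s2 X *ᵥ w) = w ⬝ᵥ (noisyGram k s2 X *ᵥ v) := by
  rw [Matrix.dotProduct_mulVec, ← Matrix.mulVec_transpose, noisyGram_transpose hk, dotProduct_comm]

theorem noisyGram_mulVec_optWeights (hk : (Matrix.of k).PosSemidef) (hs : 0 < s2) (X : Fin t → D)
    (a : D) : noisyGram k s2 X *ᵥ optWeights k s2 X a = kvec k X a := by
  rw [optWeights, Matrix.mulVec_mulVec, Matrix.mul_nonsing_inv, Matrix.one_mulVec]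
  exact (Matrix.isUnit_iff_isUnit_det _).1 (noisyGram_posDef hk hs X).isUnit

theorem postVar_eq_sub (k : D → D → ℝ) (s2 : ℝ) (X : Fin t → D) (a : D) :
    postVar k s2 X a = k a a - optWeights k s2 X a ⬝ᵥ kvec k X a := by
  rw [dotProduct_comm]
  rfl

theorem postMean_eq_dotProduct (hk : (Matrix.of k).PosSemidef) (X : Fin t → D) (y : Fin t → ℝ)
    (a : D) : postMean k s2 X y a = optWeights k s2 X a ⬝ᵥ y := by
  rw [postMean, Matrix.dotProduct_mulVec, ← Matrix.mulVec_transpose, Matrix.transpose_nonsing_inv]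
  exact congrArg (fun A => (A⁻¹ *ᵥ kvec k X a) ⬝ᵥ y) (noisyGram_transpose hk X)

theorem linMse_eq_postVar_add (hk : (Matrix.of k).PosSemidef) (hs : 0 < s2) (X : Fin t → D)
    (a : D) (w : Fin t → ℝ) :
    linMse k s2 X a w = postVar k s2 X a
      + (w - optWeights k s2 X a) ⬝ᵥ (noisyGram k s2 X *ᵥ (w - optWeights k s2 X a)) := by
  have hcomm := dotProduct_noisyGram_mulVec_comm (s2 := s2) hk X (optWeights k s2 X a) w
  rw [linMse, postVar_eq_sub, Matrix.mulVec_sub, dotProduct_sub, sub_dotProduct, sub_dotProduct,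
    hcomm, noisyGram_mulVec_optWeights hk hs]
  ring

theorem postVar_le_linMse (hk : (Matrix.of k).PosSemidef) (hs : 0 < s2) (X : Fin t → D) (a : D)
    (w : Fin t → ℝ) : postVar k s2 X a ≤ linMse k s2 X a w := by
  rw [linMse_eq_postVar_add hk hs]
  exact le_add_of_nonneg_right (dotProduct_noisyGram_mulVec_nonneg hk hs X _)

theorem linMse_optWeights (hk : (Matrix.of k).PosSemidef) (hs : 0 < s2) (X : Fin t → D) (a : D) :
    linMse k s2 X a (optWeights k s2 X a) = postVar k s2 X a := by
  rw [linMse_eq_postVar_add hk hs, sub_self, zero_dotProduct, add_zero]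

theorem extend_zero_dotProduct {g : Fin m → Fin t} (hg : g.Injective) (w : Fin m → ℝ)
    (u : Fin t → ℝ) : Function.extend g w 0 ⬝ᵥ u = w ⬝ᵥ (u ∘ g) := by
  refine (Fintype.sum_of_injective g hg _ _ (fun j hj => ?_) fun i => ?_).symm
  · rw [Function.extend_apply' _ _ _ hj, Pi.zero_apply, zero_mul]
  · rw [hg.extend_apply, Function.comp_apply]

theorem linMse_extend_zero {g : Fin m → Fin t} (hg : g.Injective) (X : Fin t → D) (a : D)
    (w : Fin m → ℝ) :
    linMse k s2 X a (Function.extend g w 0) = linMse k s2 (X ∘ g) a w := by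
  have hmulVec : (noisyGram k s2 X *ᵥ Function.extend g w 0) ∘ g
      = noisyGram k s2 (X ∘ g) *ᵥ w := by
    ext i
    rw [noisyGram_comp hg, Function.comp_apply, Matrix.mulVec, dotProduct_comm,
      extend_zero_dotProduct hg, dotProduct_comm]
    rfl
  rw [linMse, extend_zero_dotProduct hg, extend_zero_dotProduct hg, hmulVec]
  rfl

theorem postVar_le_postVar_comp (hk : (Matrix.of k).PosSemidef) (hs : 0 < s2) {g : Fin m → Fin t}
    (hg : g.Injective) (X : Fin t → D) (a : D) : postVar k s2 X a ≤ postVar k s2 (X ∘ g) a :=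
  calc postVar k s2 X a
    _ ≤ linMse k s2 X a (Function.extend g (optWeights k s2 (X ∘ g) a) 0) :=
      postVar_le_linMse hk hs X a _
    _ = postVar k s2 (X ∘ g) a := by rw [linMse_extend_zero hg, linMse_optWeights hk hs]

theorem postVar_append_le_left (hk : (Matrix.of k).PosSemidef) (hs : 0 < s2) (X : Fin t → D)
    (S : Fin m → D) (a : D) : postVar k s2 (Fin.append X S) a ≤ postVar k s2 X a := by
  refine (postVar_le_postVar_comp hk hs (Fin.castAdd_injective t m) _ a).trans_eq ?_
  rw [show Fin.append X S ∘ Fin.castAdd m = X from funext (Fin.append_left X S)]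

theorem postVar_append_le_right (hk : (Matrix.of k).PosSemidef) (hs : 0 < s2) (X : Fin t → D)
    (S : Fin m → D) (a : D) : postVar k s2 (Fin.append X S) a ≤ postVar k s2 S a := by
  refine (postVar_le_postVar_comp hk hs (Fin.natAdd_injective m t) _ a).trans_eq ?_
  rw [show Fin.append X S ∘ Fin.natAdd t = S from funext (Fin.append_right X S)]

theorem postVar_le_kernel (hk : (Matrix.of k).PosSemidef) (hs : 0 < s2) (X : Fin t → D) (a : D) :
    postVar k s2 X a ≤ k a a := by
  simpa [linMse] using postVar_le_linMse hk hs X a 0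

/-- The mean squared error consists of the part due to the noise, which is the left-hand side, and
a part due to `f`, which is a value of the positive semidefinite form `k`. -/
theorem mul_dotProduct_self_optWeights_le_postVar (hk : (Matrix.of k).PosSemidef) (hs : 0 < s2)
    (X : Fin t → D) (a : D) :
    s2 * (optWeights k s2 X a ⬝ᵥ optWeights k s2 X a) ≤ postVar k s2 X a := by
  rw [← linMse_optWeights hk hs X a]
  set w := optWeights k s2 X a
  have hform := (gram_posSemidef hk (Fin.cons a X : Fin (t + 1) → D)).dotProduct_mulVec_nonneg
    (Fin.cons (-1) w)
  have hexpand : star (Fin.cons (-1) w : Fin (t + 1) → ℝ) ⬝ᵥ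
      (gram k (Fin.cons a X : Fin (t + 1) → D) *ᵥ Fin.cons (-1) w)
        = k a a - 2 * (w ⬝ᵥ kvec k X a) + w ⬝ᵥ (gram k X *ᵥ w) := by
    simp only [dotProduct, Matrix.mulVec, gram, kvec, Fin.sum_univ_succ, Matrix.of_apply,
      Pi.star_apply, star_trivial, Fin.cons_zero, Fin.cons_succ, mul_add, Finset.sum_add_distrib,
      kernel_symm hk a, mul_neg, mul_one, neg_mul, one_mul, Finset.sum_neg_distrib]
    simp only [mul_comm (w _)]
    ring
  rw [hexpand] at hform
  rw [linMse, noisyGram, Matrix.add_mulVec, Matrix.smul_mulVec, Matrix.one_mulVec, dotProduct_add,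
    dotProduct_smul, smul_eq_mul]
  linarith

theorem postVar_nonneg (hk : (Matrix.of k).PosSemidef) (hs : 0 < s2) (X : Fin t → D) (a : D) :
    0 ≤ postVar k s2 X a :=
  (mul_nonneg hs.le (dotProduct_self_star_nonneg _)).trans
    (mul_dotProduct_self_optWeights_le_postVar hk hs X a)

theorem postVar_pos (hk : (Matrix.of k).PosSemidef) (hs : 0 < s2) (X : Fin t → D) {a : D}
    (ha : 0 < k a a) : 0 < postVar k s2 X a := by
  by_cases hw : optWeights k s2 X a = 0
  · rwa [postVar_eq_sub, hw, zero_dotProduct, sub_zero]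
  · have hpos : 0 < optWeights k s2 X a ⬝ᵥ optWeights k s2 X a :=
      (dotProduct_self_star_nonneg _).lt_of_ne fun h => hw (dotProduct_self_eq_zero.1 h.symm)
    exact (mul_pos hs hpos).trans_le (mul_dotProduct_self_optWeights_le_postVar hk hs X a)

theorem postVar_const_le (hk : (Matrix.of k).PosSemidef) (hs : 0 < s2) (hm : m ≠ 0) (a : D) :
    postVar k s2 (fun _ : Fin m => a) a ≤ s2 / m := by
  refine (postVar_le_linMse hk hs _ a fun _ => 1 / m).trans_eq ?_
  have : (m : ℝ) ≠ 0 := Nat.cast_ne_zero.2 hm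
  simp only [linMse, Matrix.add_mulVec, Matrix.smul_mulVec, Matrix.one_mulVec, dotProduct_add,
    dotProduct_smul, smul_eq_mul]
  simp only [dotProduct, Matrix.mulVec, gram, kvec, Matrix.of_apply, Finset.sum_const,
    Finset.card_univ, Fintype.card_fin, nsmul_eq_mul]
  field_simp
  ring

end PosteriorVariance

section InformationGain

variable {D : Type*} {k : D → D → ℝ} {s2 : ℝ} {t : ℕ}

/-- Twice the mutual information `½ log det (I + s2⁻¹ K)` between `f` and the observations at the
points `X`. -/
noncomputable def logDet (k : D → D → ℝ) (s2 : ℝ) (X : Fin t → D) : ℝ :=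
  Real.log (1 + s2⁻¹ • gram k X : Matrix (Fin t) (Fin t) ℝ).det

theorem gram_append_submatrix (hk : (Matrix.of k).PosSemidef) (X : Fin t → D) (a : D) :
    (gram k (Fin.append X ![a])).submatrix finSumFinEquiv finSumFinEquiv
      = Matrix.fromBlocks (gram k X) (Matrix.replicateCol (Fin 1) (kvec k X a))
          (Matrix.replicateRow (Fin 1) (kvec k X a)) (Matrix.of fun _ _ => k a a) := by
  ext (i | i) (j | j) <;> simp [gram, kvec, kernel_symm hk a]

theorem noisyGram_append_submatrix (hk : (Matrix.of k).PosSemidef) (X : Fin t → D) (a : D) :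
    (noisyGram k s2 (Fin.append X ![a])).submatrix finSumFinEquiv finSumFinEquiv
      = Matrix.fromBlocks (noisyGram k s2 X) (Matrix.replicateCol (Fin 1) (kvec k X a))
          (Matrix.replicateRow (Fin 1) (kvec k X a)) (Matrix.of fun _ _ => k a a + s2) := by
  have hsplit : (noisyGram k s2 (Fin.append X ![a])).submatrix finSumFinEquiv finSumFinEquiv
      = (gram k (Fin.append X ![a])).submatrix finSumFinEquiv finSumFinEquiv
        + s2 • (1 : Matrix (Fin (t + 1)) (Fin (t + 1)) ℝ).submatrix finSumFinEquiv finSumFinEquiv :=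
    rfl
  rw [hsplit, gram_append_submatrix hk, Matrix.submatrix_one_equiv, ← Matrix.fromBlocks_one,
    Matrix.fromBlocks_smul, Matrix.fromBlocks_add]
  congr 1
  · simp
  · simp
  · ext i j
    simp [Subsingleton.elim i j]

theorem det_noisyGram_append (hk : (Matrix.of k).PosSemidef) (hs : 0 < s2) (X : Fin t → D)
    (a : D) :
    (noisyGram k s2 (Fin.append X ![a])).det
      = (noisyGram k s2 X).det * (s2 + postVar k s2 X a) := by
  have := (noisyGram_posDef hk hs X).isUnit.invertible
  rw [← Matrix.det_submatrix_equiv_self finSumFinEquiv, noisyGram_append_submatrix hk,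
    Matrix.det_fromBlocks₁₁, Matrix.invOf_eq_nonsing_inv, Matrix.mul_assoc,
    ← Matrix.replicateCol_mulVec, Matrix.replicateRow_mul_replicateCol]
  congr 1
  rw [Matrix.det_unique]
  simp only [Matrix.sub_apply, Matrix.of_apply, postVar]
  ring

theorem det_one_add_smul_gram (k : D → D → ℝ) (hs : s2 ≠ 0) (X : Fin t → D) :
    (1 + s2⁻¹ • gram k X : Matrix (Fin t) (Fin t) ℝ).det
      = s2⁻¹ ^ t * (noisyGram k s2 X).det := by
  have hscale : (1 + s2⁻¹ • gram k X : Matrix (Fin t) (Fin t) ℝ) = s2⁻¹ • noisyGram k s2 X := by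
    rw [smul_add, smul_smul, inv_mul_cancel₀ hs, one_smul, add_comm]
  rw [hscale, Matrix.det_smul, Fintype.card_fin]

theorem logDet_append (hk : (Matrix.of k).PosSemidef) (hs : 0 < s2) (X : Fin t → D) (a : D) :
    logDet k s2 (Fin.append X ![a])
      = logDet k s2 X + Real.log (1 + s2⁻¹ * postVar k s2 X a) := by
  have hdet := (noisyGram_posDef hk hs X).det_pos
  have hvar := postVar_nonneg hk hs X a
  rw [logDet, logDet, det_one_add_smul_gram k hs.ne', det_one_add_smul_gram k hs.ne',
    det_noisyGram_append hk hs, ← Real.log_mul (by positivity) (by positivity)]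
  rw [show t + Nat.succ 0 = t + 1 from rfl, pow_succ]
  field_simp

theorem half_logDet_le_gamma [Finite D] (k : D → D → ℝ) (s2 : ℝ) (X : Fin t → D) :
    1 / 2 * logDet k s2 X ≤ gamma k s2 t :=
  le_ciSup (f := fun X : Fin t → D => 1 / 2 * logDet k s2 X) (Set.finite_range _).bddAbove X

theorem gamma_mono [Finite D] [Nonempty D] (hk : (Matrix.of k).PosSemidef) (hs : 0 < s2) :
    Monotone (gamma k s2) := by
  refine monotone_nat_of_le_succ fun t => ciSup_le fun X => ?_
  obtain ⟨a⟩ := ‹Nonempty D›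
  have hvar := postVar_nonneg hk hs X a
  have hlog : 0 ≤ Real.log (1 + s2⁻¹ * postVar k s2 X a) :=
    Real.log_nonneg (le_add_of_nonneg_right (by positivity))
  refine le_trans ?_ (half_logDet_le_gamma k s2 (Fin.append X ![a]))
  rw [logDet_append hk hs]
  exact mul_le_mul_of_nonneg_left (le_add_of_nonneg_right hlog) one_half_pos.le

theorem half_log_one_add_mul_le_gamma [Finite D] (k : D → D → ℝ) (s2 : ℝ) (t : ℕ) (a : D) :
    1 / 2 * Real.log (1 + t * (k a a / s2)) ≤ gamma k s2 t := by
  refine le_of_eq_of_le ?_ (half_logDet_le_gamma k s2 fun _ : Fin t => a)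
  have hrank_one : (s2⁻¹ • gram k fun _ : Fin t => a)
      = Matrix.replicateCol Unit (fun _ : Fin t => k a a / s2)
        * Matrix.replicateRow Unit (fun _ : Fin t => (1 : ℝ)) := by
    ext i j
    simp [gram, Matrix.mul_apply, inv_mul_eq_div]
  rw [logDet, hrank_one, Matrix.det_one_add_replicateCol_mul_replicateRow]
  simp [dotProduct]

/-- Uncertainty sampling: query the point of largest posterior variance `m` times in a row. The
largest variance decreases, so each query contributes at least the final value to `logDet`. -/
theorem exists_mul_log_le_logDet [Finite D] [Nonempty D] (hk : (Matrix.of k).PosSemidef)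
    (hs : 0 < s2) (m : ℕ) :
    ∃ X : Fin m → D, ∀ a, m * Real.log (1 + s2⁻¹ * postVar k s2 X a) ≤ logDet k s2 X := by
  induction m with
  | zero => exact ⟨Fin.elim0, fun a => by simp [logDet]⟩
  | succ m ih =>
    obtain ⟨X, hX⟩ := ih
    obtain ⟨c, hc⟩ := Finite.exists_max (postVar k s2 X)
    refine ⟨Fin.append X ![c], fun a => ?_⟩
    have hvar := postVar_nonneg hk hs (Fin.append X ![c]) a
    have hle : Real.log (1 + s2⁻¹ * postVar k s2 (Fin.append X ![c]) a)
        ≤ Real.log (1 + s2⁻¹ * postVar k s2 X c) := by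
      gcongr
      exact (postVar_append_le_left hk hs X ![c] a).trans (hc a)
    calc ((m + 1 : ℕ) : ℝ) * Real.log (1 + s2⁻¹ * postVar k s2 (Fin.append X ![c]) a)
      _ ≤ (m + 1) * Real.log (1 + s2⁻¹ * postVar k s2 X c) := by
        push_cast
        gcongr
      _ ≤ logDet k s2 X + Real.log (1 + s2⁻¹ * postVar k s2 X c) := by linarith [hX c]
      _ = logDet k s2 (Fin.append X ![c]) := (logDet_append hk hs X c).symm

theorem mul_log_one_add_le_log_one_add_mul {c p : ℝ} (hc : -1 < c) (hp : 0 ≤ p) (hp1 : p ≤ 1) :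
    p * Real.log (1 + c) ≤ Real.log (1 + c * p) := by
  have hpos : 0 < 1 + c := by linarith
  rw [← Real.log_rpow hpos, mul_comm c]
  exact Real.log_le_log (Real.rpow_pos_of_pos hpos p)
    (rpow_one_add_le_one_add_mul_self hc.le hp hp1)

theorem exists_mul_postVar_le [Finite D] [Nonempty D] {σ : ℝ} (hk : (Matrix.of k).PosSemidef)
    (hσ : 0 < σ) (hone : ∀ a, k a a ≤ 1) (m : ℕ) :
    ∃ X : Fin m → D, ∀ a, m * postVar k (σ ^ 2) X a ≤ 2 * (C1 σ * gamma k (σ ^ 2) m) := by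
  have hs : 0 < σ ^ 2 := by positivity
  have hlog : 0 < Real.log (1 + (σ ^ 2)⁻¹) := Real.log_pos (lt_add_of_pos_right 1 (by positivity))
  obtain ⟨X, hX⟩ := exists_mul_log_le_logDet hk hs m
  refine ⟨X, fun a => ?_⟩
  have hconcave := mul_log_one_add_le_log_one_add_mul (c := (σ ^ 2)⁻¹)
    (by linarith [inv_pos.2 hs]) (postVar_nonneg hk hs X a)
    ((postVar_le_kernel hk hs X a).trans (hone a))
  have hinfo : m * postVar k (σ ^ 2) X a * Real.log (1 + (σ ^ 2)⁻¹) ≤ 2 * gamma k (σ ^ 2) m :=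
    calc m * postVar k (σ ^ 2) X a * Real.log (1 + (σ ^ 2)⁻¹)
      _ ≤ m * Real.log (1 + (σ ^ 2)⁻¹ * postVar k (σ ^ 2) X a) := by
        rw [mul_assoc]
        gcongr
      _ ≤ logDet k (σ ^ 2) X := hX a
      _ ≤ 2 * gamma k (σ ^ 2) m := by linarith [half_logDet_le_gamma k (σ ^ 2) X]
  rw [C1, one_div, inv_mul_eq_div, ← mul_div_assoc]
  exact (le_div_iff₀ hlog).2 hinfo

end InformationGain

section Greedy

variable {D : Type*} {k : D → D → ℝ} {s2 : ℝ} {t : ℕ}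

theorem varReduction_elim0 (X : Fin t → D) (a : D) : varReduction k s2 X a Fin.elim0 = 0 := by
  rw [varReduction, Fin.append_elim0, sub_eq_zero]
  rfl

theorem varReduction_comp_cast {m n : ℕ} (h : n = m) (X : Fin t → D) (a : D) (S : Fin m → D) :
    varReduction k s2 X a (S ∘ Fin.cast h) = varReduction k s2 X a S := by
  subst h
  rfl

theorem varReduction_append_singleton_le (hsub : SubmodularVarReduction k s2) {m : ℕ}
    (X : Fin t → D) (a : D) (S : Fin m → D) (b : D) :
    varReduction k s2 X a (Fin.append S ![b])
      ≤ varReduction k s2 X a S + varReduction k s2 X a ![b] := by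
  have h := hsub t 0 m X a Fin.elim0 S b
  simp only [Fin.elim0_append, Fin.append_cast_left, varReduction_comp_cast,
    varReduction_elim0] at h
  linarith

theorem varReduction_le_sum (hsub : SubmodularVarReduction k s2) {m : ℕ} (X : Fin t → D) (a : D)
    (S : Fin m → D) : varReduction k s2 X a S ≤ ∑ i, varReduction k s2 X a ![S i] := by
  induction m with
  | zero => rw [Subsingleton.elim S Fin.elim0, varReduction_elim0, Fin.sum_univ_zero]
  | succ m ih =>
    have hsnoc : Fin.append (Fin.init S) ![S (Fin.last m)] = S := by
      rw [Fin.append_right_eq_snoc]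
      exact Fin.snoc_init_self S
    calc varReduction k s2 X a S
      _ ≤ varReduction k s2 X a (Fin.init S) + varReduction k s2 X a ![S (Fin.last m)] := by
        conv_lhs => rw [← hsnoc]
        exact varReduction_append_singleton_le hsub X a _ _
      _ ≤ (∑ i : Fin m, varReduction k s2 X a ![S i.castSucc])
            + varReduction k s2 X a ![S (Fin.last m)] := by gcongr; exact ih (Fin.init S)
      _ = ∑ i, varReduction k s2 X a ![S i] :=
        (Fin.sum_univ_castSucc fun i => varReduction k s2 X a ![S i]).symm

theorem max_sub_le_sum_max_sub_max {ι : Type*} [Fintype ι] {v h : ℝ} {u : ι → ℝ}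
    (hu : ∀ i, u i ≤ v) (hsum : v - h ≤ ∑ i, (v - u i)) :
    max v h - h ≤ ∑ i, (max v h - max (u i) h) := by
  have hnonneg : ∀ i, 0 ≤ max v h - max (u i) h := fun i => sub_nonneg.2 (max_le_max_right h (hu i))
  rcases le_total v h with hvh | hhv
  · exact (sub_nonpos.2 (max_eq_right hvh).le).trans (Finset.sum_nonneg fun i _ => hnonneg i)
  by_cases hex : ∃ i, u i ≤ h
  · obtain ⟨i, hi⟩ := hex
    calc max v h - h = max v h - max (u i) h := by rw [max_eq_right hi]
      _ ≤ ∑ i, (max v h - max (u i) h) :=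
        Finset.single_le_sum (fun j _ => hnonneg j) (Finset.mem_univ i)
  · push Not at hex
    simpa only [max_eq_left hhv, max_eq_left (hex _).le] using hsum

/-- Total excess over `h` of the scaled posterior variances `b σ²` on `M`. The acquisition function
is the decrease of this quantity caused by one query, for `b = β₍ᵢ₎` and `h = η₍ᵢ₎²`. -/
noncomputable def excess (k : D → D → ℝ) (s2 b h : ℝ) (X : Fin t → D) (M : Finset D) : ℝ :=
  ∑ a ∈ M, (max (b * postVar k s2 X a) h - h)

theorem excess_mono (b h : ℝ) (X : Fin t → D) : Monotone (excess k s2 b h X) := fun _ _ hMN =>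
  Finset.sum_le_sum_of_subset_of_nonneg hMN fun _ _ _ => sub_nonneg.2 (le_max_right _ _)

theorem sub_le_excess (b h : ℝ) (X : Fin t → D) {M : Finset D} {a : D} (ha : a ∈ M) :
    b * postVar k s2 X a - h ≤ excess k s2 b h X M :=
  (sub_le_sub_right (le_max_left _ _) h).trans
    (Finset.single_le_sum (f := fun a => max (b * postVar k s2 X a) h - h)
      (fun _ _ => sub_nonneg.2 (le_max_right _ _)) ha)

theorem excess_le_card_mul (hk : (Matrix.of k).PosSemidef) (hs : 0 < s2) (hone : ∀ a, k a a ≤ 1)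
    {b h : ℝ} (hb : 0 ≤ b) (hh : 0 ≤ h) (X : Fin t → D) (M : Finset D) :
    excess k s2 b h X M ≤ M.card * b := by
  rw [← nsmul_eq_mul]
  refine Finset.sum_le_card_nsmul M _ b fun a _ => ?_
  have hvar : b * postVar k s2 X a ≤ b :=
    mul_le_of_le_one_right hb ((postVar_le_kernel hk hs X a).trans (hone a))
  rw [sub_le_iff_le_add]
  exact max_le (by linarith) (by linarith)

theorem acq_eq_excess_sub (p : Params) (X : Fin t → D) (s : State D) (a : D) :
    acq k p X s a = excess k p.s2 (p.beta s.epoch) (p.eta s.epoch ^ 2) X s.M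
      - excess k p.s2 (p.beta s.epoch) (p.eta s.epoch ^ 2) (Fin.append X ![a]) s.M := by
  simp only [acq, excess, Finset.sum_sub_distrib, sub_sub_sub_cancel_right]

/-- If the design `S` alone removes the whole excess, then by submodularity the decreases caused by
its single points add up to at least the excess. -/
theorem excess_le_sum_excess_sub (hk : (Matrix.of k).PosSemidef) (hs : 0 < s2)
    (hsub : SubmodularVarReduction k s2) {b h : ℝ} (hb : 0 ≤ b) {m : ℕ} (X : Fin t → D)
    {S : Fin m → D} (hS : ∀ a, b * postVar k s2 S a ≤ h) (M : Finset D) :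
    excess k s2 b h X M
      ≤ ∑ i, (excess k s2 b h X M - excess k s2 b h (Fin.append X ![S i]) M) := by
  simp only [excess, ← Finset.sum_sub_distrib, sub_sub_sub_cancel_right]
  rw [Finset.sum_comm]
  refine Finset.sum_le_sum fun a _ => max_sub_le_sum_max_sub_max (fun i => ?_) ?_
  · exact mul_le_mul_of_nonneg_left (postVar_append_le_left hk hs X _ a) hb
  calc b * postVar k s2 X a - h
    _ ≤ b * postVar k s2 X a - b * postVar k s2 (Fin.append X S) a := by
      have := mul_le_mul_of_nonneg_left (postVar_append_le_right hk hs X S a) hb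
      linarith [hS a]
    _ = b * varReduction k s2 X a S := by rw [varReduction, mul_sub]
    _ ≤ b * ∑ i, varReduction k s2 X a ![S i] := by gcongr; exact varReduction_le_sum hsub X a S
    _ = ∑ i, (b * postVar k s2 X a - b * postVar k s2 (Fin.append X ![S i]) a) := by
      simp only [varReduction, Finset.mul_sum, mul_sub]

end Greedy

section Epochs

variable {D : Type*} {k : D → D → ℝ} {p : Params}

/-- Assumptions on the parameters under which the `while` loop over the epochs terminates. -/
structure Params.Regular (p : Params) : Prop where
  s2_pos : 0 < p.s2
  dbar_pos : 0 < p.dbar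
  eta_pos : ∀ i, 0 < p.eta i
  eta_tendsto : Filter.Tendsto p.eta Filter.atTop (nhds 0)
  beta_bdd : ∃ b, 0 < b ∧ ∀ i, b ≤ p.beta i

theorem Params.Regular.beta_pos (hp : p.Regular) (i : ℕ) : 0 < p.beta i := by
  obtain ⟨b, hb, hle⟩ := hp.beta_bdd
  exact hb.trans_le (hle i)

section NextEpoch

variable {t m : ℕ}

theorem updateSets_M_subset (pb : Problem) (X : Fin t → D) (y : Fin t → ℝ) (s : State D) :
    (updateSets pb k p X y s).M ⊆ s.M := by
  cases pb <;> exact Finset.filter_subset _ _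

theorem updateSets_epoch (pb : Problem) (X : Fin t → D) (y : Fin t → ℝ) (s : State D) :
    (updateSets pb k p X y s).epoch = s.epoch := by
  cases pb <;> rfl

theorem EpochDone.append (hk : (Matrix.of k).PosSemidef) (hs : 0 < p.s2) {X : Fin t → D}
    {M N : Finset D} {i : ℕ} (h : EpochDone k p X M i) (hNM : N ⊆ M) (S : Fin m → D) :
    EpochDone k p (Fin.append X S) N i := fun a ha =>
  (mul_le_mul_of_nonneg_left (Real.sqrt_le_sqrt (postVar_append_le_left hk hs X S a))
    (Real.sqrt_nonneg _)).trans (h a (hNM ha))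

theorem exists_not_epochDone (hk : (Matrix.of k).PosSemidef) (hpos : ∀ a, 0 < k a a)
    (hp : p.Regular) (X : Fin t → D) {M : Finset D} (hM : M.Nonempty) (i : ℕ) :
    ∃ j, i ≤ j ∧ ¬ EpochDone k p X M j := by
  obtain ⟨a, ha⟩ := hM
  obtain ⟨b, hb, hle⟩ := hp.beta_bdd
  have hwidth : 0 < √b * √(postVar k p.s2 X a) :=
    mul_pos (Real.sqrt_pos.2 hb) (Real.sqrt_pos.2 (postVar_pos hk hp.s2_pos X (hpos a)))
  have htendsto : Filter.Tendsto (fun j => (1 + p.dbar) * p.eta j) Filter.atTop (nhds 0) := by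
    simpa only [mul_zero] using hp.eta_tendsto.const_mul (1 + p.dbar)
  obtain ⟨j, hij, hj⟩ :=
    ((Filter.eventually_ge_atTop i).and (htendsto.eventually_lt_const hwidth)).exists
  refine ⟨j, hij, fun hdone => (hdone a ha).not_gt (hj.trans_le ?_)⟩
  gcongr
  exact hle j

theorem le_nextEpoch (X : Fin t → D) (M : Finset D) (i : ℕ) : i ≤ nextEpoch k p X M i := by
  classical
  unfold nextEpoch
  split_ifs with h
  · exact (Nat.find_spec h).1
  · exact le_rfl

theorem not_epochDone_nextEpoch (hk : (Matrix.of k).PosSemidef) (hpos : ∀ a, 0 < k a a)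
    (hp : p.Regular) (X : Fin t → D) {M : Finset D} (hM : M.Nonempty) (i : ℕ) :
    ¬ EpochDone k p X M (nextEpoch k p X M i) := by
  classical
  rw [nextEpoch, dif_pos (exists_not_epochDone hk hpos hp X hM i)]
  exact (Nat.find_spec (exists_not_epochDone hk hpos hp X hM i)).2

theorem epochDone_of_lt_nextEpoch (X : Fin t → D) (M : Finset D) {i j : ℕ} (hij : i ≤ j)
    (hj : j < nextEpoch k p X M i) : EpochDone k p X M j := by
  classical
  unfold nextEpoch at hj
  split_ifs at hj with h
  · by_contra hdone
    exact Nat.find_min h hj ⟨hij, hdone⟩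
  · exact absurd hj hij.not_gt

end NextEpoch

/-- The points queried in the first `t` time steps, in the form in which they occur in `state`. -/
abbrev queries (x : ℕ → D) (t : ℕ) : Fin t → D := fun i => x i

theorem queries_append_singleton (x : ℕ → D) (t : ℕ) :
    Fin.append (queries x t) ![x t] = queries x (t + 1) := by
  rw [Fin.append_right_eq_snoc]
  ext i
  refine Fin.lastCases ?_ (fun i => ?_) i <;> simp [queries]

variable [Fintype D] {pb : Problem} {x : ℕ → D} {y : ℕ → ℝ}

theorem state_succ_M (t : ℕ) :
    (state pb k p x y (t + 1)).M
      = (updateSets pb k p (queries x (t + 1)) (fun i => y i) (state pb k p x y t)).M :=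
  rfl

theorem state_succ_epoch (t : ℕ) :
    (state pb k p x y (t + 1)).epoch
      = nextEpoch k p (queries x (t + 1)) (state pb k p x y (t + 1)).M
          (state pb k p x y t).epoch := by
  conv_rhs => rw [← updateSets_epoch (k := k) (p := p) pb (queries x (t + 1)) (fun i => y i)]
  rfl

theorem state_M_antitone (pb : Problem) (k : D → D → ℝ) (p : Params) (x : ℕ → D)
    (y : ℕ → ℝ) : Antitone fun t => (state pb k p x y t).M :=
  antitone_nat_of_succ_le fun t => by
    rw [state_succ_M]
    exact updateSets_M_subset _ _ _ _

theorem state_epoch_monotone (pb : Problem) (k : D → D → ℝ) (p : Params) (x : ℕ → D)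
    (y : ℕ → ℝ) : Monotone fun t => (state pb k p x y t).epoch :=
  monotone_nat_of_le_succ fun t => by
    rw [state_succ_epoch]
    exact le_nextEpoch _ _ _

theorem one_le_state_epoch (t : ℕ) : 1 ≤ (state pb k p x y t).epoch :=
  state_epoch_monotone pb k p x y (Nat.zero_le t)

theorem epochDone_of_lt_state_epoch (hk : (Matrix.of k).PosSemidef) (hs : 0 < p.s2) (t : ℕ) {j : ℕ}
    (hj : 1 ≤ j) (hjt : j < (state pb k p x y t).epoch) :
    EpochDone k p (queries x t) (state pb k p x y t).M j := by
  induction t with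
  | zero => exact absurd hjt hj.not_gt
  | succ t ih =>
    rcases lt_or_ge j (state pb k p x y t).epoch with hlt | hle
    · rw [← queries_append_singleton]
      exact (ih hlt).append hk hs (state_M_antitone pb k p x y t.le_succ) _
    · rw [state_succ_epoch] at hjt
      exact epochDone_of_lt_nextEpoch _ _ hle hjt

theorem not_epochDone_state_epoch (hk : (Matrix.of k).PosSemidef) (hpos : ∀ a, 0 < k a a)
    (hp : p.Regular) {t : ℕ} (ht : 1 ≤ t) (hM : (state pb k p x y t).M.Nonempty) :
    ¬ EpochDone k p (queries x t) (state pb k p x y t).M (state pb k p x y t).epoch := by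
  obtain ⟨t, rfl⟩ := Nat.exists_eq_add_of_le' ht
  rw [state_succ_epoch]
  exact not_epochDone_nextEpoch hk hpos hp _ hM _

end Epochs

section EpochLength

variable {D : Type*} [Fintype D] {k : D → D → ℝ} {p : Params} {pb : Problem} {x : ℕ → D}
  {y : ℕ → ℝ}

/-- `x` is a sequence of queries that always maximize the acquisition function, when the observed
values are `y`; the condition `IsRun.greedy` for a single outcome. -/
def IsGreedy (pb : Problem) (k : D → D → ℝ) (p : Params) (x : ℕ → D) (y : ℕ → ℝ) : Prop :=
  ∀ t a, acq k p (queries x t) (state pb k p x y t) a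
    ≤ acq k p (queries x t) (state pb k p x y t) (x t)

/-- The excess over `η₍ₑ₎²` of the posterior variances scaled with `β₍ₑ₎`, on `M_t` after time `t`.
The parameter `e` is the epoch whose length is estimated. -/
noncomputable def stateExcess (pb : Problem) (k : D → D → ℝ) (p : Params) (x : ℕ → D) (y : ℕ → ℝ)
    (e t : ℕ) : ℝ :=
  excess k p.s2 (p.beta e) (p.eta e ^ 2) (queries x t) (state pb k p x y t).M

theorem stateExcess_succ_le (hk : (Matrix.of k).PosSemidef) (hs : 0 < p.s2)
    (hsub : SubmodularVarReduction k p.s2) (hgreedy : IsGreedy pb k p x y) {e m t : ℕ}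
    (hβ : 0 ≤ p.beta e) (hm : 0 < m) {S : Fin m → D}
    (hS : ∀ a, p.beta e * postVar k p.s2 S a ≤ p.eta e ^ 2) (he : (state pb k p x y t).epoch = e) :
    stateExcess pb k p x y e (t + 1) ≤ (1 - 1 / m) * stateExcess pb k p x y e t := by
  have hm' : (0 : ℝ) < m := Nat.cast_pos.2 hm
  set M := (state pb k p x y t).M
  set Δ := excess k p.s2 (p.beta e) (p.eta e ^ 2) (queries x t) M
    - excess k p.s2 (p.beta e) (p.eta e ^ 2) (queries x (t + 1)) M
  have hbest : ∀ a, excess k p.s2 (p.beta e) (p.eta e ^ 2) (queries x t) M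
      - excess k p.s2 (p.beta e) (p.eta e ^ 2) (Fin.append (queries x t) ![a]) M ≤ Δ := fun a => by
    have := hgreedy t a
    rwa [acq_eq_excess_sub, acq_eq_excess_sub, he, queries_append_singleton] at this
  have hgain : stateExcess pb k p x y e t ≤ m * Δ :=
    calc stateExcess pb k p x y e t
      _ ≤ ∑ i, (excess k p.s2 (p.beta e) (p.eta e ^ 2) (queries x t) M
            - excess k p.s2 (p.beta e) (p.eta e ^ 2) (Fin.append (queries x t) ![S i]) M) :=
        excess_le_sum_excess_sub hk hs hsub hβ _ hS M
      _ ≤ ∑ _i : Fin m, Δ := Finset.sum_le_sum fun i _ => hbest (S i)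
      _ = m * Δ := by rw [Finset.sum_const, Finset.card_univ, Fintype.card_fin, nsmul_eq_mul]
  calc stateExcess pb k p x y e (t + 1)
    _ ≤ excess k p.s2 (p.beta e) (p.eta e ^ 2) (queries x (t + 1)) M :=
      excess_mono _ _ _ (state_M_antitone pb k p x y t.le_succ)
    _ = stateExcess pb k p x y e t - Δ := (sub_sub_cancel _ _).symm
    _ ≤ stateExcess pb k p x y e t - stateExcess pb k p x y e t / m :=
      sub_le_sub_left ((div_le_iff₀' hm').2 hgain) _
    _ = (1 - 1 / m) * stateExcess pb k p x y e t := by ring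

theorem stateExcess_add_le (hk : (Matrix.of k).PosSemidef) (hs : 0 < p.s2)
    (hsub : SubmodularVarReduction k p.s2) (hgreedy : IsGreedy pb k p x y) {e m t n : ℕ}
    (hβ : 0 ≤ p.beta e) (hm : 0 < m) {S : Fin m → D}
    (hS : ∀ a, p.beta e * postVar k p.s2 S a ≤ p.eta e ^ 2)
    (he : ∀ i < n, (state pb k p x y (t + i)).epoch = e) :
    stateExcess pb k p x y e (t + n) ≤ (1 - 1 / m) ^ n * stateExcess pb k p x y e t := by
  have hratio : (0 : ℝ) ≤ 1 - 1 / m := sub_nonneg.2 (div_le_one_of_le₀ (by exact_mod_cast hm)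
    (Nat.cast_nonneg m))
  induction n with
  | zero => simp
  | succ n ih =>
    calc stateExcess pb k p x y e (t + n + 1)
      _ ≤ (1 - 1 / m) * stateExcess pb k p x y e (t + n) :=
        stateExcess_succ_le hk hs hsub hgreedy hβ hm hS (he n n.lt_succ_self)
      _ ≤ (1 - 1 / m) * ((1 - 1 / m) ^ n * stateExcess pb k p x y e t) := by
        gcongr
        exact ih fun i hi => he i (hi.trans n.lt_succ_self)
      _ = (1 - 1 / m) ^ (n + 1) * stateExcess pb k p x y e t := by ring

theorem sqrt_mul_sqrt_le_iff {b v c : ℝ} (hb : 0 ≤ b) (hc : 0 ≤ c) :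
    √b * √v ≤ c ↔ b * v ≤ c ^ 2 := by
  rw [← Real.sqrt_mul hb, Real.sqrt_le_left hc]

theorem lt_stateExcess_of_not_epochDone {e t : ℕ} (hβ : 0 ≤ p.beta e)
    (hη : 0 ≤ (1 + p.dbar) * p.eta e)
    (hdone : ¬ EpochDone k p (queries x t) (state pb k p x y t).M e) :
    ((1 + p.dbar) ^ 2 - 1) * p.eta e ^ 2 < stateExcess pb k p x y e t := by
  simp only [EpochDone, sqrt_mul_sqrt_le_iff hβ hη] at hdone
  push Not at hdone
  obtain ⟨a, ha, hlt⟩ := hdone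
  calc ((1 + p.dbar) ^ 2 - 1) * p.eta e ^ 2
    _ = ((1 + p.dbar) * p.eta e) ^ 2 - p.eta e ^ 2 := by ring
    _ < p.beta e * postVar k p.s2 (queries x t) a - p.eta e ^ 2 := sub_lt_sub_right hlt _
    _ ≤ stateExcess pb k p x y e t := sub_le_excess _ _ _ ha

theorem one_sub_inv_pow_le_exp {m : ℕ} (hm : 0 < m) (n : ℕ) :
    (1 - 1 / m : ℝ) ^ n ≤ Real.exp (-(n / m)) := by
  rw [show -((n : ℝ) / m) = n * -(1 / m) by ring, Real.exp_nat_mul]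
  refine pow_le_pow_left₀ (sub_nonneg.2 (div_le_one_of_le₀ ?_ m.cast_nonneg))
    (Real.one_sub_le_exp_neg _) n
  exact_mod_cast hm

/-- A certificate that epoch `e` ends within `n` steps: `m` queries suffice to bring all variances
to the target, and `n / m` is so large that the factor `(1 - 1 / m) ^ n` brings the excess from its
largest possible value `|D| β₍ₑ₎` below the value at which the epoch ends. -/
def EpochBound (k : D → D → ℝ) (p : Params) (e n : ℕ) : Prop :=
  ∃ m : ℕ, 0 < m ∧ (∃ S : Fin m → D, ∀ a, p.beta e * postVar k p.s2 S a ≤ p.eta e ^ 2) ∧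
    Fintype.card D * p.beta e * Real.exp (-(n / m)) ≤ ((1 + p.dbar) ^ 2 - 1) * p.eta e ^ 2

theorem EpochBound.lt_state_epoch {e n : ℕ} (hn : EpochBound k p e n)
    (hk : (Matrix.of k).PosSemidef) (hone : ∀ a, k a a = 1) (hsub : SubmodularVarReduction k p.s2)
    (hp : p.Regular) (hgreedy : IsGreedy pb k p x y) {t : ℕ} (ht : e ≤ (state pb k p x y t).epoch)
    (htn : 1 ≤ t + n) (hM : (state pb k p x y (t + n)).M.Nonempty) :
    e < (state pb k p x y (t + n)).epoch := by
  obtain ⟨m, hm, ⟨S, hS⟩, hexp⟩ := hn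
  have hβ := hp.beta_pos e
  by_contra! hle
  have hepoch : ∀ i ≤ n, (state pb k p x y (t + i)).epoch = e := fun i hi =>
    le_antisymm ((state_epoch_monotone pb k p x y (by omega)).trans hle)
      (ht.trans (state_epoch_monotone pb k p x y (t.le_add_right i)))
  have hnot_done : ¬ EpochDone k p (queries x (t + n)) (state pb k p x y (t + n)).M e := by
    rw [← hepoch n le_rfl]
    exact not_epochDone_state_epoch hk (fun a => (hone a).ge.trans_lt' one_pos) hp htn hM
  have hinit : stateExcess pb k p x y e t ≤ Fintype.card D * p.beta e :=
    (excess_le_card_mul hk hp.s2_pos (fun a => (hone a).le) hβ.le (sq_nonneg _) _ _).trans (by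
      gcongr
      exact Finset.card_le_univ _)
  refine lt_irrefl (stateExcess pb k p x y e (t + n)) ?_
  calc stateExcess pb k p x y e (t + n)
    _ ≤ (1 - 1 / m) ^ n * stateExcess pb k p x y e t :=
      stateExcess_add_le hk hp.s2_pos hsub hgreedy hβ.le hm hS fun i hi => hepoch i hi.le
    _ ≤ Real.exp (-(n / m)) * (Fintype.card D * p.beta e) :=
      mul_le_mul (one_sub_inv_pow_le_exp hm n) hinit
        (Finset.sum_nonneg fun _ _ => sub_nonneg.2 (le_max_right _ _)) (Real.exp_pos _).le
    _ ≤ ((1 + p.dbar) ^ 2 - 1) * p.eta e ^ 2 := by rwa [mul_comm]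
    _ < stateExcess pb k p x y e (t + n) :=
      lt_stateExcess_of_not_epochDone hβ.le
        (mul_nonneg (by linarith [hp.dbar_pos]) (hp.eta_pos e).le) hnot_done

theorem le_state_epoch_of_sum_le (hk : (Matrix.of k).PosSemidef) (hone : ∀ a, k a a = 1)
    (hsub : SubmodularVarReduction k p.s2) (hp : p.Regular) (hgreedy : IsGreedy pb k p x y)
    {i₀ N₀ : ℕ} {n : ℕ → ℕ} (hN₀ : 1 ≤ N₀) (hn : ∀ e, i₀ ≤ e → EpochBound k p e (n e))
    (hstart : (state pb k p x y N₀).M.Nonempty → i₀ ≤ (state pb k p x y N₀).epoch) (j : ℕ)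
    (hM : (state pb k p x y (N₀ + ∑ i ∈ Finset.range j, n (i₀ + i))).M.Nonempty) :
    i₀ + j ≤ (state pb k p x y (N₀ + ∑ i ∈ Finset.range j, n (i₀ + i))).epoch := by
  induction j with
  | zero => exact hstart hM
  | succ j ih =>
    rw [Finset.sum_range_succ, ← add_assoc N₀] at hM ⊢
    exact (hn (i₀ + j) (Nat.le_add_right _ _)).lt_state_epoch hk hone hsub hp hgreedy
      (ih (hM.mono (state_M_antitone pb k p x y (Nat.le_add_right _ _)))) (by omega) hM

end EpochLength

section Accuracy

theorem ucb_sub_lcb {D : Type*} (k : D → D → ℝ) (s2 b : ℝ) {t : ℕ} (X : Fin t → D)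
    (y : Fin t → ℝ) (a : D) :
    ucb k s2 b X y a - lcb k s2 b X y a = 2 * (√b * √(postVar k s2 X a)) := by
  unfold ucb lcb
  ring

variable {D : Type*} [Fintype D] {k : D → D → ℝ} {p : Params} {pb : Problem} {x : ℕ → D}
  {y : ℕ → ℝ} {f : D → ℝ}

/-- The confidence intervals with parameter `c` that are based on the first `t + 1` observations
contain the values of `f`. -/
def Covers (k : D → D → ℝ) (s2 : ℝ) (x : ℕ → D) (y : ℕ → ℝ) (f : D → ℝ) (t : ℕ) (c : ℝ) : Prop :=
  ∀ a, |f a - postMean k s2 (queries x (t + 1)) (fun i => y i) a|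
    ≤ √c * √(postVar k s2 (queries x (t + 1)) a)

/-- All confidence intervals used by a run contain the values of `f`: the good event of the
analysis, at a single outcome. Nothing is required once `M` is empty. -/
def Confident (pb : Problem) (k : D → D → ℝ) (p : Params) (x : ℕ → D) (y : ℕ → ℝ) (f : D → ℝ) :
    Prop :=
  ∀ t, (state pb k p x y t).M.Nonempty →
    Covers k p.s2 x y f t (p.beta (state pb k p x y t).epoch)

theorem Confident.lcb_le (hc : Confident pb k p x y f) {t : ℕ}
    (hM : (state pb k p x y t).M.Nonempty) (a : D) :
    lcb k p.s2 (p.beta (state pb k p x y t).epoch) (queries x (t + 1)) (fun i => y i) a ≤ f a := by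
  unfold lcb
  linarith [(abs_le.1 (hc t hM a)).1]

theorem Confident.le_ucb (hc : Confident pb k p x y f) {t : ℕ}
    (hM : (state pb k p x y t).M.Nonempty) (a : D) :
    f a ≤ ucb k p.s2 (p.beta (state pb k p x y t).epoch) (queries x (t + 1)) (fun i => y i) a := by
  unfold ucb
  linarith [(abs_le.1 (hc t hM a)).2]

theorem Confident.mem_state_M (hc : Confident .bo k p x y f) {c : D} (hmax : ∀ a, f a ≤ f c)
    (t : ℕ) : c ∈ (state .bo k p x y t).M := by
  induction t with
  | zero => exact Finset.mem_univ c
  | succ t ih =>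
    exact Finset.mem_filter.2 ⟨ih, fun a _ =>
      (hc.lcb_le ⟨c, ih⟩ a).trans ((hmax a).trans (hc.le_ucb ⟨c, ih⟩ c))⟩

theorem Confident.lt_of_mem_state_H {h : ℝ} (hc : Confident (.lse h) k p x y f) {t : ℕ} {a : D}
    (ha : a ∈ (state (.lse h) k p x y t).H) : h < f a := by
  induction t with
  | zero => exact absurd ha (Finset.notMem_empty a)
  | succ t ih =>
    classical
    rcases Finset.mem_union.1 ha with hH | hM
    · exact ih hH
    · obtain ⟨haM, hlt⟩ := Finset.mem_filter.1 hM
      exact hlt.trans_le (hc.lcb_le ⟨a, haM⟩ a)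

theorem Confident.lt_of_mem_state_L {h : ℝ} (hc : Confident (.lse h) k p x y f) {t : ℕ} {a : D}
    (ha : a ∈ (state (.lse h) k p x y t).L) : f a < h := by
  induction t with
  | zero => exact absurd ha (Finset.notMem_empty a)
  | succ t ih =>
    classical
    rcases Finset.mem_union.1 ha with hL | hM
    · exact ih hL
    · obtain ⟨haM, hlt⟩ := Finset.mem_filter.1 hM
      exact (hc.le_ucb ⟨a, haM⟩ a).trans_lt hlt

theorem Confident.accurate (hc : Confident pb k p x y f) {ε : ℝ} {t T : ℕ} (htT : t + 1 ≤ T)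
    (hwidth : ∀ a ∈ (state pb k p x y t).M, 4 * (√(p.beta (state pb k p x y t).epoch)
      * √(postVar k p.s2 (queries x (t + 1)) a)) ≤ ε) :
    Accurate pb ε f (state pb k p x y T) := by
  have hsubset := state_M_antitone pb k p x y htT
  have hlength : ∀ a ∈ (state pb k p x y t).M,
      2 * (ucb k p.s2 (p.beta (state pb k p x y t).epoch) (queries x (t + 1)) (fun i => y i) a
        - lcb k p.s2 (p.beta (state pb k p x y t).epoch) (queries x (t + 1)) (fun i => y i) a)
          ≤ ε := fun a ha => by
    rw [ucb_sub_lcb]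
    linarith [hwidth a ha]
  cases pb with
  | bo =>
    refine fun c hmax => ⟨hc.mem_state_M hmax T, fun a ha => ?_⟩
    have hct := hc.mem_state_M hmax t
    obtain ⟨hat, hcmp⟩ := Finset.mem_filter.1 (hsubset ha)
    linarith [hcmp c hct, hc.le_ucb ⟨c, hct⟩ c, hc.lcb_le ⟨c, hct⟩ a, hlength a hat,
      hlength c hct]
  | lse h =>
    refine ⟨fun a => hc.lt_of_mem_state_H, fun a => hc.lt_of_mem_state_L, fun a ha => ?_⟩
    obtain ⟨hat, hu, hl⟩ := Finset.mem_filter.1 (hsubset ha)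
    rw [abs_le]
    constructor <;>
      linarith [hc.lcb_le ⟨a, hat⟩ a, hc.le_ucb ⟨a, hat⟩ a, hlength a hat]

end Accuracy

section GaussianTail

open scoped NNReal ENNReal

variable {v : ℝ≥0}

theorem gaussianReal_Iio_neg (v : ℝ≥0) (u : ℝ) :
    gaussianReal 0 v (Set.Iio (-u)) = gaussianReal 0 v (Set.Ioi u) := by
  have hsymm : (gaussianReal 0 v).map (fun x => -x) = gaussianReal 0 v := by
    rw [gaussianReal_map_neg, neg_zero]
  conv_lhs => rw [← hsymm]
  rw [Measure.map_apply measurable_neg measurableSet_Iio, Set.neg_preimage, Set.neg_Iio, neg_neg]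

theorem two_mul_gaussianReal_Ioi_le (v : ℝ≥0) : 2 * gaussianReal 0 v (Set.Ioi 0) ≤ 1 := by
  have hdisj : Disjoint (Set.Ioi (0 : ℝ)) (Set.Iio 0) :=
    Set.disjoint_left.2 fun _ h₁ h₂ => lt_asymm (Set.mem_Ioi.1 h₁) (Set.mem_Iio.1 h₂)
  rw [two_mul]
  nth_rewrite 2 [← gaussianReal_Iio_neg]
  rw [neg_zero, ← measure_union hdisj measurableSet_Iio]
  exact prob_le_one

/-- The density satisfies `φ (x + s) ≤ exp (-s² / 2v) φ x` for `x > 0`. Comparison with the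
half-line from `0` saves the factor `2` that the Chernoff bound loses in the two-sided estimate. -/
theorem gaussianReal_Ioi_le (hv : v ≠ 0) {s : ℝ} (hs : 0 ≤ s) :
    gaussianReal 0 v (Set.Ioi s)
      ≤ ENNReal.ofReal (Real.exp (-(s ^ 2 / (2 * v)))) * gaussianReal 0 v (Set.Ioi 0) := by
  have hshift : gaussianReal 0 v (Set.Ioi s) = gaussianReal (0 - s) v (Set.Ioi 0) := by
    rw [← gaussianReal_map_sub_const s, Measure.map_apply (by fun_prop) measurableSet_Ioi,
      Set.preimage_sub_const_Ioi, zero_add]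
  rw [hshift, gaussianReal_apply _ hv, gaussianReal_apply _ hv,
    ← lintegral_const_mul _ (measurable_gaussianPDF _ _)]
  refine setLIntegral_mono ((measurable_gaussianPDF _ _).const_mul _) fun x (hx : 0 < x) => ?_
  rw [gaussianPDF, gaussianPDF, ← ENNReal.ofReal_mul (Real.exp_pos _).le]
  refine ENNReal.ofReal_le_ofReal ?_
  rw [gaussianPDFReal, gaussianPDFReal, mul_left_comm, ← Real.exp_add, ← neg_div, ← add_div]
  gcongr
  nlinarith

theorem gaussianReal_abs_gt_le (hv : v ≠ 0) {s : ℝ} (hs : 0 ≤ s) :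
    gaussianReal 0 v {x | s < |x|} ≤ ENNReal.ofReal (Real.exp (-(s ^ 2 / (2 * v)))) := by
  have hsub : {x : ℝ | s < |x|} ⊆ Set.Ioi s ∪ Set.Iio (-s) := fun x (hx : s < |x|) =>
    (lt_abs.1 hx).imp id lt_neg.1
  calc gaussianReal 0 v {x | s < |x|}
    _ ≤ gaussianReal 0 v (Set.Ioi s) + gaussianReal 0 v (Set.Iio (-s)) :=
      (measure_mono hsub).trans (measure_union_le _ _)
    _ = 2 * gaussianReal 0 v (Set.Ioi s) := by rw [gaussianReal_Iio_neg, two_mul]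
    _ ≤ 2 * (ENNReal.ofReal (Real.exp (-(s ^ 2 / (2 * v)))) * gaussianReal 0 v (Set.Ioi 0)) := by
      gcongr
      exact gaussianReal_Ioi_le hv hs
    _ = ENNReal.ofReal (Real.exp (-(s ^ 2 / (2 * v)))) * (2 * gaussianReal 0 v (Set.Ioi 0)) := by
      ring
    _ ≤ ENNReal.ofReal (Real.exp (-(s ^ 2 / (2 * v)))) :=
      mul_le_of_le_one_right' (two_mul_gaussianReal_Ioi_le v)

end GaussianTail

section Residual

variable {D Ω : Type*} [MeasurableSpace Ω] {P : Measure Ω} {k : D → D → ℝ} {s2 : ℝ}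
  {f : D → Ω → ℝ} {z : ℕ → Ω → ℝ} {t : ℕ}

/-- The vector of noisy observations at the nonrandom points `X`. -/
def fixedObs (f : D → Ω → ℝ) (z : ℕ → Ω → ℝ) (X : Fin t → D) (ω : Ω) : Fin t → ℝ :=
  fun i => f (X i) ω + z i ω

/-- The error `f a - μ_t a` of the posterior mean at `a` when the nonrandom points `X` are
observed. -/
noncomputable def residual (k : D → D → ℝ) (s2 : ℝ) (f : D → Ω → ℝ) (z : ℕ → Ω → ℝ)
    (X : Fin t → D) (a : D) (ω : Ω) : ℝ :=
  f a ω - optWeights k s2 X a ⬝ᵥ fixedObs f z X ω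

namespace IsModel

theorem measurable_fixedObs (h : IsModel P k s2 f z) (X : Fin t → D) :
    Measurable (fixedObs f z X) :=
  measurable_pi_lambda _ fun i => (h.measurable_f (X i)).add (h.measurable_z i)

theorem hasGaussianLaw_z (h : IsModel P k s2 f z) (i : ℕ) : HasGaussianLaw (z i) P := by
  have : IsGaussian (P.map (z i)) := by
    rw [h.law_z]
    infer_instance
  exact IsGaussian.hasGaussianLaw

theorem hasGaussianLaw_residual_fixedObs [Finite D] (h : IsModel P k s2 f z) (X : Fin t → D)
    (a : D) :
    HasGaussianLaw (fun ω => ((fun _ : Unit => residual k s2 f z X a ω), fixedObs f z X ω)) P := by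
  have := Fintype.ofFinite D
  have := h.gaussian_f.isProbabilityMeasure
  have hf : HasGaussianLaw (fun ω a => f a ω) P :=
    (h.gaussian_f.hasGaussianLaw Finset.univ).map
      (ContinuousLinearMap.pi fun a : D => ContinuousLinearMap.proj (R := ℝ)
        (φ := fun _ : (Finset.univ : Finset D) => ℝ) ⟨a, Finset.mem_univ a⟩)
  have hz : HasGaussianLaw (fun ω (i : Fin t) => z i ω) P :=
    iIndepFun.hasGaussianLaw (fun i => h.hasGaussianLaw_z i) (h.indep_z.precomp Fin.val_injective)
  have hindep : IndepFun (fun ω a => f a ω) (fun ω (i : Fin t) => z i ω) P :=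
    h.indep_f_z.comp (φ := id) (ψ := fun (y : ℕ → ℝ) (i : Fin t) => y i) measurable_id
      (by fun_prop)
  let obsMap : ((D → ℝ) × (Fin t → ℝ)) →ₗ[ℝ] (Fin t → ℝ) :=
    LinearMap.funLeft ℝ ℝ X ∘ₗ LinearMap.fst ℝ _ _ + LinearMap.snd ℝ _ _
  let resMap : ((D → ℝ) × (Fin t → ℝ)) →ₗ[ℝ] ℝ :=
    LinearMap.proj a ∘ₗ LinearMap.fst ℝ _ _
      - dotProductBilin ℝ ℝ (optWeights k s2 X a) ∘ₗ obsMap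
  exact (hindep.hasGaussianLaw hf hz).map
    (LinearMap.toContinuousLinearMap ((LinearMap.pi fun _ : Unit => resMap).prod obsMap))

theorem memLp_f (h : IsModel P k s2 f z) (a : D) : MemLp (f a) 2 P :=
  (h.gaussian_f.hasGaussianLaw_eval a).memLp_two

theorem memLp_z (h : IsModel P k s2 f z) (i : ℕ) : MemLp (z i) 2 P :=
  (h.hasGaussianLaw_z i).memLp_two

theorem memLp_fixedObs (h : IsModel P k s2 f z) (X : Fin t → D) (i : Fin t) :
    MemLp (fun ω => fixedObs f z X ω i) 2 P :=
  (h.memLp_f (X i)).add (h.memLp_z i)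

theorem memLp_dotProduct_fixedObs (h : IsModel P k s2 f z) (X : Fin t → D) (w : Fin t → ℝ) :
    MemLp (fun ω => w ⬝ᵥ fixedObs f z X ω) 2 P :=
  memLp_finsetSum _ fun i _ => (h.memLp_fixedObs X i).const_mul (w i)

theorem memLp_residual (h : IsModel P k s2 f z) (X : Fin t → D) (a : D) :
    MemLp (residual k s2 f z X a) 2 P :=
  (h.memLp_f a).sub (h.memLp_dotProduct_fixedObs X _)

theorem integral_z (h : IsModel P k s2 f z) (i : ℕ) : ∫ ω, z i ω ∂P = 0 := by
  have := integral_map (μ := P) (φ := z i) (f := id) (h.measurable_z i).aemeasurable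
    aestronglyMeasurable_id
  rw [h.law_z] at this
  exact this.symm.trans integral_id_gaussianReal

theorem integral_residual (h : IsModel P k s2 f z) (X : Fin t → D) (a : D) :
    ∫ ω, residual k s2 f z X a ω ∂P = 0 := by
  have := h.gaussian_f.isProbabilityMeasure
  have hobs : ∀ i, ∫ ω, fixedObs f z X ω i ∂P = 0 := fun i => by
    unfold fixedObs
    rw [integral_add ((h.memLp_f _).integrable one_le_two) ((h.memLp_z _).integrable one_le_two),
      h.mean_f, h.integral_z, add_zero]
  refine (integral_sub ((h.memLp_f a).integrable one_le_two)
    ((h.memLp_dotProduct_fixedObs X _).integrable one_le_two)).trans ?_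
  unfold dotProduct
  rw [h.mean_f,
    integral_finsetSum _ fun i _ => ((h.memLp_fixedObs X i).const_mul _).integrable one_le_two]
  simp only [integral_const_mul, hobs, mul_zero, Finset.sum_const_zero, sub_zero]

theorem cov_f_z (h : IsModel P k s2 f z) (a : D) (i : ℕ) : cov[f a, z i; P] = 0 := by
  have hindep : IndepFun (f a) (z i) P :=
    h.indep_f_z.comp (φ := fun g : D → ℝ => g a) (ψ := fun y : ℕ → ℝ => y i)
      (by fun_prop) (by fun_prop)
  exact hindep.covariance_eq_zero (h.memLp_f a) (h.memLp_z i)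

theorem cov_z_z (h : IsModel P k s2 f z) (hs : 0 ≤ s2) (i j : ℕ) :
    cov[z i, z j; P] = if i = j then s2 else 0 := by
  have hz := (h.measurable_z i).aemeasurable (μ := P)
  split_ifs with hij
  · subst hij
    rw [covariance_self hz, ← Function.id_comp (z i), ← variance_map aemeasurable_id hz, h.law_z,
      variance_id_gaussianReal, Real.coe_toNNReal _ hs]
  · have := h.gaussian_f.isProbabilityMeasure
    exact (h.indep_z.indepFun hij).covariance_eq_zero (h.memLp_z i) (h.memLp_z j)

theorem cov_f_fixedObs (h : IsModel P k s2 f z) (X : Fin t → D) (i : Fin t) (a : D) :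
    cov[f a, fun ω => fixedObs f z X ω i; P] = k a (X i) := by
  have := h.gaussian_f.isProbabilityMeasure
  refine (covariance_add_right (h.memLp_f a) (h.memLp_f (X i)) (h.memLp_z i)).trans ?_
  rw [h.cov_f_z, h.cov_f, add_zero]

theorem cov_fixedObs (h : IsModel P k s2 f z) (hs : 0 ≤ s2) (X : Fin t → D) (i j : Fin t) :
    cov[fun ω => fixedObs f z X ω i, fun ω => fixedObs f z X ω j; P] = noisyGram k s2 X i j := by
  have := h.gaussian_f.isProbabilityMeasure
  have hnoise : cov[z i, fun ω => fixedObs f z X ω j; P] = if (i : ℕ) = j then s2 else 0 := by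
    refine (covariance_add_right (h.memLp_z i) (h.memLp_f (X j)) (h.memLp_z j)).trans ?_
    rw [covariance_comm, h.cov_f_z, h.cov_z_z hs, zero_add]
  refine (covariance_add_left (h.memLp_f (X i)) (h.memLp_z i) (h.memLp_fixedObs X j)).trans ?_
  rw [h.cov_f_fixedObs, hnoise]
  simp [gram, Matrix.one_apply, Fin.val_inj]

theorem cov_residual_left (h : IsModel P k s2 f z) (X : Fin t → D) (a : D) {Y : Ω → ℝ}
    (hY : MemLp Y 2 P) :
    cov[residual k s2 f z X a, Y; P]
      = cov[f a, Y; P]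
        - optWeights k s2 X a ⬝ᵥ fun i => cov[fun ω => fixedObs f z X ω i, Y; P] := by
  have := h.gaussian_f.isProbabilityMeasure
  refine (covariance_fun_sub_left (h.memLp_f a) (h.memLp_dotProduct_fixedObs X _) hY).trans ?_
  unfold dotProduct
  rw [covariance_fun_sum_left (fun i => (h.memLp_fixedObs X i).const_mul _) hY]
  simp only [covariance_const_mul_left]

/-- This is the system of normal equations that determines `optWeights`. -/
theorem cov_residual_fixedObs (h : IsModel P k s2 f z) (hk : (Matrix.of k).PosSemidef)
    (hs : 0 < s2) (X : Fin t → D) (a : D) (j : Fin t) :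
    cov[residual k s2 f z X a, fun ω => fixedObs f z X ω j; P] = 0 := by
  rw [h.cov_residual_left X a (h.memLp_fixedObs X j), h.cov_f_fixedObs, sub_eq_zero,
    kernel_symm hk]
  simp only [h.cov_fixedObs hs.le]
  calc k (X j) a
    _ = (noisyGram k s2 X *ᵥ optWeights k s2 X a) j := by
      rw [noisyGram_mulVec_optWeights hk hs]
      rfl
    _ = optWeights k s2 X a ⬝ᵥ fun i => noisyGram k s2 X i j := by
      rw [← Matrix.vecMul_transpose, noisyGram_transpose hk]
      rfl

theorem variance_residual (h : IsModel P k s2 f z) (hk : (Matrix.of k).PosSemidef) (hs : 0 < s2)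
    (X : Fin t → D) (a : D) : Var[residual k s2 f z X a; P] = postVar k s2 X a := by
  have := h.gaussian_f.isProbabilityMeasure
  have hres := h.memLp_residual X a
  have hpred : cov[residual k s2 f z X a, fun ω => optWeights k s2 X a ⬝ᵥ fixedObs f z X ω; P]
      = 0 := by
    unfold dotProduct
    rw [covariance_fun_sum_right (fun i => (h.memLp_fixedObs X i).const_mul _) hres]
    simp only [covariance_const_mul_right, h.cov_residual_fixedObs hk hs, mul_zero,
      Finset.sum_const_zero]
  calc Var[residual k s2 f z X a; P]
    _ = cov[residual k s2 f z X a, residual k s2 f z X a; P] :=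
      (covariance_self hres.aestronglyMeasurable.aemeasurable).symm
    _ = cov[residual k s2 f z X a, f a; P] := by
      refine (covariance_fun_sub_right hres (h.memLp_f a)
        (h.memLp_dotProduct_fixedObs X _)).trans ?_
      rw [hpred, sub_zero]
    _ = postVar k s2 X a := by
      rw [h.cov_residual_left X a (h.memLp_f a), h.cov_f, postVar_eq_sub]
      simp only [covariance_comm _ (f a), h.cov_f_fixedObs, kernel_symm hk a]
      rfl

theorem indepFun_residual [Finite D] (h : IsModel P k s2 f z) (hk : (Matrix.of k).PosSemidef)
    (hs : 0 < s2) (X : Fin t → D) (a : D) :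
    IndepFun (residual k s2 f z X a) (fixedObs f z X) P :=
  ((h.hasGaussianLaw_residual_fixedObs X a).indepFun_of_covariance_eval
    (fun _ j => h.cov_residual_fixedObs hk hs X a j)).comp
    (φ := fun g : Unit → ℝ => g ()) (ψ := id) (by fun_prop) measurable_id

theorem map_residual_eq_gaussianReal [Finite D] (h : IsModel P k s2 f z)
    (hk : (Matrix.of k).PosSemidef) (hs : 0 < s2) (X : Fin t → D) (a : D) :
    P.map (residual k s2 f z X a) = gaussianReal 0 (postVar k s2 X a).toNNReal := by
  have hgauss : HasGaussianLaw (residual k s2 f z X a) P :=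
    (h.hasGaussianLaw_residual_fixedObs X a).fst.map
      (ContinuousLinearMap.proj (R := ℝ) (φ := fun _ : Unit => ℝ) ())
  rw [hgauss.map_eq_gaussianReal, h.integral_residual, h.variance_residual hk hs]

theorem measure_residual_gt_le [Finite D] (h : IsModel P k s2 f z)
    (hk : (Matrix.of k).PosSemidef) (hs : 0 < s2) (X : Fin t → D) {a : D} (ha : 0 < k a a) {c : ℝ}
    (hc : 0 ≤ c) :
    P {ω | √c * √(postVar k s2 X a) < |residual k s2 f z X a ω|}
      ≤ ENNReal.ofReal (Real.exp (-(c / 2))) := by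
  have hvar := postVar_pos hk hs X ha
  have hset : MeasurableSet {u : ℝ | √c * √(postVar k s2 X a) < |u|} :=
    measurableSet_lt measurable_const (by fun_prop)
  have hexponent : (√c * √(postVar k s2 X a)) ^ 2 / (2 * (postVar k s2 X a).toNNReal) = c / 2 := by
    rw [mul_pow, Real.sq_sqrt hc, Real.sq_sqrt hvar.le, Real.coe_toNNReal _ hvar.le]
    field_simp
  calc P {ω | √c * √(postVar k s2 X a) < |residual k s2 f z X a ω|}
    _ = P.map (residual k s2 f z X a) {u | √c * √(postVar k s2 X a) < |u|} :=
      (Measure.map_apply_of_aemeasurable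
        (h.memLp_residual X a).aestronglyMeasurable.aemeasurable hset).symm
    _ ≤ ENNReal.ofReal (Real.exp (-(c / 2))) := by
      rw [h.map_residual_eq_gaussianReal hk hs, ← hexponent]
      exact gaussianReal_abs_gt_le (Real.toNNReal_pos.2 hvar).ne' (by positivity)

end IsModel

end Residual

section Adaptive

variable {D Ω : Type*} {f : D → Ω → ℝ} {z : ℕ → Ω → ℝ} {x : ℕ → Ω → D}

theorem obs_eq_fixedObs {t : ℕ} {X : Fin t → D} {ω : Ω} (hX : queries (x · ω) t = X) :
    (fun i : Fin t => obs f z x i ω) = fixedObs f z X ω := by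
  subst hX
  rfl

/-- Every query is a function of the past observations; the condition `IsRun.nonanticipating`. -/
def Nonanticipating (f : D → Ω → ℝ) (z : ℕ → Ω → ℝ) (x : ℕ → Ω → D) : Prop :=
  ∀ t d, MeasurableSet[⨆ s : Fin t, MeasurableSpace.comap (obs f z x s) inferInstance]
    {ω | x t ω = d}

theorem Nonanticipating.exists_preimage (hx : Nonanticipating f z x) (t : ℕ) (X : Fin t → D) :
    ∃ B : Set (Fin t → ℝ), MeasurableSet B ∧
      {ω | queries (x · ω) t = X} = fixedObs f z X ⁻¹' B := by
  induction t with
  | zero => exact ⟨Set.univ, MeasurableSet.univ, Set.eq_univ_of_forall fun ω =>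
      Subsingleton.elim _ _⟩
  | succ t ih =>
    obtain ⟨B₀, hB₀, hpast⟩ := ih (Fin.init X)
    have hcomap : (⨆ s : Fin t, MeasurableSpace.comap (obs f z x s) inferInstance)
        = MeasurableSpace.comap (fun ω (s : Fin t) => obs f z x s ω) MeasurableSpace.pi := by
      rw [MeasurableSpace.pi, MeasurableSpace.comap_iSup]
      simp only [MeasurableSpace.comap_comp]
      rfl
    have hlast := hx t (X (Fin.last t))
    rw [hcomap] at hlast
    obtain ⟨B₁, hB₁, hlast⟩ := hlast
    refine ⟨Fin.init ⁻¹' (B₀ ∩ B₁), (hB₀.inter hB₁).preimage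
      (measurable_pi_lambda _ fun i => measurable_pi_apply i.castSucc), Set.ext fun ω => ?_⟩
    have hpast_iff : queries (x · ω) t = Fin.init X ↔ fixedObs f z (Fin.init X) ω ∈ B₀ :=
      Set.ext_iff.1 hpast ω
    have hlast_iff : (fun s : Fin t => obs f z x s ω) ∈ B₁ ↔ x t ω = X (Fin.last t) :=
      Set.ext_iff.1 hlast ω
    calc queries (x · ω) (t + 1) = X
      _ ↔ queries (x · ω) t = Fin.init X ∧ x t ω = X (Fin.last t) := by
        simp only [funext_iff, Fin.forall_fin_succ', Fin.init]
        rfl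
      _ ↔ fixedObs f z (Fin.init X) ω ∈ B₀ ∧ fixedObs f z (Fin.init X) ω ∈ B₁ := by
        rw [← hpast_iff, ← hlast_iff]
        exact and_congr_right fun hX => by rw [obs_eq_fixedObs hX]

variable [MeasurableSpace Ω] {P : Measure Ω} {k : D → D → ℝ} {s2 : ℝ}

theorem Nonanticipating.measurableSet_queries_eq (hx : Nonanticipating f z x)
    (h : IsModel P k s2 f z) (t : ℕ) (X : Fin t → D) :
    MeasurableSet {ω | queries (x · ω) t = X} := by
  obtain ⟨B, hB, hpre⟩ := hx.exists_preimage t X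
  rw [hpre]
  exact h.measurable_fixedObs X hB

variable [Finite D]

theorem IsModel.measure_queries_eq_inter_residual_gt_le (h : IsModel P k s2 f z)
    (hk : (Matrix.of k).PosSemidef) (hs : 0 < s2) (hx : Nonanticipating f z x) {t : ℕ}
    (X : Fin t → D) {a : D} (ha : 0 < k a a) {c : ℝ} (hc : 0 ≤ c) :
    P ({ω | queries (x · ω) t = X} ∩ {ω | √c * √(postVar k s2 X a) < |residual k s2 f z X a ω|})
      ≤ P {ω | queries (x · ω) t = X} * ENNReal.ofReal (Real.exp (-(c / 2))) := by
  obtain ⟨B, hB, hpre⟩ := hx.exists_preimage t X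
  have hset : MeasurableSet {u : ℝ | √c * √(postVar k s2 X a) < |u|} :=
    measurableSet_lt measurable_const (by fun_prop)
  have hindep := (h.indepFun_residual hk hs X a).symm.measure_inter_preimage_eq_mul _ _ hB hset
  rw [← hpre] at hindep
  exact hindep.trans_le (mul_le_mul_right (h.measure_residual_gt_le hk hs X ha hc) _)

/-- The queries depend on the observations only, and for fixed queries the residual is independent
of the observations; so the tail bound for fixed queries survives conditioning on the queries. -/
theorem IsModel.measure_abs_sub_postMean_gt_le (h : IsModel P k s2 f z)
    (hk : (Matrix.of k).PosSemidef) (hs : 0 < s2) (hx : Nonanticipating f z x) (t : ℕ) {a : D}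
    (ha : 0 < k a a) {c : ℝ} (hc : 0 ≤ c) :
    P {ω | √c * √(postVar k s2 (queries (x · ω) t) a)
        < |f a ω - postMean k s2 (queries (x · ω) t) (fun i => obs f z x i ω) a|}
      ≤ ENNReal.ofReal (Real.exp (-(c / 2))) := by
  classical
  have := Fintype.ofFinite D
  have := h.gaussian_f.isProbabilityMeasure
  have hcover : {ω | √c * √(postVar k s2 (queries (x · ω) t) a)
        < |f a ω - postMean k s2 (queries (x · ω) t) (fun i => obs f z x i ω) a|}
      ⊆ ⋃ X ∈ (Finset.univ : Finset (Fin t → D)), {ω | queries (x · ω) t = X}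
        ∩ {ω | √c * √(postVar k s2 X a) < |residual k s2 f z X a ω|} := fun ω hω => by
    rw [Set.mem_ofPred_eq, postMean_eq_dotProduct hk, obs_eq_fixedObs rfl] at hω
    exact Set.mem_biUnion (Finset.mem_univ (queries (x · ω) t)) ⟨rfl, hω⟩
  have htotal : ∑ X, P {ω | queries (x · ω) t = X} ≤ 1 := by
    refine (sum_measure_le_measure_univ (fun X _ =>
      (hx.measurableSet_queries_eq h t X).nullMeasurableSet) fun X _ Y _ hXY =>
        Disjoint.aedisjoint (Set.disjoint_left.2 fun ω hωX hωY => hXY ?_)).trans_eq measure_univ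
    exact hωX.symm.trans hωY
  calc P _
    _ ≤ ∑ X : Fin t → D, P ({ω | queries (x · ω) t = X}
          ∩ {ω | √c * √(postVar k s2 X a) < |residual k s2 f z X a ω|}) :=
      (measure_mono hcover).trans (measure_biUnion_finset_le _ _)
    _ ≤ ∑ X, P {ω | queries (x · ω) t = X} * ENNReal.ofReal (Real.exp (-(c / 2))) :=
      Finset.sum_le_sum fun X _ =>
        h.measure_queries_eq_inter_residual_gt_le hk hs hx X ha hc
    _ ≤ ENNReal.ofReal (Real.exp (-(c / 2))) := by
      rw [← Finset.sum_mul]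
      exact mul_le_of_le_one_left' htotal

end Adaptive

section Schedule

variable {D : Type*} {k : D → D → ℝ} {p : Params} {pb : Problem}

theorem Covers.mono {s2 : ℝ} {x : ℕ → D} {y : ℕ → ℝ} {f : D → ℝ} {t : ℕ} {c c' : ℝ}
    (h : Covers k s2 x y f t c) (hc : c ≤ c') : Covers k s2 x y f t c' := fun a =>
  (h a).trans (mul_le_mul_of_nonneg_right (Real.sqrt_le_sqrt hc) (Real.sqrt_nonneg _))

theorem exists_le_and_lt_succ {N : ℕ → ℕ} {t : ℕ} (h₀ : N 0 ≤ t) (hex : ∃ j, t < N j) :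
    ∃ j, N j ≤ t ∧ t < N (j + 1) := by
  obtain ⟨j, hj⟩ := hex
  induction j with
  | zero => exact absurd hj h₀.not_gt
  | succ j ih => exact (lt_or_ge t (N j)).elim ih fun hle => ⟨j, hle, hj⟩

/-- The epochs before `i₀` are over at time `N₀`, and epoch `e ≥ i₀` takes at most `n e` further
steps. If `β` does not decrease from `i₀` on, the interval used at a time between the `j`-th and the
`(j + 1)`-st of the resulting deadlines contains the interval with parameter `β (i₀ + j)`. -/
theorem confident_of_covers [Fintype D] (hk : (Matrix.of k).PosSemidef) (hone : ∀ a, k a a = 1)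
    (hsub : SubmodularVarReduction k p.s2) (hp : p.Regular) {x : ℕ → D} {y : ℕ → ℝ}
    (hgreedy : IsGreedy pb k p x y) {f : D → ℝ} {i₀ N₀ : ℕ} {n : ℕ → ℕ} (hN₀ : 1 ≤ N₀)
    (hn : ∀ e, i₀ ≤ e → EpochBound k p e (n e))
    (hstart : (state pb k p x y N₀).M.Nonempty → i₀ ≤ (state pb k p x y N₀).epoch)
    (hmono : MonotoneOn p.beta (Set.Ici i₀)) {c₀ : ℝ} (hc₀ : ∀ e, 1 ≤ e → c₀ ≤ p.beta e)
    (hfirst : ∀ t < N₀, Covers k p.s2 x y f t c₀)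
    (hepoch : ∀ j, ∀ t < N₀ + ∑ i ∈ Finset.range (j + 1), n (i₀ + i),
      N₀ + ∑ i ∈ Finset.range j, n (i₀ + i) ≤ t → Covers k p.s2 x y f t (p.beta (i₀ + j))) :
    Confident pb k p x y f := by
  intro t hM
  set N : ℕ → ℕ := fun j => N₀ + ∑ i ∈ Finset.range j, n (i₀ + i) with hN
  have hreached : ∀ j, N j ≤ t → i₀ + j ≤ (state pb k p x y t).epoch := fun j hj =>
    (le_state_epoch_of_sum_le hk hone hsub hp hgreedy hN₀ hn hstart j
      (hM.mono (state_M_antitone pb k p x y hj))).trans (state_epoch_monotone pb k p x y hj)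
  rcases lt_or_ge t N₀ with ht | ht
  · exact (hfirst t ht).mono (hc₀ _ (one_le_state_epoch t))
  have hex : ∃ j, t < N j := by
    by_contra! hall
    have := hreached _ (hall ((state pb k p x y t).epoch + 1))
    omega
  obtain ⟨j, hj, hj'⟩ := exists_le_and_lt_succ (by simpa [hN] using ht) hex
  exact (hepoch j t hj' hj).mono
    (hmono (Nat.le_add_right _ _) ((Nat.le_add_right _ _).trans (hreached j hj)) (hreached j hj))

variable {Ω : Type*} {s2 : ℝ} {f : D → Ω → ℝ} {z : ℕ → Ω → ℝ} {x : ℕ → Ω → D}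

/-- Some confidence interval with parameter `c` that is based on the first `t + 1` observations
misses the value of `f`. -/
def missSet (k : D → D → ℝ) (s2 : ℝ) (f : D → Ω → ℝ) (z : ℕ → Ω → ℝ) (x : ℕ → Ω → D) (t : ℕ)
    (c : ℝ) : Set Ω :=
  {ω | ¬ Covers k s2 (x · ω) (obs f z x · ω) (f · ω) t c}

variable [Fintype D] [MeasurableSpace Ω] {P : Measure Ω}

theorem measure_missSet_le (h : IsModel P k s2 f z) (hk : (Matrix.of k).PosSemidef)
    (hpos : ∀ a, 0 < k a a) (hs : 0 < s2) (hx : Nonanticipating f z x) (t : ℕ) {c : ℝ}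
    (hc : 0 ≤ c) :
    P (missSet k s2 f z x t c) ≤ ENNReal.ofReal (Fintype.card D * Real.exp (-(c / 2))) := by
  have hunion : missSet k s2 f z x t c ⊆ ⋃ a ∈ (Finset.univ : Finset D),
      {ω | √c * √(postVar k s2 (queries (x · ω) (t + 1)) a)
        < |f a ω - postMean k s2 (queries (x · ω) (t + 1)) (fun i => obs f z x i ω) a|} := by
    intro ω hω
    simpa [missSet, Covers] using hω
  calc P (missSet k s2 f z x t c)
    _ ≤ ∑ _a : D, ENNReal.ofReal (Real.exp (-(c / 2))) :=
      (measure_mono hunion).trans ((measure_biUnion_finset_le _ _).trans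
        (Finset.sum_le_sum fun a _ =>
          h.measure_abs_sub_postMean_gt_le hk hs hx (t + 1) (hpos a) hc))
    _ = ENNReal.ofReal (Fintype.card D * Real.exp (-(c / 2))) := by
      rw [Finset.sum_const, Finset.card_univ, nsmul_eq_mul, ENNReal.ofReal_mul (Nat.cast_nonneg _),
        ENNReal.ofReal_natCast]

theorem measure_biUnion_missSet_le (h : IsModel P k s2 f z) (hk : (Matrix.of k).PosSemidef)
    (hpos : ∀ a, 0 < k a a) (hs : 0 < s2) (hx : Nonanticipating f z x) (I : Finset ℕ) {c : ℝ}
    (hc : 0 ≤ c) :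
    P (⋃ t ∈ I, missSet k s2 f z x t c)
      ≤ ENNReal.ofReal (Fintype.card D * (I.card * Real.exp (-(c / 2)))) := by
  calc P (⋃ t ∈ I, missSet k s2 f z x t c)
    _ ≤ ∑ _t ∈ I, ENNReal.ofReal (Fintype.card D * Real.exp (-(c / 2))) :=
      (measure_biUnion_finset_le _ _).trans
        (Finset.sum_le_sum fun t _ => measure_missSet_le h hk hpos hs hx t hc)
    _ = ENNReal.ofReal (Fintype.card D * (I.card * Real.exp (-(c / 2)))) := by
      rw [Finset.sum_const, nsmul_eq_mul, ← ENNReal.ofReal_natCast,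
        ← ENNReal.ofReal_mul (Nat.cast_nonneg _), mul_left_comm]

theorem tsum_ofReal_mul_geometric {c : ℝ} (hc : 0 ≤ c) :
    ∑' j : ℕ, ENNReal.ofReal (c * (1 / 2) ^ j) = ENNReal.ofReal (c * 2) := by
  rw [← ENNReal.ofReal_tsum_of_nonneg (fun j => by positivity)
    (summable_geometric_two.mul_left c), tsum_mul_left, tsum_geometric_two]

theorem measure_not_confident_le (hmodel : IsModel P k p.s2 f z) (hk : (Matrix.of k).PosSemidef)
    (hone : ∀ a, k a a = 1) (hsub : SubmodularVarReduction k p.s2) (hp : p.Regular)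
    (hrun : IsRun pb k p f z x) {i₀ N₀ : ℕ} {n : ℕ → ℕ} (hN₀ : 1 ≤ N₀)
    (hn : ∀ e, i₀ ≤ e → EpochBound k p e (n e))
    (hstart : ∀ ω, (runState pb k p f z x ω N₀).M.Nonempty →
      i₀ ≤ (runState pb k p f z x ω N₀).epoch)
    (hmono : MonotoneOn p.beta (Set.Ici i₀)) {c₀ : ℝ} (hc₀ : 0 ≤ c₀)
    (hc₀_le : ∀ e, 1 ≤ e → c₀ ≤ p.beta e) {Q δ : ℝ} (hQ : 0 ≤ Q)
    (hbound : ∀ j, n (i₀ + j) * Real.exp (-(p.beta (i₀ + j) / 2)) ≤ Q * (1 / 2) ^ j)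
    (hδ : Fintype.card D * (N₀ * Real.exp (-(c₀ / 2)) + 2 * Q) ≤ δ) :
    P {ω | ¬ Confident pb k p (x · ω) (obs f z x · ω) (f · ω)} ≤ ENNReal.ofReal δ := by
  have hpos : ∀ a, 0 < k a a := fun a => (hone a).ge.trans_lt' one_pos
  set N : ℕ → ℕ := fun j => N₀ + ∑ i ∈ Finset.range j, n (i₀ + i) with hN
  have hcover : {ω | ¬ Confident pb k p (x · ω) (obs f z x · ω) (f · ω)}
      ⊆ (⋃ t ∈ Finset.range N₀, missSet k p.s2 f z x t c₀)
        ∪ ⋃ j, ⋃ t ∈ Finset.Ico (N j) (N (j + 1)), missSet k p.s2 f z x t (p.beta (i₀ + j)) := by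
    intro ω hω
    by_contra hnot
    simp only [Set.mem_union, Set.mem_iUnion, not_or, not_exists, missSet, Set.mem_ofPred_eq,
      not_not, Finset.mem_range, Finset.mem_Ico] at hnot
    exact hω (confident_of_covers hk hone hsub hp (fun t a => hrun.greedy t ω a) hN₀ hn (hstart ω)
      hmono hc₀_le hnot.1 fun j t ht ht' => hnot.2 j t ⟨ht', ht⟩)
  have hepoch : ∀ j, P (⋃ t ∈ Finset.Ico (N j) (N (j + 1)),
      missSet k p.s2 f z x t (p.beta (i₀ + j)))
      ≤ ENNReal.ofReal (Fintype.card D * Q * (1 / 2) ^ j) := fun j => by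
    have hcard : (Finset.Ico (N j) (N (j + 1))).card = n (i₀ + j) := by
      simp [hN, Finset.sum_range_succ, ← add_assoc]
    refine (measure_biUnion_missSet_le hmodel hk hpos hp.s2_pos hrun.nonanticipating _
      (hp.beta_pos _).le).trans (ENNReal.ofReal_le_ofReal ?_)
    rw [hcard, mul_assoc]
    exact mul_le_mul_of_nonneg_left (hbound j) (Nat.cast_nonneg _)
  calc P {ω | ¬ Confident pb k p (x · ω) (obs f z x · ω) (f · ω)}
    _ ≤ ENNReal.ofReal (Fintype.card D * (N₀ * Real.exp (-(c₀ / 2))))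
        + ∑' j : ℕ, ENNReal.ofReal (Fintype.card D * Q * (1 / 2) ^ j) := by
      refine (measure_mono hcover).trans ((measure_union_le _ _).trans (add_le_add ?_
        ((measure_iUnion_le _).trans (ENNReal.tsum_le_tsum hepoch))))
      simpa only [Finset.card_range] using measure_biUnion_missSet_le hmodel hk hpos hp.s2_pos
        hrun.nonanticipating (Finset.range N₀) hc₀
    _ ≤ ENNReal.ofReal δ := by
      rw [tsum_ofReal_mul_geometric (by positivity),
        ← ENNReal.ofReal_add (by positivity) (by positivity)]
      exact ENNReal.ofReal_le_ofReal (by linarith)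

end Schedule

section EpochLengthBounds

variable {D : Type*} [Fintype D] {k : D → D → ℝ} {p : Params} {pb : Problem}

theorem exists_postVar_le_div_of_card (hk : (Matrix.of k).PosSemidef) {s2 : ℝ} (hs : 0 < s2)
    {m : ℕ} (hm : m ≠ 0) :
    ∃ S : Fin (Fintype.card D * m) → D, ∀ a, postVar k s2 S a ≤ s2 / m := by
  refine ⟨fun i => (Fintype.equivFin D).symm (finProdFinEquiv.symm i).1, fun a => ?_⟩
  have hinj : (fun j : Fin m => finProdFinEquiv (Fintype.equivFin D a, j)).Injective :=
    fun j j' h => by simpa using h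
  have hconst : (fun i => (Fintype.equivFin D).symm (finProdFinEquiv.symm i).1)
      ∘ (fun j : Fin m => finProdFinEquiv (Fintype.equivFin D a, j)) = fun _ => a := by
    ext j
    simp only [Function.comp, Equiv.symm_apply_apply]
  exact (postVar_le_postVar_comp hk hs hinj _ a).trans
    (hconst ▸ postVar_const_le hk hs hm a)

theorem Params.Regular.gap_pos (hp : p.Regular) : 0 < (1 + p.dbar) ^ 2 - 1 := by
  nlinarith [hp.dbar_pos]

/-- Solving the exponential condition of `EpochBound` for `n`. -/
theorem epochBound_ceil [Nonempty D] (hp : p.Regular) {e m : ℕ} (hm : 0 < m) {S : Fin m → D}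
    (hS : ∀ a, p.beta e * postVar k p.s2 S a ≤ p.eta e ^ 2) {A : ℝ}
    (hlog : Real.log (Fintype.card D * p.beta e / (((1 + p.dbar) ^ 2 - 1) * p.eta e ^ 2)) ≤ A) :
    EpochBound k p e ⌈m * A⌉₊ := by
  refine ⟨m, hm, ⟨S, hS⟩, ?_⟩
  have hm' : (0 : ℝ) < m := Nat.cast_pos.2 hm
  have hβ := hp.beta_pos e
  have hgap : 0 < ((1 + p.dbar) ^ 2 - 1) * p.eta e ^ 2 :=
    mul_pos hp.gap_pos (pow_pos (hp.eta_pos e) 2)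
  have hsteps : A ≤ (⌈m * A⌉₊ : ℝ) / m := by
    rw [le_div_iff₀ hm', mul_comm]
    exact Nat.le_ceil _
  rw [Real.log_le_iff_le_exp (by positivity), div_le_iff₀ hgap] at hlog
  calc Fintype.card D * p.beta e * Real.exp (-(⌈m * A⌉₊ / m))
    _ ≤ Real.exp A * (((1 + p.dbar) ^ 2 - 1) * p.eta e ^ 2) * Real.exp (-A) := by
      gcongr
    _ = ((1 + p.dbar) ^ 2 - 1) * p.eta e ^ 2 := by
      rw [mul_right_comm, ← Real.exp_add, add_neg_cancel, Real.exp_zero, one_mul]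

theorem exists_epochBound [Nonempty D] (hk : (Matrix.of k).PosSemidef) (hp : p.Regular) (e : ℕ)
    {A : ℝ} (hA : 0 ≤ A)
    (hlog : Real.log (Fintype.card D * p.beta e / (((1 + p.dbar) ^ 2 - 1) * p.eta e ^ 2)) ≤ A) :
    ∃ n : ℕ, EpochBound k p e n ∧
      n ≤ Fintype.card D * (p.s2 * (p.beta e / p.eta e ^ 2) + 1) * A + 1 := by
  have hη := hp.eta_pos e
  have hβ := hp.beta_pos e
  have hs := hp.s2_pos
  set m := ⌈p.s2 * (p.beta e / p.eta e ^ 2)⌉₊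
  have hm_pos : 0 < m := Nat.ceil_pos.2 (by positivity)
  have hm_le : p.s2 * (p.beta e / p.eta e ^ 2) ≤ m := Nat.le_ceil _
  have hm_lt : (m : ℝ) < p.s2 * (p.beta e / p.eta e ^ 2) + 1 := Nat.ceil_lt_add_one (by positivity)
  obtain ⟨S, hS⟩ := exists_postVar_le_div_of_card hk hs hm_pos.ne'
  have hS' : ∀ a, p.beta e * postVar k p.s2 S a ≤ p.eta e ^ 2 := fun a => by
    have hm_pos' : (0 : ℝ) < m := Nat.cast_pos.2 hm_pos
    calc p.beta e * postVar k p.s2 S a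
      _ ≤ p.beta e * (p.s2 / m) := by
        gcongr
        exact hS a
      _ = p.s2 * (p.beta e / p.eta e ^ 2) * p.eta e ^ 2 / m := by
        field_simp
      _ ≤ p.eta e ^ 2 := by
        rw [div_le_iff₀ hm_pos', mul_comm]
        gcongr
  refine ⟨_, epochBound_ceil hp (Nat.mul_pos Fintype.card_pos hm_pos) hS' hlog,
    (Nat.ceil_lt_add_one (by positivity)).le.trans ?_⟩
  push_cast
  gcongr

theorem pow_three_mul_exp_neg_le {u Λ : ℝ} (hu : 1 ≤ u) (hΛ : 8 ≤ Λ) :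
    u ^ 3 * Real.exp (-(Λ * u / 2)) ≤ Real.exp (-(Λ / 2)) * u⁻¹ := by
  have hu_pos : 0 < u := by linarith
  have hexp : u ≤ Real.exp (u - 1) := by linarith [Real.add_one_le_exp (u - 1)]
  rw [← div_eq_mul_inv, le_div_iff₀ hu_pos]
  calc u ^ 3 * Real.exp (-(Λ * u / 2)) * u
    _ = u ^ 4 * Real.exp (-(Λ * u / 2)) := by ring
    _ ≤ Real.exp (u - 1) ^ 4 * Real.exp (-(Λ * u / 2)) := by gcongr
    _ = Real.exp (4 * (u - 1) - Λ * u / 2) := by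
      rw [← Real.exp_nat_mul, ← Real.exp_add, Nat.cast_ofNat, sub_eq_add_neg _ (Λ * u / 2)]
    _ ≤ Real.exp (-(Λ / 2)) := Real.exp_le_exp.2 (by nlinarith)

theorem log_mul_sq_le {B u A : ℝ} (hu : 1 ≤ u) (hA : 2 ≤ A) (hB : 0 < B) (hlog : Real.log B ≤ A) :
    Real.log (B * u ^ 2) ≤ A * u := by
  rw [Real.log_mul hB.ne' (by positivity), Real.log_pow, Nat.cast_ofNat]
  nlinarith [Real.log_le_sub_one_of_pos (one_pos.trans_le hu)]

/-- With `β = Λ u` and `η² ≥ 1 / (C u)`, the length of the epoch is polynomial in `u` while the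
failure probability of a step is exponentially small in `u`. -/
theorem exists_epochBound_mul_exp_le [Nonempty D] (hk : (Matrix.of k).PosSemidef) (hp : p.Regular)
    (e : ℕ) {Λ u C A : ℝ} (hΛ : 8 ≤ Λ) (hu : 1 ≤ u) (hβ : p.beta e = Λ * u) (hC : 0 < C)
    (hη : 1 ≤ C * u * p.eta e ^ 2) (hA : 2 ≤ A)
    (hlog : Real.log (Fintype.card D * Λ * C / ((1 + p.dbar) ^ 2 - 1)) ≤ A) :
    ∃ n : ℕ, EpochBound k p e n ∧ n * Real.exp (-(p.beta e / 2))
      ≤ (Fintype.card D * (p.s2 * Λ * C + 1) * A + 1) * Real.exp (-(Λ / 2)) * u⁻¹ := by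
  have hη_pos := hp.eta_pos e
  have hs := hp.s2_pos
  have hgap := hp.gap_pos
  have hratio : p.beta e / p.eta e ^ 2 ≤ Λ * C * u ^ 2 := by
    rw [hβ, div_le_iff₀ (by positivity)]
    calc Λ * u
      _ ≤ Λ * u * (C * u * p.eta e ^ 2) := le_mul_of_one_le_right (by positivity) hη
      _ = Λ * C * u ^ 2 * p.eta e ^ 2 := by ring
  have hlog' : Real.log (Fintype.card D * p.beta e / (((1 + p.dbar) ^ 2 - 1) * p.eta e ^ 2))
      ≤ A * u := by
    have hβ_pos := hp.beta_pos e
    refine le_trans (Real.log_le_log (by positivity) ?_) (log_mul_sq_le hu hA (by positivity) hlog)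
    calc Fintype.card D * p.beta e / (((1 + p.dbar) ^ 2 - 1) * p.eta e ^ 2)
      _ = Fintype.card D / ((1 + p.dbar) ^ 2 - 1) * (p.beta e / p.eta e ^ 2) := by
        rw [mul_div_mul_comm]
      _ ≤ Fintype.card D / ((1 + p.dbar) ^ 2 - 1) * (Λ * C * u ^ 2) := by gcongr
      _ = Fintype.card D * Λ * C / ((1 + p.dbar) ^ 2 - 1) * u ^ 2 := by ring
  obtain ⟨n, hn, hn_le⟩ := exists_epochBound hk hp e (by positivity) hlog'
  refine ⟨n, hn, ?_⟩
  have hn_le_cube : (n : ℝ) ≤ (Fintype.card D * (p.s2 * Λ * C + 1) * A + 1) * u ^ 3 :=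
    calc (n : ℝ)
      _ ≤ Fintype.card D * (p.s2 * (p.beta e / p.eta e ^ 2) + 1) * (A * u) + 1 := hn_le
      _ ≤ Fintype.card D * (p.s2 * (Λ * C * u ^ 2) + 1 * u ^ 2) * (A * u) + 1 * u ^ 3 := by
        gcongr <;> linarith [one_le_pow₀ hu (n := 2), one_le_pow₀ hu (n := 3)]
      _ = (Fintype.card D * (p.s2 * Λ * C + 1) * A + 1) * u ^ 3 := by ring
  rw [hβ, mul_assoc]
  calc n * Real.exp (-(Λ * u / 2))
    _ ≤ (Fintype.card D * (p.s2 * Λ * C + 1) * A + 1) * u ^ 3 * Real.exp (-(Λ * u / 2)) := by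
      gcongr
    _ = (Fintype.card D * (p.s2 * Λ * C + 1) * A + 1) * (u ^ 3 * Real.exp (-(Λ * u / 2))) :=
      mul_assoc _ _ _
    _ ≤ (Fintype.card D * (p.s2 * Λ * C + 1) * A + 1) * (Real.exp (-(Λ / 2)) * u⁻¹) :=
      mul_le_mul_of_nonneg_left (pow_three_mul_exp_neg_le hu hΛ) (by positivity)

variable [Nonempty D] {Ω : Type*} [MeasurableSpace Ω] {P : Measure Ω} {f : D → Ω → ℝ}
  {z : ℕ → Ω → ℝ} {x : ℕ → Ω → D}

theorem measure_not_confident_le_of_growth (hmodel : IsModel P k p.s2 f z)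
    (hk : (Matrix.of k).PosSemidef) (hone : ∀ a, k a a = 1) (hsub : SubmodularVarReduction k p.s2)
    (hp : p.Regular) (hrun : IsRun pb k p f z x) {i₀ N₀ : ℕ} (hN₀ : 1 ≤ N₀)
    (hstart : ∀ ω, (runState pb k p f z x ω N₀).M.Nonempty →
      i₀ ≤ (runState pb k p f z x ω N₀).epoch)
    {c₀ : ℝ} (hc₀ : 0 ≤ c₀) (hc₀_le : ∀ e, 1 ≤ e → c₀ ≤ p.beta e) {Λ C A : ℝ} {u : ℕ → ℝ}
    (hΛ : 8 ≤ Λ) (hu : ∀ e, i₀ ≤ e → 1 ≤ u e) (hβ : ∀ e, i₀ ≤ e → p.beta e = Λ * u e)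
    (hC : 0 < C) (hη : ∀ e, i₀ ≤ e → 1 ≤ C * u e * p.eta e ^ 2)
    (hmono : MonotoneOn u (Set.Ici i₀)) (hgrowth : ∀ j, 2 ^ j ≤ 2 * u (i₀ + j)) (hA : 2 ≤ A)
    (hlog : Real.log (Fintype.card D * Λ * C / ((1 + p.dbar) ^ 2 - 1)) ≤ A) {δ : ℝ}
    (hδ : Fintype.card D * (N₀ * Real.exp (-(c₀ / 2))
      + 4 * ((Fintype.card D * (p.s2 * Λ * C + 1) * A + 1) * Real.exp (-(Λ / 2)))) ≤ δ) :
    P {ω | ¬ Confident pb k p (x · ω) (obs f z x · ω) (f · ω)} ≤ ENNReal.ofReal δ := by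
  have hs := hp.s2_pos
  have hlength := fun e : ℕ => fun he : i₀ ≤ e => exists_epochBound_mul_exp_le hk hp e hΛ (hu e he)
    (hβ e he) hC (hη e he) hA hlog
  choose! n hn hn_le using hlength
  have hinv : ∀ j, (u (i₀ + j))⁻¹ ≤ 2 * (1 / 2) ^ j := fun j => by
    rw [one_div, inv_pow, ← div_eq_mul_inv,
      inv_le_comm₀ (one_pos.trans_le (hu _ (Nat.le_add_right _ _))) (by positivity), inv_div,
      div_le_iff₀ two_pos, mul_comm]
    exact hgrowth j
  refine measure_not_confident_le hmodel hk hone hsub hp hrun hN₀ hn hstart ?_ hc₀ hc₀_le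
    (Q := (Fintype.card D * (p.s2 * Λ * C + 1) * A + 1) * Real.exp (-(Λ / 2)) * 2)
    (by positivity) (fun j => ?_) (by linarith)
  · intro e he e' he' hee'
    rw [hβ e he, hβ e' he']
    exact mul_le_mul_of_nonneg_left (hmono he he' hee') (by linarith)
  · rw [mul_assoc _ 2]
    exact (hn_le (i₀ + j) (Nat.le_add_right _ _)).trans
      (mul_le_mul_of_nonneg_left (hinv j) (by positivity))

end EpochLengthBounds

section HalvingParams

/-- The parameters of the theorem: `η₍₁₎ = 1` and `r = 1/2`. -/
noncomputable abbrev halvingParams (σ dbar : ℝ) (β : ℕ → ℝ) : Params :=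
  ⟨σ ^ 2, 1, 1 / 2, dbar, β⟩

theorem halvingParams_eta (σ dbar : ℝ) (β : ℕ → ℝ) (e : ℕ) :
    (halvingParams σ dbar β).eta e = (1 / 2) ^ (e - 1) :=
  one_mul _

theorem halvingParams_eta_sq (σ dbar : ℝ) (β : ℕ → ℝ) (e : ℕ) :
    (halvingParams σ dbar β).eta e ^ 2 = (4 ^ (e - 1))⁻¹ := by
  rw [halvingParams_eta, ← pow_mul, mul_comm, pow_mul, ← inv_pow]
  norm_num

theorem halvingParams_eta_one (σ dbar : ℝ) (β : ℕ → ℝ) : (halvingParams σ dbar β).eta 1 = 1 := by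
  rw [halvingParams_eta, Nat.sub_self, pow_zero]

theorem halvingParams_regular {σ dbar : ℝ} (hσ : 0 < σ) (hdbar : 0 < dbar) {β : ℕ → ℝ}
    (hβ : ∃ b, 0 < b ∧ ∀ i, b ≤ β i) : (halvingParams σ dbar β).Regular where
  s2_pos := pow_pos hσ 2
  dbar_pos := hdbar
  eta_pos e := by
    rw [halvingParams_eta]
    positivity
  eta_tendsto := by
    rw [← Filter.tendsto_add_atTop_iff_nat 1]
    simp only [halvingParams_eta, Nat.add_sub_cancel]
    exact tendsto_pow_atTop_nhds_zero_of_lt_one (by norm_num) (by norm_num)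
  beta_bdd := hβ

theorem halvingParams_epochDone_iff {D : Type*} {k : D → D → ℝ} {σ dbar : ℝ} {β : ℕ → ℝ}
    (hdbar : 0 ≤ 1 + dbar) {e t : ℕ} (hβ : 0 ≤ β e) (X : Fin t → D) (M : Finset D) :
    EpochDone k (halvingParams σ dbar β) X M e
      ↔ ∀ a ∈ M, β e * 4 ^ (e - 1) * postVar k (σ ^ 2) X a ≤ (1 + dbar) ^ 2 := by
  refine forall₂_congr fun a _ => ?_
  rw [halvingParams_eta, sqrt_mul_sqrt_le_iff hβ (by positivity), ← halvingParams_eta σ dbar β,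
    mul_pow, halvingParams_eta_sq, ← div_eq_mul_inv, le_div_iff₀ (by positivity), mul_right_comm]

theorem one_sub_le_measureReal {Ω : Type*} [MeasurableSpace Ω] {P : Measure Ω}
    [IsProbabilityMeasure P] {δ : ℝ} (hδ : 0 ≤ δ) {φ ψ : Ω → Prop}
    (h : P {ω | ¬ φ ω} ≤ ENNReal.ofReal δ) (hφψ : ∀ ω, φ ω → ψ ω) : 1 - δ ≤ P.real {ω | ψ ω} := by
  have hcover : Set.univ ⊆ {ω | ψ ω} ∪ {ω | ¬ φ ω} := fun ω _ =>
    or_iff_not_imp_right.2 fun hω => hφψ ω (not_not.1 hω)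
  have hfail : P.real {ω | ¬ φ ω} ≤ δ := ENNReal.toReal_le_of_le_ofReal hδ h
  have hone : (1 : ℝ) ≤ P.real {ω | ψ ω} + P.real {ω | ¬ φ ω} :=
    calc (1 : ℝ)
      _ = P.real Set.univ := probReal_univ.symm
      _ ≤ P.real ({ω | ψ ω} ∪ {ω | ¬ φ ω}) := measureReal_mono hcover
      _ ≤ _ := measureReal_union_le _ _
  linarith

variable {D : Type*} [Fintype D] {k : D → D → ℝ}

/-- In every model and for every run of the algorithm with the parameters of the theorem, with
probability at least `1 - δ` the sets are `ε`-accurate after every time `T ≥ 1` that satisfies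
`q`. -/
def AccurateWithProb.{u, v} {D : Type u} [Fintype D] (k : D → D → ℝ) (σ dbar : ℝ) (β : ℕ → ℝ)
    (ε δ : ℝ) (q : ℕ → Prop) : Prop :=
  ∀ (pb : Problem) (Ω : Type v) [MeasurableSpace Ω] (P : Measure Ω) [IsProbabilityMeasure P]
    (f : D → Ω → ℝ) (z : ℕ → Ω → ℝ) (x : ℕ → Ω → D),
    IsModel P k (σ ^ 2) f z → IsRun pb k (halvingParams σ dbar β) f z x →
    1 - δ ≤ P.real {ω | ∀ T : ℕ, 1 ≤ T → q T →
      Accurate pb ε (f · ω) (runState pb k (halvingParams σ dbar β) f z x ω T)}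

theorem AccurateWithProb.mono.{u, v} {D : Type u} [Fintype D] {k : D → D → ℝ} {σ dbar : ℝ}
    {β : ℕ → ℝ} {ε δ : ℝ} {q q' : ℕ → Prop}
    (h : AccurateWithProb.{u, v} k σ dbar β ε δ q) (hq : ∀ T, 1 ≤ T → q' T → q T) :
    AccurateWithProb.{u, v} k σ dbar β ε δ q' := fun pb Ω _ P _ f z x hmodel hrun =>
  (h pb Ω P f z x hmodel hrun).trans
    (measureReal_mono fun _ hω T hT hqT => hω T hT (hq T hT hqT))

theorem two_le_state_epoch_of_forall_le {p : Params} {pb : Problem} {x : ℕ → D} {y : ℕ → ℝ}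
    (hk : (Matrix.of k).PosSemidef) (hpos : ∀ a, 0 < k a a) (hp : p.Regular) {t : ℕ} (ht : 1 ≤ t)
    (hM : (state pb k p x y t).M.Nonempty)
    (hwidth : ∀ a, p.beta 1 * postVar k p.s2 (queries x t) a ≤ ((1 + p.dbar) * p.eta 1) ^ 2) :
    2 ≤ (state pb k p x y t).epoch := by
  have hone_le := one_le_state_epoch (pb := pb) (k := k) (p := p) (x := x) (y := y) t
  by_contra! hlt
  have hnot_done := not_epochDone_state_epoch hk hpos hp ht hM
  rw [show (state pb k p x y t).epoch = 1 by omega] at hnot_done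
  refine hnot_done fun a _ => ?_
  rw [sqrt_mul_sqrt_le_iff (hp.beta_pos 1).le
    (mul_nonneg (by linarith [hp.dbar_pos]) (hp.eta_pos 1).le)]
  exact hwidth a

end HalvingParams

section PriorAccurate

/-- Confidence parameters for the case in which the prior intervals are already short: the constant
`b` in epoch `1`, and parameters growing from `Λ` afterwards. -/
noncomputable def priorBeta (b Λ : ℝ) (e : ℕ) : ℝ := if e ≤ 1 then b else Λ * 4 ^ (e - 1)

theorem priorBeta_one (b Λ : ℝ) : priorBeta b Λ 1 = b := if_pos le_rfl

theorem priorBeta_of_two_le (b Λ : ℝ) {e : ℕ} (he : 2 ≤ e) :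
    priorBeta b Λ e = Λ * 4 ^ (e - 1) :=
  if_neg (by omega)

theorem le_priorBeta {b Λ : ℝ} (hb : 0 < b) (hbΛ : b ≤ Λ) (e : ℕ) : b ≤ priorBeta b Λ e := by
  unfold priorBeta
  split_ifs
  · exact le_rfl
  · exact hbΛ.trans (le_mul_of_one_le_right (hb.le.trans hbΛ) (one_le_pow₀ (by norm_num)))

theorem tendsto_quadratic_mul_exp_neg (n s q : ℝ) :
    Filter.Tendsto (fun Λ : ℝ => n * (4 * ((n * (s * Λ + 1)
      * (2 + n * Λ / q) + 1) * Real.exp (-(Λ / 2))))) Filter.atTop (nhds 0) := by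
  have hmonomial := fun j => (Real.tendsto_pow_mul_exp_neg_atTop_nhds_zero j).comp
    (Filter.tendsto_id.atTop_div_const (zero_lt_two' ℝ))
  have hsum := (((hmonomial 2).const_mul (4 * n * (n * s * (n / q)) * 4)).add
    ((hmonomial 1).const_mul (4 * n * (2 * (n * s * 2 + n * (n / q)))))).add
    ((hmonomial 0).const_mul (4 * n * (2 * n + 1)))
  simp only [mul_zero, add_zero] at hsum
  refine hsum.congr fun Λ => ?_
  simp only [Function.comp, id]
  ring

variable {D : Type*} [Fintype D] {k : D → D → ℝ} {σ dbar ε δ b Λ : ℝ}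

theorem two_pow_le_two_mul_four_pow (j : ℕ) : (2 : ℝ) ^ j ≤ 2 * 4 ^ (2 + j - 1) :=
  calc (2 : ℝ) ^ j
    _ ≤ 4 ^ j := by
      gcongr
      norm_num
    _ ≤ 4 ^ (2 + j - 1) := pow_le_pow_right₀ (by norm_num) (by omega)
    _ ≤ 2 * 4 ^ (2 + j - 1) := le_mul_of_one_le_left (by positivity) one_le_two

/-- As `b ≤ (1 + δ̄)²`, epoch `1` ends after the first step. -/
theorem measure_not_confident_priorBeta_le [Nonempty D] (hk : (Matrix.of k).PosSemidef)
    (hone : ∀ a, k a a = 1) (hσ : 0 < σ) (hsub : SubmodularVarReduction k (σ ^ 2))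
    (hdbar : 0 < dbar) (hb : 0 < b) (hb_le : b ≤ (1 + dbar) ^ 2) (hbΛ : b ≤ Λ) (hΛ : 8 ≤ Λ)
    (hbδ : Fintype.card D * Real.exp (-(b / 2)) ≤ 2 / 3 * δ)
    (hΛδ : Fintype.card D * (4 * ((Fintype.card D * (σ ^ 2 * Λ + 1)
      * (2 + Fintype.card D * Λ / ((1 + dbar) ^ 2 - 1)) + 1) * Real.exp (-(Λ / 2)))) ≤ δ / 3)
    {pb : Problem} {Ω : Type*} [MeasurableSpace Ω] {P : Measure Ω} {f : D → Ω → ℝ}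
    {z : ℕ → Ω → ℝ} {x : ℕ → Ω → D} (hmodel : IsModel P k (σ ^ 2) f z)
    (hrun : IsRun pb k (halvingParams σ dbar (priorBeta b Λ)) f z x) :
    P {ω | ¬ Confident pb k (halvingParams σ dbar (priorBeta b Λ)) (x · ω) (obs f z x · ω) (f · ω)}
      ≤ ENNReal.ofReal δ := by
  have hp : (halvingParams σ dbar (priorBeta b Λ)).Regular :=
    halvingParams_regular hσ hdbar ⟨b, hb, le_priorBeta hb hbΛ⟩
  have hratio : 0 < Fintype.card D * Λ / ((1 + dbar) ^ 2 - 1) :=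
    div_pos (by positivity) hp.gap_pos
  have hstart : ∀ ω, (runState pb k (halvingParams σ dbar (priorBeta b Λ)) f z x ω 1).M.Nonempty →
      2 ≤ (runState pb k (halvingParams σ dbar (priorBeta b Λ)) f z x ω 1).epoch := fun ω hM => by
    refine two_le_state_epoch_of_forall_le hk (fun a => (hone a).ge.trans_lt' one_pos) hp le_rfl hM
      fun a => ?_
    rw [halvingParams_eta_one, mul_one]
    calc priorBeta b Λ 1 * postVar k (σ ^ 2) (queries (x · ω) 1) a
      _ ≤ b * 1 := by
        rw [priorBeta_one]
        gcongr
        exact (postVar_le_kernel hk hp.s2_pos _ a).trans_eq (hone a)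
      _ ≤ (1 + dbar) ^ 2 := by rwa [mul_one]
  refine measure_not_confident_le_of_growth (p := halvingParams σ dbar (priorBeta b Λ)) (i₀ := 2)
    hmodel hk hone hsub hp hrun le_rfl hstart hb.le (fun e _ => le_priorBeta hb hbΛ e) hΛ (C := 1)
    (u := fun e => 4 ^ (e - 1))
    (fun e _ => one_le_pow₀ (by norm_num)) (fun e he => priorBeta_of_two_le b Λ he) one_pos
    (fun e _ => ?_) (fun e _ e' _ hle => pow_le_pow_right₀ (by norm_num) (by omega))
    two_pow_le_two_mul_four_pow (A := 2 + Fintype.card D * Λ / ((1 + dbar) ^ 2 - 1))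
    ?_ ?_ ?_
  · rw [halvingParams_eta_sq, one_mul, mul_inv_cancel₀ (by positivity)]
  · linarith
  · rw [mul_one]
    linarith [Real.log_le_sub_one_of_pos hratio]
  · rw [Nat.cast_one, one_mul, mul_one, mul_add]
    linarith

theorem exists_accurateWithProb_of_prior_accurate [Nonempty D] (hk : (Matrix.of k).PosSemidef)
    (hone : ∀ a, k a a = 1) (hσ : 0 < σ) (hsub : SubmodularVarReduction k (σ ^ 2))
    (hdbar : 0 < dbar) (hε : 0 < ε) (hε_lt : ε < 4 * (1 + dbar)) (hδ : 0 < δ) (hb : 0 < b)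
    (hbε : 16 * b ≤ ε ^ 2) (hbδ : Fintype.card D * Real.exp (-(b / 2)) ≤ 2 / 3 * δ) :
    ∃ β : ℕ → ℝ, (∃ c, 0 < c ∧ ∀ i, c ≤ β i) ∧
      AccurateWithProb k σ dbar β ε δ fun _ => True := by
  have htendsto := tendsto_quadratic_mul_exp_neg (Fintype.card D) (σ ^ 2) ((1 + dbar) ^ 2 - 1)
  obtain ⟨Λ, hΛ, hΛδ⟩ := ((Filter.eventually_ge_atTop (max 8 b)).and
    (htendsto.eventually_le_const (show 0 < δ / 3 by positivity))).exists
  obtain ⟨hΛ_ge, hbΛ⟩ := max_le_iff.1 hΛ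
  have hb_le : b ≤ (1 + dbar) ^ 2 := by nlinarith
  refine ⟨priorBeta b Λ, ⟨b, hb, le_priorBeta hb hbΛ⟩, fun pb Ω _ P _ f z x hmodel hrun => ?_⟩
  refine one_sub_le_measureReal hδ.le (measure_not_confident_priorBeta_le hk hone hσ hsub hdbar hb
    hb_le hbΛ hΛ_ge hbδ hΛδ hmodel hrun) fun ω hconf T hT _ =>
      hconf.accurate (t := 0) hT fun a _ => ?_
  have hwidth : √(priorBeta b Λ 1) * √(postVar k (σ ^ 2) (queries (x · ω) 1) a) ≤ ε / 4 := by
    rw [priorBeta_one, sqrt_mul_sqrt_le_iff hb.le (by positivity)]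
    calc b * postVar k (σ ^ 2) (queries (x · ω) 1) a
      _ ≤ b * 1 := by
        gcongr
        exact (postVar_le_kernel hk (pow_pos hσ 2) _ a).trans_eq (hone a)
      _ ≤ (ε / 4) ^ 2 := by linarith
  change 4 * (√(priorBeta b Λ 1) * √(postVar k (σ ^ 2) (queries (x · ω) 1) a)) ≤ ε
  linarith

end PriorAccurate

section Ladder

/-- Confidence parameters for which all epochs `e` with `4 ^ (e - 1) ≤ E` have the same target
`B E σ² ≤ (1 + δ̄)²` for the posterior variance, so that they end together with epoch `1`; the
parameters of later epochs grow. -/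
noncomputable def betaLadder (B E : ℝ) (e : ℕ) : ℝ :=
  B * max (max (E / 4 ^ (e - 1)) 1) (4 ^ (e - 1) / (4 * E))

variable {B E : ℝ}

theorem le_betaLadder (hB : 0 ≤ B) (e : ℕ) : B ≤ betaLadder B E e :=
  le_mul_of_one_le_right hB ((le_max_right _ _).trans (le_max_left _ _))

theorem betaLadder_mul_of_le {e : ℕ} (h : (4 : ℝ) ^ (e - 1) ≤ E) :
    betaLadder B E e * 4 ^ (e - 1) = B * E := by
  have hpow : (0 : ℝ) < 4 ^ (e - 1) := by positivity
  have hfst : 1 ≤ E / 4 ^ (e - 1) := (one_le_div hpow).2 h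
  have hsnd : (4 : ℝ) ^ (e - 1) / (4 * E) ≤ 1 := (div_le_one (by linarith)).2 (by linarith)
  rw [betaLadder, max_eq_left hfst, max_eq_left (hsnd.trans hfst), mul_assoc,
    div_mul_cancel₀ _ hpow.ne']

theorem betaLadder_one (hE : 1 ≤ E) : betaLadder B E 1 = B * E := by
  simpa only [Nat.sub_self, pow_zero, mul_one] using
    betaLadder_mul_of_le (B := B) (e := 1) (by simpa only [Nat.sub_self, pow_zero] using hE)

theorem betaLadder_of_ge {e : ℕ} (h : E ≤ (4 : ℝ) ^ (e - 1)) :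
    betaLadder B E e = B * max 1 (4 ^ (e - 1) / (4 * E)) := by
  rw [betaLadder, max_eq_right ((div_le_one (by positivity)).2 h)]

theorem betaLadder_mul_of_ge (hE : 0 < E) {e : ℕ} (h : E ≤ (4 : ℝ) ^ (e + 1)) :
    betaLadder B E (e + 2) * E = B * max E (4 ^ e) := by
  rw [betaLadder_of_ge h, mul_assoc, max_mul_of_nonneg _ _ hE.le, one_mul, Nat.add_succ_sub_one,
    pow_succ, mul_comm _ (4 : ℝ), mul_div_mul_left _ _ four_ne_zero, div_mul_cancel₀ _ hE.ne']

theorem exists_forall_le_four_pow (E : ℝ) :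
    ∃ i₀ : ℕ, 1 ≤ i₀ ∧ (∀ e, i₀ ≤ e → E ≤ (4 : ℝ) ^ (e - 1)) ∧
      ∀ e, 1 ≤ e → e < i₀ → (4 : ℝ) ^ (e - 1) ≤ E := by
  classical
  have hex : ∃ j : ℕ, E < (4 : ℝ) ^ j := pow_unbounded_of_one_lt E (by norm_num)
  refine ⟨Nat.find hex + 1, by omega, fun e he => (Nat.find_spec hex).le.trans
    (pow_le_pow_right₀ (by norm_num) (by omega)), fun e he he' => ?_⟩
  exact not_lt.1 (Nat.find_min hex (by omega))

theorem monotone_max_one_four_pow_div (hE : 0 < E) :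
    Monotone fun e : ℕ => max 1 ((4 : ℝ) ^ (e - 1) / (4 * E)) := fun e e' hle => by
  dsimp only
  gcongr
  norm_num

theorem two_pow_le_two_mul_max {i₀ : ℕ} (hi₀ : 1 ≤ i₀) (hE : 0 < E)
    (hle : E ≤ (4 : ℝ) ^ (i₀ - 1)) (j : ℕ) :
    (2 : ℝ) ^ j ≤ 2 * max 1 (4 ^ (i₀ + j - 1) / (4 * E)) := by
  have hquot : (4 : ℝ) ^ j / 4 ≤ 4 ^ (i₀ + j - 1) / (4 * E) := by
    rw [div_le_div_iff₀ four_pos (by positivity), Nat.sub_add_comm hi₀, pow_add]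
    nlinarith [pow_pos (four_pos (α := ℝ)) j]
  have hsq : (4 : ℝ) ^ j = (2 ^ j) ^ 2 := by
    rw [← pow_mul, mul_comm, pow_mul]
    norm_num
  have hamgm : (2 : ℝ) ^ j ≤ 1 + 4 ^ j / 4 := by nlinarith [sq_nonneg ((2 : ℝ) ^ j - 2)]
  linarith [le_max_left 1 ((4 : ℝ) ^ (i₀ + j - 1) / (4 * E)),
    le_max_right 1 ((4 : ℝ) ^ (i₀ + j - 1) / (4 * E))]

variable {D : Type*} [Fintype D] {k : D → D → ℝ} {σ dbar ε δ : ℝ}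

theorem le_state_epoch_of_betaLadder (hk : (Matrix.of k).PosSemidef) (hpos : ∀ a, 0 < k a a)
    (hσ : 0 < σ) (hdbar : 0 < dbar) (hB : 0 < B) (hE : 1 ≤ E) {pb : Problem} {x : ℕ → D}
    {y : ℕ → ℝ} {i₀ t : ℕ} (hi₀ : ∀ e, 1 ≤ e → e < i₀ → (4 : ℝ) ^ (e - 1) ≤ E) (ht : 1 ≤ t)
    (hM : (state pb k (halvingParams σ dbar (betaLadder B E)) x y t).M.Nonempty)
    (hfirst : 2 ≤ (state pb k (halvingParams σ dbar (betaLadder B E)) x y t).epoch) :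
    i₀ ≤ (state pb k (halvingParams σ dbar (betaLadder B E)) x y t).epoch := by
  have hp : (halvingParams σ dbar (betaLadder B E)).Regular :=
    halvingParams_regular hσ hdbar ⟨B, hB, le_betaLadder hB.le⟩
  have hdbar' : 0 ≤ 1 + dbar := by linarith
  by_contra! hlt
  have hdone := epochDone_of_lt_state_epoch hk hp.s2_pos t le_rfl hfirst
  refine not_epochDone_state_epoch hk hpos hp ht hM ?_
  rw [halvingParams_epochDone_iff hdbar' (hp.beta_pos _).le] at hdone ⊢
  rwa [betaLadder_mul_of_le (hi₀ _ (by omega) hlt), ← betaLadder_one hE,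
    ← mul_one (betaLadder B E 1), ← pow_zero 4, ← Nat.sub_self 1]

theorem mul_sqrt_mul_sqrt_le_of_betaLadder (hk : (Matrix.of k).PosSemidef) (hσ : 0 < σ)
    (hdbar : 0 < dbar) (hB : 0 < B) (hE : 1 ≤ E) (hε : 0 < ε)
    (hEε : E * ε ^ 2 = 16 * (1 + dbar) ^ 2) {pb : Problem} {x : ℕ → D} {y : ℕ → ℝ} {t : ℕ}
    (hfirst : 2 ≤ (state pb k (halvingParams σ dbar (betaLadder B E)) x y t).epoch)
    (hlast : E ≤ 4 ^ ((state pb k (halvingParams σ dbar (betaLadder B E)) x y t).epoch - 1)) {a : D}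
    (ha : a ∈ (state pb k (halvingParams σ dbar (betaLadder B E)) x y t).M) :
    4 * (√(betaLadder B E (state pb k (halvingParams σ dbar (betaLadder B E)) x y t).epoch)
      * √(postVar k (σ ^ 2) (queries x (t + 1)) a)) ≤ ε := by
  have hp : (halvingParams σ dbar (betaLadder B E)).Regular :=
    halvingParams_regular hσ hdbar ⟨B, hB, le_betaLadder hB.le⟩
  have hdbar' : 0 ≤ 1 + dbar := by linarith
  have hE_pos : 0 < E := one_pos.trans_le hE
  have hdone : ∀ j, 1 ≤ j → j < (state pb k (halvingParams σ dbar (betaLadder B E)) x y t).epoch →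
      betaLadder B E j * 4 ^ (j - 1) * postVar k (σ ^ 2) (queries x t) a ≤ (1 + dbar) ^ 2 :=
    fun j hj hjt => (halvingParams_epochDone_iff hdbar' (hp.beta_pos j).le _ _).1
      (epochDone_of_lt_state_epoch hk hp.s2_pos t hj hjt) a ha
  obtain ⟨e, he⟩ := Nat.exists_eq_add_of_le' hfirst
  rw [he] at hdone hlast ⊢
  set v := postVar k (σ ^ 2) (queries x t) a
  set v' := postVar k (σ ^ 2) (queries x (t + 1)) a
  have hv' : 0 ≤ v' := postVar_nonneg hk hp.s2_pos _ a
  have hv'v : v' ≤ v := by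
    simpa only [queries_append_singleton] using
      postVar_append_le_left hk hp.s2_pos (queries x t) ![x t] a
  have hdone_first : B * E * v ≤ (1 + dbar) ^ 2 := by
    simpa only [betaLadder_one hE, Nat.sub_self, pow_zero, mul_one] using hdone 1 le_rfl (by omega)
  have hdone_prev : B * 4 ^ e * v ≤ (1 + dbar) ^ 2 :=
    calc B * 4 ^ e * v
      _ ≤ betaLadder B E (e + 1) * 4 ^ e * v := by
        gcongr
        · exact hv'.trans hv'v
        · exact le_betaLadder hB.le _
      _ ≤ (1 + dbar) ^ 2 := hdone (e + 1) (by omega) (by omega)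
  have htarget : betaLadder B E (e + 2) * v' * E ≤ (ε / 4) ^ 2 * E :=
    calc betaLadder B E (e + 2) * v' * E
      _ = B * max E (4 ^ e) * v' := by rw [mul_right_comm, betaLadder_mul_of_ge hE_pos hlast]
      _ ≤ B * max E (4 ^ e) * v := by gcongr
      _ ≤ (1 + dbar) ^ 2 := by rcases max_choice E ((4 : ℝ) ^ e) with h | h <;> rwa [h]
      _ = (ε / 4) ^ 2 * E := by linarith
  have hwidth : √(betaLadder B E (e + 2)) * √v' ≤ ε / 4 :=
    (sqrt_mul_sqrt_le_iff (hp.beta_pos _).le (by positivity)).2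
      (le_of_mul_le_mul_right htarget hE_pos)
  linarith

theorem accurateWithProb_betaLadder [Nonempty D] (hk : (Matrix.of k).PosSemidef)
    (hone : ∀ a, k a a = 1) (hσ : 0 < σ) (hsub : SubmodularVarReduction k (σ ^ 2))
    (hdbar : 0 < dbar) (hε : 0 < ε) (hδ : 0 ≤ δ) (hB : 8 ≤ B) (hE : 1 ≤ E)
    (hEε : E * ε ^ 2 = 16 * (1 + dbar) ^ 2) {N₀ : ℕ} (hN₀ : 1 ≤ N₀) {A : ℝ} (hA : 2 ≤ A)
    (hlog : Real.log (Fintype.card D * B * (4 * E) / ((1 + dbar) ^ 2 - 1)) ≤ A)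
    (hbudget : Fintype.card D * (N₀ * Real.exp (-(B / 2))
      + 4 * ((Fintype.card D * (σ ^ 2 * B * (4 * E) + 1) * A + 1) * Real.exp (-(B / 2)))) ≤ δ)
    (hfirst : ∀ pb x y, IsGreedy pb k (halvingParams σ dbar (betaLadder B E)) x y →
      (state pb k (halvingParams σ dbar (betaLadder B E)) x y N₀).M.Nonempty →
      2 ≤ (state pb k (halvingParams σ dbar (betaLadder B E)) x y N₀).epoch) :
    AccurateWithProb k σ dbar (betaLadder B E) ε δ (N₀ + 1 ≤ ·) := by
  intro pb Ω _ P _ f z x hmodel hrun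
  have hB_pos : 0 < B := by linarith
  have hE_pos : 0 < E := by linarith
  have hp : (halvingParams σ dbar (betaLadder B E)).Regular :=
    halvingParams_regular hσ hdbar ⟨B, hB_pos, le_betaLadder hB_pos.le⟩
  obtain ⟨i₀, hi₀, hi₀_le, hlt_i₀⟩ := exists_forall_le_four_pow E
  have hfirst_run := fun ω => hfirst pb (x · ω) (obs f z x · ω) fun t a => hrun.greedy t ω a
  have hstart := fun ω hM => le_state_epoch_of_betaLadder hk
    (fun a => (hone a).ge.trans_lt' one_pos) hσ hdbar hB_pos hE hlt_i₀ hN₀ hM (hfirst_run ω hM)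
  refine one_sub_le_measureReal hδ (measure_not_confident_le_of_growth
    (p := halvingParams σ dbar (betaLadder B E)) hmodel hk hone hsub hp hrun hN₀ hstart hB_pos.le
    (fun e _ => le_betaLadder hB_pos.le e) hB (u := fun e => max 1 (4 ^ (e - 1) / (4 * E)))
    (C := 4 * E) (fun e _ => le_max_left _ _) (fun e he => betaLadder_of_ge (hi₀_le e he))
    (by positivity) (fun e _ => ?_) ((monotone_max_one_four_pow_div hE_pos).monotoneOn _)
    (two_pow_le_two_mul_max hi₀ hE_pos (hi₀_le i₀ le_rfl)) hA hlog hbudget)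
    fun ω hconf T _ hT => hconf.accurate hT fun a ha =>
      mul_sqrt_mul_sqrt_le_of_betaLadder hk hσ hdbar hB_pos hE hε hEε (hfirst_run ω ⟨a, ha⟩)
        (hi₀_le _ (hstart ω ⟨a, ha⟩)) ha
  rw [halvingParams_eta_sq, ← div_eq_mul_inv, one_le_div (by positivity), mul_comm]
  exact (div_le_iff₀ (by positivity)).1 (le_max_right _ _)

end Ladder

section BetaT

variable {n T : ℕ} {δ : ℝ}

theorem nine_lt_pi_sq : 9 < Real.pi ^ 2 := by nlinarith [Real.pi_gt_three]

theorem betaT_pos (hn : 1 ≤ n) (hδ : 0 < δ) (hδ_lt : δ < 1) (hT : 1 ≤ T) : 0 < betaT n δ T := by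
  have hnT : (1 : ℝ) ≤ n * T ^ 2 := by
    exact_mod_cast Nat.one_le_iff_ne_zero.2 (Nat.mul_ne_zero (by omega) (pow_ne_zero 2 (by omega)))
  refine mul_pos two_pos (Real.log_pos ((one_lt_div (by positivity)).2 ?_))
  nlinarith [nine_lt_pi_sq]

theorem mul_exp_neg_betaT_le (hn : 1 ≤ n) (hδ : 0 < δ) (hT : 1 ≤ T) :
    n * Real.exp (-(betaT n δ T / 2)) ≤ 2 / 3 * δ / (T : ℝ) ^ 2 := by
  have : (0 : ℝ) < n := Nat.cast_pos.2 hn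
  have : (0 : ℝ) < T := Nat.cast_pos.2 hT
  calc n * Real.exp (-(betaT n δ T / 2))
    _ = 6 * δ / T ^ 2 / Real.pi ^ 2 := by
      rw [betaT, mul_div_cancel_left₀ _ two_ne_zero, Real.exp_neg, Real.exp_log (by positivity)]
      field_simp
    _ ≤ 6 * δ / T ^ 2 / 9 := by
      gcongr
      exact nine_lt_pi_sq.le
    _ = 2 / 3 * δ / T ^ 2 := by ring

theorem eight_le_betaT (hn : 1 ≤ n) (hδ : 0 < δ) (hδ_lt : δ < 1) (hT : 7 ≤ T) :
    8 ≤ betaT n δ T := by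
  have hT_sq : (49 : ℝ) ≤ n * T ^ 2 := by
    exact_mod_cast (Nat.pow_le_pow_left hT 2).trans (Nat.le_mul_of_pos_left _ hn)
  have hexp : Real.exp 4 ≤ 60 :=
    calc Real.exp 4
      _ = Real.exp 1 ^ 4 := by rw [← Real.exp_nat_mul, Nat.cast_ofNat, mul_one]
      _ ≤ 2.75 ^ 4 := by
        gcongr
        linarith [Real.exp_one_lt_d9]
      _ ≤ 60 := by norm_num
  have hlog : 4 ≤ Real.log (n * (T : ℝ) ^ 2 * Real.pi ^ 2 / (6 * δ)) := by
    rw [Real.le_log_iff_exp_le (by positivity), le_div_iff₀ (by positivity)]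
    calc Real.exp 4 * (6 * δ)
      _ ≤ 60 * (6 * 1) := by gcongr
      _ ≤ 49 * 9 := by norm_num
      _ ≤ n * (T : ℝ) ^ 2 * Real.pi ^ 2 := by
        gcongr
        exact nine_lt_pi_sq.le
  rw [betaT]
  linarith

end BetaT

section C1

variable {σ g t : ℝ}

theorem sq_le_C1 (hσ : 0 < σ) : σ ^ 2 ≤ C1 σ := by
  have hinv : 0 < (σ ^ 2)⁻¹ := by positivity
  rw [C1, le_div_iff₀ (Real.log_pos (by linarith)), mul_comm, ← le_div_iff₀ (by positivity),
    one_div]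
  linarith [Real.log_le_sub_one_of_pos (show 0 < 1 + (σ ^ 2)⁻¹ by positivity)]

theorem C1_pos (hσ : 0 < σ) : 0 < C1 σ := (pow_pos hσ 2).trans_le (sq_le_C1 hσ)

theorem half_le_C1_mul (hσ : 0 < σ) (ht : 1 ≤ t) (hg : 1 / 2 * Real.log (1 + t / σ ^ 2) ≤ g) :
    1 / 2 ≤ C1 σ * g := by
  have hinv : 0 < (σ ^ 2)⁻¹ := by positivity
  have hlog : Real.log (1 + (σ ^ 2)⁻¹) ≤ Real.log (1 + t / σ ^ 2) := by
    rw [← one_div]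
    gcongr
  rw [C1, one_div_mul_eq_div, le_div_iff₀ (Real.log_pos (by linarith))]
  linarith

theorem sq_le_three_mul_C1_mul (hσ : 0 < σ) (ht : σ ^ 2 ≤ t)
    (hg : 1 / 2 * Real.log (1 + t / σ ^ 2) ≤ g) : σ ^ 2 ≤ 3 * (C1 σ * g) := by
  have hlog : Real.log 2 ≤ Real.log (1 + t / σ ^ 2) :=
    Real.log_le_log two_pos (by linarith [(one_le_div (pow_pos hσ 2)).2 ht])
  have hg_ge : 1 / 3 ≤ g := by linarith [Real.log_two_gt_d9]
  linarith [mul_le_mul (sq_le_C1 hσ) hg_ge (by norm_num) (C1_pos hσ).le]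

theorem le_four_mul_C1_mul (hσ : 0 < σ) (ht : 0 ≤ t) (htσ : t ≤ σ ^ 2)
    (hg : 1 / 2 * Real.log (1 + t / σ ^ 2) ≤ g) : t ≤ 4 * (C1 σ * g) := by
  have hsq : 0 < σ ^ 2 := by positivity
  have hu : 0 ≤ t / σ ^ 2 := by positivity
  have hu_le : t / σ ^ 2 ≤ 1 := (div_le_one hsq).2 htσ
  have hlog : t / σ ^ 2 / 2 ≤ Real.log (1 + t / σ ^ 2) := by
    refine le_trans ?_ (Real.one_sub_inv_le_log_of_pos (by positivity))
    rw [le_sub_comm, inv_le_iff_one_le_mul₀ (by positivity)]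
    nlinarith
  calc t
    _ = 4 * (σ ^ 2 * (t / σ ^ 2 / 4)) := by field_simp
    _ ≤ 4 * (C1 σ * g) := by
      gcongr
      · exact (C1_pos hσ).le
      · exact sq_le_C1 hσ
      · linarith

theorem two_mul_sq_mul_le (hσ : 0 < σ) (ht : 0 < t) (hg : 1 / 2 * Real.log (1 + t / σ ^ 2) ≤ g)
    {R : ℝ} (hR : 1 ≤ R) (hle : 6 * (C1 σ * g) * R ≤ t) : 2 * (σ ^ 2 * R) ≤ t := by
  rcases le_total (σ ^ 2) t with htσ | htσ
  · nlinarith [sq_le_three_mul_C1_mul hσ htσ hg]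
  · nlinarith [le_four_mul_C1_mul hσ ht.le htσ hg]

end C1

section HorizonBounds

/-- Numerical content of the condition on the time horizon `T` in units of `s = σ²`, with `n = |D|`,
`d = δ̄`, `g = C₁ γ_T`, `Y = 16 (1 + δ̄)² β_T / ε²` and the logarithmic factor `L`; the first epoch
of the ladder is designed to reach variances of order `1 / Y`. -/
structure HorizonBounds (n d s g Y L T : ℝ) : Prop where
  one_le_card : 1 ≤ n
  slack_pos : 0 < d
  slack_lt : (1 + d) ^ 2 < Y
  log_eq : Real.log (n * Y / d ^ 2) = L
  half_le_info : 1 / 2 ≤ g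
  info_le : 6 * g * (Y * L) + 4 * L ≤ T
  noise_le : 2 * (s * Y * L) ≤ T

theorem log_add_two_mul_log_le {n d Y : ℝ} (hn : 0 < n) (hd : 0 < d) (hY : (1 + d) ^ 2 ≤ Y) :
    Real.log n + 2 * Real.log ((1 + d) / d) ≤ Real.log (n * Y / d ^ 2) :=
  calc Real.log n + 2 * Real.log ((1 + d) / d)
    _ = Real.log (n * ((1 + d) / d) ^ 2) := by
      rw [Real.log_mul hn.ne' (by positivity), Real.log_pow, Nat.cast_ofNat]
    _ ≤ Real.log (n * Y / d ^ 2) := by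
      rw [div_pow, mul_div_assoc]
      gcongr

theorem two_le_log_mul {n d Y : ℝ} (hn : 1 ≤ n) (hd : 0 < d) (hY : (1 + d) ^ 2 ≤ Y) :
    2 ≤ Real.log (n * Y / d ^ 2) * (1 + d) := by
  have hlog : 1 / (1 + d) ≤ Real.log ((1 + d) / d) := by
    refine le_of_eq_of_le ?_ (Real.one_sub_inv_le_log_of_pos (by positivity))
    field_simp
    ring
  rw [← div_le_iff₀ (by positivity)]
  calc 2 / (1 + d)
    _ = 0 + 2 * (1 / (1 + d)) := by ring
    _ ≤ Real.log n + 2 * Real.log ((1 + d) / d) := by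
      gcongr
      exact Real.log_nonneg hn
    _ ≤ Real.log (n * Y / d ^ 2) := log_add_two_mul_log_le (by linarith) hd hY

theorem log_le_log_mul_div {n d Y : ℝ} (hn : 0 < n) (hd : 0 < d) (hY : (1 + d) ^ 2 ≤ Y) :
    Real.log n ≤ Real.log (n * Y / d ^ 2) := by
  have hlog : 0 ≤ Real.log ((1 + d) / d) :=
    Real.log_nonneg ((one_le_div hd).2 (by linarith))
  linarith [log_add_two_mul_log_le hn hd hY]

theorem two_mul_one_add_le_mul {d Y L : ℝ} (hd : 0 ≤ d) (hY : (1 + d) ^ 2 ≤ Y)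
    (hL : 2 ≤ L * (1 + d)) : 2 * (1 + d) ≤ Y * L := by
  have hL_pos : 0 < L := pos_of_mul_pos_left (by linarith) (by linarith : 0 ≤ 1 + d)
  calc 2 * (1 + d)
    _ ≤ L * (1 + d) * (1 + d) := by gcongr
    _ = (1 + d) ^ 2 * L := by ring
    _ ≤ Y * L := by gcongr

theorem horizonBounds_of_le {n d σ g Y c T : ℝ} (hn : 1 ≤ n) (hd : 0 < d) (hσ : 0 < σ)
    (hY : (1 + d) ^ 2 < Y) (hT : 1 ≤ T) (hg : 1 / 2 * Real.log (1 + T / σ ^ 2) ≤ g) (hc : 2 ≤ c)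
    (hle : (6 * (C1 σ * g * Y) + 2 * c) * Real.log (n * Y / d ^ 2) ≤ T) :
    HorizonBounds n d (σ ^ 2) (C1 σ * g) Y (Real.log (n * Y / d ^ 2)) T := by
  have hL := two_le_log_mul hn hd hY.le
  set L := Real.log (n * Y / d ^ 2)
  have hL_pos : 0 < L := pos_of_mul_pos_left (by linarith) (by linarith : 0 ≤ 1 + d)
  have hYL := two_mul_one_add_le_mul hd.le hY.le hL
  have hinfo : 6 * (C1 σ * g) * (Y * L) + 4 * L ≤ T := by
    linarith [mul_le_mul_of_nonneg_right hc hL_pos.le]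
  have hnoise := two_mul_sq_mul_le hσ (by linarith) hg (R := Y * L) (by linarith) (by linarith)
  exact ⟨hn, hd, hY, rfl, half_le_C1_mul hσ hT hg, hinfo, by linarith⟩

namespace HorizonBounds

variable {n d s g Y L T b : ℝ}

theorem two_le_mul (h : HorizonBounds n d s g Y L T) : 2 ≤ L * (1 + d) :=
  h.log_eq ▸ two_le_log_mul h.one_le_card h.slack_pos h.slack_lt.le

theorem log_le (h : HorizonBounds n d s g Y L T) : Real.log n ≤ L :=
  h.log_eq ▸ log_le_log_mul_div (by linarith [h.one_le_card]) h.slack_pos h.slack_lt.le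

theorem log_pos (h : HorizonBounds n d s g Y L T) : 0 < L :=
  pos_of_mul_pos_left (by linarith [h.two_le_mul]) (by linarith [h.slack_pos] : 0 ≤ 1 + d)

theorem target_pos (h : HorizonBounds n d s g Y L T) : 0 < Y :=
  h.slack_lt.trans_le' (sq_nonneg _)

theorem three_mul_le (h : HorizonBounds n d s g Y L T) : 3 * (Y * L) + 4 * L ≤ T := by
  linarith [h.info_le,
    mul_le_mul_of_nonneg_right h.half_le_info (mul_pos h.target_pos h.log_pos).le]

theorem six_mul_le (h : HorizonBounds n d s g Y L T) : 6 * (1 + d) ≤ T := by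
  linarith [h.three_mul_le, two_mul_one_add_le_mul h.slack_pos.le h.slack_lt.le h.two_le_mul,
    h.log_pos]

theorem log_mul_le (h : HorizonBounds n d s g Y L T) (hY : 8 ≤ Y) : 28 * L ≤ T := by
  linarith [h.three_mul_le, mul_le_mul_of_nonneg_right hY h.log_pos.le]

end HorizonBounds

end HorizonBounds

section Budget

variable {n d s g Y L T b δ : ℝ}

theorem mul_exp_three_half_mul_le (hδ : 0 < δ) (hδ_le : δ ≤ 1) (hn : 1 ≤ n) (hT : 0 < T)
    (hb : n * Real.exp (-(b / 2)) ≤ 2 / 3 * δ / T ^ 2) {q : ℝ} (hq : q ≤ 1.8 * T ^ 3) :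
    n * (Real.exp (-(3 / 2 * b / 2)) * q) ≤ δ := by
  set r := Real.exp (-(b / 4)) with hr
  have hr_pos : 0 < r := Real.exp_pos _
  have hexp : Real.exp (-(b / 2)) = r ^ 2 := by
    rw [hr, ← Real.exp_nat_mul]
    ring_nf
  have hexp' : Real.exp (-(3 / 2 * b / 2)) = r ^ 3 := by
    rw [hr, ← Real.exp_nat_mul]
    ring_nf
  rw [hexp, le_div_iff₀ (by positivity)] at hb
  have hrT : r * T ≤ 0.82 := by
    refine le_of_sq_le_sq ?_ (by norm_num)
    calc (r * T) ^ 2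
      _ ≤ n * (r * T) ^ 2 := le_mul_of_one_le_left (sq_nonneg _) hn
      _ = n * r ^ 2 * T ^ 2 := by ring
      _ ≤ 2 / 3 * 1 := by linarith
      _ ≤ 0.82 ^ 2 := by norm_num
  calc n * (Real.exp (-(3 / 2 * b / 2)) * q)
    _ ≤ n * (r ^ 3 * (1.8 * T ^ 3)) := by
      rw [hexp']
      gcongr
    _ = n * r ^ 2 * T ^ 2 * (1.8 * (r * T)) := by ring
    _ ≤ 2 / 3 * δ * (1.8 * 0.82) := by gcongr
    _ ≤ δ := by linarith

theorem mul_exp_two_mul_le (hδ : 0 < δ) (hδ_le : δ ≤ 1) (hn : 0 < n) (hT : 0 < T)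
    (hb : n * Real.exp (-(b / 2)) ≤ 2 / 3 * δ / T ^ 2) {q : ℝ} (hq : q ≤ n * T ^ 4) :
    n * (Real.exp (-(2 * b / 2)) * q) ≤ δ := by
  have hexp : Real.exp (-(2 * b / 2)) = Real.exp (-(b / 2)) ^ 2 := by
    rw [← Real.exp_nat_mul]
    ring_nf
  rw [le_div_iff₀ (by positivity)] at hb
  calc n * (Real.exp (-(2 * b / 2)) * q)
    _ ≤ n * (Real.exp (-(b / 2)) ^ 2 * (n * T ^ 4)) := by
      rw [hexp]
      gcongr
    _ = (n * Real.exp (-(b / 2)) * T ^ 2) ^ 2 := by ring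
    _ ≤ (2 / 3 * δ) ^ 2 := by gcongr
    _ ≤ δ := by nlinarith

namespace HorizonBounds

theorem count_le_of_four_le (h : HorizonBounds n d s g Y L T) (hs : 0 ≤ s) (hY : 8 ≤ Y)
    (hT : 7 ≤ T) (hn : 4 ≤ n) (hL : 1 ≤ L) :
    T - 1 + 4 * (n * (4 * (2 * (s * Y)) + 1) * (L + 2.1) + 1) ≤ n * T ^ 4 := by
  have hW : 0 ≤ s * Y := mul_nonneg hs h.target_pos.le
  have hW_le : 2 * (s * Y) ≤ T := by nlinarith [h.noise_le]
  have hstep : (4 * (2 * (s * Y)) + 1) * (L + 2.1) ≤ 13 * T := by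
    linarith [h.noise_le, h.log_mul_le hY]
  have hcube : (7 : ℝ) ^ 3 ≤ T ^ 3 := by gcongr
  calc T - 1 + 4 * (n * (4 * (2 * (s * Y)) + 1) * (L + 2.1) + 1)
    _ = T + 3 + 4 * (n * ((4 * (2 * (s * Y)) + 1) * (L + 2.1))) := by ring
    _ ≤ n * T + n * T + 4 * (n * (13 * T)) := by
      gcongr
      · nlinarith
      · nlinarith
    _ ≤ n * (T * 7 ^ 3) := by nlinarith
    _ ≤ n * (T * T ^ 3) := by gcongr
    _ = n * T ^ 4 := by ring

theorem step_le (h : HorizonBounds n d s g Y L T) (hY : 8 ≤ Y) :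
    (4 * (3 / 2 * (s * Y)) + 1) * (L + 2.1) ≤ 3 * T + 12.6 * (s * Y) + T / 28 + 2.1 := by
  linarith [h.noise_le, h.log_mul_le hY]

theorem count_le_of_le_three (h : HorizonBounds n d s g Y L T) (hs : 0 ≤ s) (hY : 8 ≤ Y)
    (hT : 16 ≤ T) (hn : n ≤ 3) (hL : 0.69 ≤ L) :
    T - 1 + 4 * (n * (4 * (3 / 2 * (s * Y)) + 1) * (L + 2.1) + 1) ≤ 1.8 * T ^ 3 := by
  have hW : 0 ≤ s * Y := mul_nonneg hs h.target_pos.le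
  have hW_le : s * Y ≤ 3 / 4 * T := by nlinarith [h.noise_le]
  have hstep : (4 * (3 / 2 * (s * Y)) + 1) * (L + 2.1) ≤ 12.6 * T + 2.1 := by
    linarith [h.step_le hY]
  have hsq : (16 : ℝ) ^ 2 ≤ T ^ 2 := by gcongr
  calc T - 1 + 4 * (n * (4 * (3 / 2 * (s * Y)) + 1) * (L + 2.1) + 1)
    _ = T + 3 + 4 * (n * ((4 * (3 / 2 * (s * Y)) + 1) * (L + 2.1))) := by ring
    _ ≤ T + 3 + 4 * (3 * (12.6 * T + 2.1)) := by
      gcongr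
    _ ≤ 1.8 * (T * 16 ^ 2) := by linarith
    _ ≤ 1.8 * (T * T ^ 2) := by gcongr
    _ = 1.8 * T ^ 3 := by ring

theorem four_mul_noise_le (h : HorizonBounds n d s g Y L T) (hs : 0 ≤ s) :
    4 * (s * Y) ≤ T * (1 + d) := by
  linarith [mul_le_mul_of_nonneg_left h.two_le_mul (mul_nonneg hs h.target_pos.le),
    mul_le_mul_of_nonneg_right h.noise_le (by linarith [h.slack_pos] : 0 ≤ 1 + d)]

theorem count_le_of_eq_one (h : HorizonBounds 1 d s g Y L T) (hs : 0 ≤ s) (hY : 8 ≤ Y)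
    (hT : 7 ≤ T) :
    T - 1 + 4 * (1 * (4 * (3 / 2 * (s * Y)) + 1) * (L + 2.1) + 1) ≤ 1.8 * T ^ 3 := by
  have hW_le : 24 * (s * Y) ≤ T ^ 2 := by
    nlinarith [h.four_mul_noise_le hs, h.six_mul_le]
  nlinarith [h.step_le hY, mul_nonneg (by linarith : 0 ≤ T) (sub_nonneg.2 hT),
    mul_nonneg (sq_nonneg T) (sub_nonneg.2 hT)]

theorem design_le (h : HorizonBounds n d s g Y L T) {κ l : ℝ} (hl : κ * l ≤ (3 - κ) * L)
    (hlL : l + 1 ≤ 3 * L) : (2 * κ * (g * Y) + 1) * (L + l) ≤ T - 1 := by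
  have hgY : 0 ≤ g * Y := mul_nonneg (by linarith [h.half_le_info]) h.target_pos.le
  linarith [h.info_le, mul_le_mul_of_nonneg_left hl hgY]

end HorizonBounds

end Budget

section FirstEpoch

variable {D : Type*} [Fintype D] {k : D → D → ℝ} {σ dbar B E : ℝ} {pb : Problem}
  {x : ℕ → D} {y : ℕ → ℝ}

theorem epochBound_one_of_gamma [Nonempty D] (hk : (Matrix.of k).PosSemidef)
    (hone : ∀ a, k a a ≤ 1) (hσ : 0 < σ) (hdbar : 0 < dbar) (hB : 0 < B) (hE : 1 ≤ E) {T m : ℕ}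
    (hm : 0 < m) (hmT : m ≤ T)
    (hdesign : 2 * (B * E) * (C1 σ * gamma k (σ ^ 2) T) ≤ m) {A : ℝ}
    (hlog : Real.log (Fintype.card D * (B * E) / ((1 + dbar) ^ 2 - 1)) ≤ A) :
    EpochBound k (halvingParams σ dbar (betaLadder B E)) 1 ⌈m * A⌉₊ := by
  have hβ : (halvingParams σ dbar (betaLadder B E)).beta 1 = B * E := betaLadder_one hE
  obtain ⟨X, hX⟩ := exists_mul_postVar_le hk hσ hone m
  refine epochBound_ceil (p := halvingParams σ dbar (betaLadder B E)) (S := X)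
    (halvingParams_regular hσ hdbar ⟨B, hB, le_betaLadder hB.le⟩) hm (fun a => ?_) ?_
  · rw [halvingParams_eta_one, one_pow, hβ]
    refine le_of_mul_le_mul_left ?_ (Nat.cast_pos.2 hm : (0 : ℝ) < m)
    calc m * (B * E * postVar k (σ ^ 2) X a)
      _ = B * E * (m * postVar k (σ ^ 2) X a) := by ring
      _ ≤ B * E * (2 * (C1 σ * gamma k (σ ^ 2) m)) := by
        gcongr B * E * ?_
        exact hX a
      _ ≤ B * E * (2 * (C1 σ * gamma k (σ ^ 2) T)) := by
        have hC1 := C1_pos hσ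
        gcongr
        exact gamma_mono hk (pow_pos hσ 2) hmT
      _ ≤ m * 1 := by linarith
  · rwa [halvingParams_eta_one, one_pow, mul_one, hβ]

theorem two_le_state_epoch_of_gamma [Nonempty D] (hk : (Matrix.of k).PosSemidef)
    (hone : ∀ a, k a a = 1) (hσ : 0 < σ) (hsub : SubmodularVarReduction k (σ ^ 2))
    (hdbar : 0 < dbar) (hB : 0 < B) (hE : 1 ≤ E)
    (hgreedy : IsGreedy pb k (halvingParams σ dbar (betaLadder B E)) x y) {T N : ℕ} (hNT : N ≤ T)
    {m : ℝ} (hm : 0 < m) (hdesign : 2 * (B * E) * (C1 σ * gamma k (σ ^ 2) T) ≤ m) {A : ℝ}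
    (hA : 1 ≤ A)
    (hlog : Real.log (Fintype.card D * (B * E) / ((1 + dbar) ^ 2 - 1)) ≤ A)
    (hN : (m + 1) * A ≤ N)
    (hM : (state pb k (halvingParams σ dbar (betaLadder B E)) x y N).M.Nonempty) :
    2 ≤ (state pb k (halvingParams σ dbar (betaLadder B E)) x y N).epoch := by
  have hceil_pos : 0 < ⌈m⌉₊ := Nat.ceil_pos.2 hm
  have hceil_lt : (⌈m⌉₊ : ℝ) < m + 1 := Nat.ceil_lt_add_one hm.le
  have hceil_le : ⌈m⌉₊ ≤ N := by
    have : m + 1 ≤ N := (le_mul_of_one_le_right (by linarith) hA).trans hN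
    exact_mod_cast hceil_lt.le.trans this
  have hA_pos : 0 < A := by linarith
  have hlength := epochBound_one_of_gamma hk (fun a => (hone a).le) hσ hdbar hB hE hceil_pos
    (hceil_le.trans hNT) (hdesign.trans (Nat.le_ceil m)) hlog
  have hlength_le : 0 + ⌈⌈m⌉₊ * A⌉₊ ≤ N := by
    rw [zero_add, Nat.ceil_le]
    exact (mul_le_mul_of_nonneg_right hceil_lt.le hA_pos.le).trans hN
  have hlength_pos : 1 ≤ 0 + ⌈⌈m⌉₊ * A⌉₊ := by
    rw [zero_add]
    exact Nat.ceil_pos.2 (mul_pos (Nat.cast_pos.2 hceil_pos) hA_pos)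
  exact (Nat.succ_le_of_lt (hlength.lt_state_epoch hk hone hsub
    (halvingParams_regular hσ hdbar ⟨B, hB, le_betaLadder hB.le⟩) hgreedy le_rfl hlength_pos
    (hM.mono (state_M_antitone _ _ _ _ _ hlength_le)))).trans
      (state_epoch_monotone _ _ _ _ _ hlength_le)

theorem two_le_state_epoch_of_subsingleton [Subsingleton D] (hk : (Matrix.of k).PosSemidef)
    (hpos : ∀ a, 0 < k a a) (hσ : 0 < σ) (hdbar : 0 < dbar) (hB : 0 < B) (hE : 1 ≤ E) {N : ℕ}
    (hN : 1 ≤ N) (hle : B * E * σ ^ 2 ≤ (1 + dbar) ^ 2 * N)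
    (hM : (state pb k (halvingParams σ dbar (betaLadder B E)) x y N).M.Nonempty) :
    2 ≤ (state pb k (halvingParams σ dbar (betaLadder B E)) x y N).epoch := by
  refine two_le_state_epoch_of_forall_le hk hpos
    (halvingParams_regular hσ hdbar ⟨B, hB, le_betaLadder hB.le⟩) hN hM fun a => ?_
  have hconst : queries x N = fun _ => a := funext fun _ => Subsingleton.elim _ _
  have hN' : (0 : ℝ) < N := Nat.cast_pos.2 hN
  rw [halvingParams_eta_one, mul_one, hconst]
  calc betaLadder B E 1 * postVar k (σ ^ 2) (fun _ : Fin N => a) a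
    _ ≤ B * E * (σ ^ 2 / N) := by
      rw [betaLadder_one hE]
      gcongr
      exact postVar_const_le hk (pow_pos hσ 2) (by omega) a
    _ ≤ (1 + dbar) ^ 2 := by
      rw [← mul_div_assoc, div_le_iff₀ hN']
      exact hle

end FirstEpoch

section Accuracy

namespace HorizonBounds

variable {n d s g Y L T : ℝ}

theorem log_div_gap_le (h : HorizonBounds n d s g Y L T) {κ : ℝ} (hκ : 0 < κ) :
    Real.log (n * (κ * Y) / ((1 + d) ^ 2 - 1)) ≤ L + Real.log κ := by
  have hn : 0 < n := by linarith [h.one_le_card]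
  have hY := h.target_pos
  have hd := h.slack_pos
  have hgap : d ^ 2 ≤ (1 + d) ^ 2 - 1 := by linarith
  calc Real.log (n * (κ * Y) / ((1 + d) ^ 2 - 1))
    _ ≤ Real.log (n * Y / d ^ 2 * κ) := by
      refine Real.log_le_log (div_pos (by positivity) (by nlinarith)) ?_
      calc n * (κ * Y) / ((1 + d) ^ 2 - 1)
        _ ≤ n * (κ * Y) / d ^ 2 := by gcongr
        _ = n * Y / d ^ 2 * κ := by ring
    _ = L + Real.log κ := by rw [Real.log_mul (by positivity) hκ.ne', h.log_eq]

end HorizonBounds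

variable {D : Type*} [Fintype D] [Nonempty D] {k : D → D → ℝ} {σ dbar ε δ b E L : ℝ} {T : ℕ}

theorem accurateWithProb_of_horizonBounds (hk : (Matrix.of k).PosSemidef)
    (hone : ∀ a, k a a = 1) (hσ : 0 < σ) (hsub : SubmodularVarReduction k (σ ^ 2)) (hε : 0 < ε)
    (hδ : 0 ≤ δ) (hb : 8 ≤ b) (hE : 1 ≤ E) (hEε : E * ε ^ 2 = 16 * (1 + dbar) ^ 2) {g κ : ℝ}
    (h : HorizonBounds (Fintype.card D) dbar (σ ^ 2) g (E * b) L T) (hκ : 1 ≤ κ) (hκ_le : κ ≤ 2)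
    (hbudget : Fintype.card D * (Real.exp (-(κ * b / 2)) * (T - 1
      + 4 * (Fintype.card D * (4 * (κ * (σ ^ 2 * (E * b))) + 1) * (L + 2.1) + 1))) ≤ δ)
    (hfirst : ∀ pb x y, IsGreedy pb k (halvingParams σ dbar (betaLadder (κ * b) E)) x y →
      (state pb k (halvingParams σ dbar (betaLadder (κ * b) E)) x y (T - 1)).M.Nonempty →
      2 ≤ (state pb k (halvingParams σ dbar (betaLadder (κ * b) E)) x y (T - 1)).epoch) :
    AccurateWithProb k σ dbar (betaLadder (κ * b) E) ε δ (T ≤ ·) := by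
  have hdbar := h.slack_pos
  have hT : 2 ≤ T := by
    have : (2 : ℝ) ≤ T := by linarith [h.six_mul_le, h.one_le_card]
    exact_mod_cast this
  have hlog : Real.log (Fintype.card D * (κ * b) * (4 * E) / ((1 + dbar) ^ 2 - 1)) ≤ L + 2.1 :=
    calc Real.log (Fintype.card D * (κ * b) * (4 * E) / ((1 + dbar) ^ 2 - 1))
      _ = Real.log (Fintype.card D * (4 * κ * (E * b)) / ((1 + dbar) ^ 2 - 1)) := by ring_nf
      _ ≤ L + Real.log (4 * κ) := h.log_div_gap_le (by linarith)
      _ ≤ L + Real.log (2 ^ 3) := by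
        gcongr
        linarith
      _ ≤ L + 2.1 := by
        rw [Real.log_pow]
        push_cast
        linarith [Real.log_two_lt_d9]
  refine (accurateWithProb_betaLadder hk hone hσ hsub hdbar hε hδ (by nlinarith) hE hEε
    (N₀ := T - 1) (by omega) (by linarith [h.log_pos]) hlog (hbudget.trans_eq' ?_) hfirst).mono
      fun t _ ht => by omega
  rw [Nat.cast_sub (by omega), Nat.cast_one]
  ring

theorem two_le_state_epoch_of_horizonBounds (hk : (Matrix.of k).PosSemidef)
    (hone : ∀ a, k a a = 1) (hσ : 0 < σ) (hsub : SubmodularVarReduction k (σ ^ 2)) (hb : 0 < b)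
    (hE : 1 ≤ E) {κ : ℝ}
    (h : HorizonBounds (Fintype.card D) dbar (σ ^ 2) (C1 σ * gamma k (σ ^ 2) T) (E * b) L T)
    (hκ : 0 < κ) (hκ_log : κ * Real.log κ ≤ (3 - κ) * L) (hlog_le : Real.log κ + 1 ≤ 3 * L)
    (hone_le : 1 ≤ L + Real.log κ) {pb : Problem} {x : ℕ → D} {y : ℕ → ℝ}
    (hgreedy : IsGreedy pb k (halvingParams σ dbar (betaLadder (κ * b) E)) x y)
    (hM : (state pb k (halvingParams σ dbar (betaLadder (κ * b) E)) x y (T - 1)).M.Nonempty) :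
    2 ≤ (state pb k (halvingParams σ dbar (betaLadder (κ * b) E)) x y (T - 1)).epoch := by
  have hT : 1 ≤ T := by
    have : (1 : ℝ) ≤ T := by linarith [h.six_mul_le, h.slack_pos]
    exact_mod_cast this
  have hg : 0 < C1 σ * gamma k (σ ^ 2) T := by linarith [h.half_le_info]
  refine two_le_state_epoch_of_gamma hk hone hσ hsub h.slack_pos (mul_pos hκ hb) hE hgreedy
    (T.sub_le 1) (m := 2 * κ * (C1 σ * gamma k (σ ^ 2) T * (E * b))) (by positivity)
    (le_of_eq (by ring)) hone_le ?_ ?_ hM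
  · rw [mul_assoc κ, mul_comm b]
    exact h.log_div_gap_le hκ
  · rw [Nat.cast_sub hT, Nat.cast_one]
    exact h.design_le hκ_log hlog_le

theorem accurateWithProb_two_of_four_le_card (hk : (Matrix.of k).PosSemidef)
    (hone : ∀ a, k a a = 1) (hσ : 0 < σ) (hsub : SubmodularVarReduction k (σ ^ 2)) (hε : 0 < ε)
    (hδ : 0 < δ) (hδ_le : δ ≤ 1) (hb : 8 ≤ b) (hE : 1 ≤ E)
    (hEε : E * ε ^ 2 = 16 * (1 + dbar) ^ 2)
    (h : HorizonBounds (Fintype.card D) dbar (σ ^ 2) (C1 σ * gamma k (σ ^ 2) T) (E * b) L T)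
    (hT : 7 ≤ T) (hbT : Fintype.card D * Real.exp (-(b / 2)) ≤ 2 / 3 * δ / T ^ 2)
    (hcard : 4 ≤ Fintype.card D) :
    AccurateWithProb k σ dbar (betaLadder (2 * b) E) ε δ (T ≤ ·) := by
  have hT' : (7 : ℝ) ≤ T := by exact_mod_cast hT
  have hcard' : (4 : ℝ) ≤ Fintype.card D := by exact_mod_cast hcard
  have hL : 2 * Real.log 2 ≤ L :=
    calc 2 * Real.log 2
      _ = Real.log (2 ^ 2) := by rw [Real.log_pow, Nat.cast_ofNat]
      _ ≤ Real.log (Fintype.card D) := by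
        gcongr
        linarith
      _ ≤ L := h.log_le
  have hlog_gt := Real.log_two_gt_d9
  have hlog_lt := Real.log_two_lt_d9
  exact accurateWithProb_of_horizonBounds hk hone hσ hsub hε hδ.le hb hE hEε h one_le_two le_rfl
    (mul_exp_two_mul_le hδ hδ_le (by linarith) (by linarith) hbT
      (h.count_le_of_four_le (sq_nonneg σ) (by nlinarith) hT' hcard' (by linarith)))
    fun _ _ _ => two_le_state_epoch_of_horizonBounds hk hone hσ hsub (by linarith) hE h two_pos
      (by linarith) (by linarith) (by linarith)

theorem accurateWithProb_three_half_of_card_le_three (hk : (Matrix.of k).PosSemidef)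
    (hone : ∀ a, k a a = 1) (hσ : 0 < σ) (hsub : SubmodularVarReduction k (σ ^ 2)) (hε : 0 < ε)
    (hδ : 0 < δ) (hδ_le : δ ≤ 1) (hb : 8 ≤ b) (hE : 1 ≤ E)
    (hEε : E * ε ^ 2 = 16 * (1 + dbar) ^ 2)
    (h : HorizonBounds (Fintype.card D) dbar (σ ^ 2) (C1 σ * gamma k (σ ^ 2) T) (E * b) L T)
    (hbT : Fintype.card D * Real.exp (-(b / 2)) ≤ 2 / 3 * δ / T ^ 2)
    (hcard : 2 ≤ Fintype.card D) (hcard_le : Fintype.card D ≤ 3) :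
    AccurateWithProb k σ dbar (betaLadder (3 / 2 * b) E) ε δ (T ≤ ·) := by
  have hcard' : (2 : ℝ) ≤ Fintype.card D := by exact_mod_cast hcard
  have hY : 8 ≤ E * b := by nlinarith
  have hL : Real.log 2 ≤ L := (Real.log_le_log two_pos hcard').trans h.log_le
  have hlog_gt := Real.log_two_gt_d9
  have hlog_three_half : 1 / 3 ≤ Real.log (3 / 2) :=
    (Real.one_sub_inv_le_log_of_pos (by norm_num)).trans' (by norm_num)
  have hlog_three_half' : Real.log (3 / 2) ≤ 1 / 2 :=
    (Real.log_le_sub_one_of_pos (by norm_num)).trans (by norm_num)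
  have hT : (16 : ℝ) ≤ T := by linarith [h.log_mul_le hY]
  exact accurateWithProb_of_horizonBounds hk hone hσ hsub hε hδ.le hb hE hEε h (by norm_num)
    (by norm_num) (mul_exp_three_half_mul_le hδ hδ_le (by linarith) (by linarith) hbT
      (h.count_le_of_le_three (sq_nonneg σ) hY hT (by exact_mod_cast hcard_le) (by linarith)))
    fun _ _ _ => two_le_state_epoch_of_horizonBounds hk hone hσ hsub (by linarith) hE h
      (by norm_num) (by linarith) (by linarith) (by linarith)

theorem accurateWithProb_three_half_of_card_eq_one (hk : (Matrix.of k).PosSemidef)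
    (hone : ∀ a, k a a = 1) (hσ : 0 < σ) (hsub : SubmodularVarReduction k (σ ^ 2)) (hε : 0 < ε)
    (hδ : 0 < δ) (hδ_le : δ ≤ 1) (hb : 8 ≤ b) (hE : 1 ≤ E)
    (hEε : E * ε ^ 2 = 16 * (1 + dbar) ^ 2) {g : ℝ}
    (h : HorizonBounds (Fintype.card D) dbar (σ ^ 2) g (E * b) L T) (hT : 7 ≤ T)
    (hbT : Fintype.card D * Real.exp (-(b / 2)) ≤ 2 / 3 * δ / T ^ 2)
    (hcard : Fintype.card D = 1) :
    AccurateWithProb k σ dbar (betaLadder (3 / 2 * b) E) ε δ (T ≤ ·) := by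
  have hT' : (7 : ℝ) ≤ T := by exact_mod_cast hT
  have hsingle : Subsingleton D := Fintype.card_le_one_iff_subsingleton.1 hcard.le
  have hdbar := h.slack_pos
  have hnoise := h.four_mul_noise_le (sq_nonneg σ)
  refine accurateWithProb_of_horizonBounds hk hone hσ hsub hε hδ.le hb hE hEε h (by norm_num)
    (by norm_num) (mul_exp_three_half_mul_le hδ hδ_le h.one_le_card (by linarith) hbT ?_)
    fun _ _ _ _ => two_le_state_epoch_of_subsingleton hk (fun a => (hone a).ge.trans_lt' one_pos)
      hσ hdbar (by linarith) hE (by omega) ?_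
  · rw [hcard, Nat.cast_one] at h ⊢
    exact h.count_le_of_eq_one (sq_nonneg σ) (by nlinarith) hT'
  · rw [Nat.cast_sub (by omega), Nat.cast_one]
    calc 3 / 2 * b * E * σ ^ 2
      _ = 3 / 8 * (4 * (σ ^ 2 * (E * b))) := by ring
      _ ≤ 3 / 8 * (T * (1 + dbar)) := by gcongr
      _ ≤ (T - 1) * (1 + dbar) := by nlinarith
      _ ≤ (1 + dbar) ^ 2 * (T - 1) := by
        rw [mul_comm]
        gcongr
        · linarith
        · exact le_self_pow₀ (by linarith) two_ne_zero

theorem exists_accurateWithProb_of_horizonBounds (hk : (Matrix.of k).PosSemidef)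
    (hone : ∀ a, k a a = 1) (hσ : 0 < σ) (hsub : SubmodularVarReduction k (σ ^ 2)) (hε : 0 < ε)
    (hδ : 0 < δ) (hδ_le : δ ≤ 1) (hb : 8 ≤ b) (hE : 1 ≤ E)
    (hEε : E * ε ^ 2 = 16 * (1 + dbar) ^ 2)
    (h : HorizonBounds (Fintype.card D) dbar (σ ^ 2) (C1 σ * gamma k (σ ^ 2) T) (E * b) L T)
    (hT : 7 ≤ T) (hbT : Fintype.card D * Real.exp (-(b / 2)) ≤ 2 / 3 * δ / T ^ 2) :
    ∃ β : ℕ → ℝ, (∃ c, 0 < c ∧ ∀ i, c ≤ β i) ∧ AccurateWithProb k σ dbar β ε δ (T ≤ ·) := by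
  have hbelow : ∀ κ : ℝ, 0 < κ → ∃ c, 0 < c ∧ ∀ i, c ≤ betaLadder (κ * b) E i := fun κ hκ =>
    ⟨κ * b, by positivity, le_betaLadder (by positivity)⟩
  rcases lt_or_ge 3 (Fintype.card D) with hfour | hthree
  · exact ⟨_, hbelow 2 two_pos, accurateWithProb_two_of_four_le_card hk hone hσ hsub hε hδ hδ_le hb
      hE hEε h hT hbT hfour⟩
  refine ⟨_, hbelow (3 / 2) (by norm_num), ?_⟩
  rcases (Nat.succ_le_of_lt Fintype.card_pos : 1 ≤ Fintype.card D).eq_or_lt with hcard | hcard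
  · exact accurateWithProb_three_half_of_card_eq_one hk hone hσ hsub hε hδ hδ_le hb hE hEε h hT hbT
      hcard.symm
  · exact accurateWithProb_three_half_of_card_le_three hk hone hσ hsub hε hδ hδ_le hb hE hEε h hbT
      hcard hthree

end Accuracy

section Threshold

theorem two_le_ceil_logb {w : ℝ} (hw : 2 < w) : 2 ≤ (⌈Real.logb 2 w⌉ : ℝ) := by
  have hlt : (1 : ℤ) < ⌈Real.logb 2 w⌉ := by
    rwa [Int.lt_ceil, Int.cast_one, Real.lt_logb_iff_rpow_lt one_lt_two (by linarith),
      Real.rpow_one]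
  exact_mod_cast hlt

theorem two_le_ceil_logb_div {d ε : ℝ} (hε : 0 < ε) (hε_lt : ε < 4 * (1 + d)) :
    2 ≤ (⌈Real.logb 2 (8 * (1 + d) / ε)⌉ : ℝ) :=
  two_le_ceil_logb ((lt_div_iff₀ hε).2 (by linarith))

theorem logFactor_eq (n : ℕ) (d ε δ : ℝ) (T : ℕ) :
    logFactor n d ε δ T
      = Real.log (n * (16 * (1 + d) ^ 2 / ε ^ 2 * betaT n δ T) / d ^ 2) := by
  rw [logFactor]
  congr 1
  rw [mul_comm (d ^ 2), ← div_div]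
  ring

theorem half_log_le_gamma {D : Type*} [Finite D] [Nonempty D] {k : D → D → ℝ}
    (hone : ∀ a, k a a = 1) (s2 : ℝ) (T : ℕ) :
    1 / 2 * Real.log (1 + T / s2) ≤ gamma k s2 T := by
  obtain ⟨a⟩ := ‹Nonempty D›
  have h := half_log_one_add_mul_le_gamma k s2 T a
  rwa [hone, mul_one_div] at h

variable {D : Type*} [Fintype D] {k : D → D → ℝ} {σ dbar ε δ : ℝ} {T : ℕ}

theorem threshold_eq_target (k : D → D → ℝ) (σ dbar ε δ : ℝ) (T : ℕ) :
    threshold k σ dbar ε δ T = (6 * (C1 σ * gamma k (σ ^ 2) T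
        * (16 * (1 + dbar) ^ 2 / ε ^ 2 * betaT (Fintype.card D) δ T))
      + 2 * (⌈Real.logb 2 (8 * (1 + dbar) / ε)⌉ : ℝ))
        * Real.log (Fintype.card D
          * (16 * (1 + dbar) ^ 2 / ε ^ 2 * betaT (Fintype.card D) δ T) / dbar ^ 2) := by
  rw [threshold, logFactor_eq]
  ring

variable [Nonempty D]

theorem exists_accurateWithProb_of_lt_target (hk : (Matrix.of k).PosSemidef)
    (hone : ∀ a, k a a = 1) (hσ : 0 < σ) (hsub : SubmodularVarReduction k (σ ^ 2))
    (hdbar : 0 < dbar) (hε : 0 < ε) (hε_lt : ε < 4 * (1 + dbar)) (hδ : 0 < δ) (hδ_lt : δ < 1)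
    (hT : 1 ≤ T) (hT_le : threshold k σ dbar ε δ T ≤ T)
    (htarget : (1 + dbar) ^ 2 < 16 * (1 + dbar) ^ 2 / ε ^ 2 * betaT (Fintype.card D) δ T) :
    ∃ β : ℕ → ℝ, (∃ c, 0 < c ∧ ∀ i, c ≤ β i) ∧ AccurateWithProb k σ dbar β ε δ (T ≤ ·) := by
  have hn : 1 ≤ Fintype.card D := Fintype.card_pos
  have h := horizonBounds_of_le (by exact_mod_cast hn) hdbar hσ htarget (by exact_mod_cast hT)
    (half_log_le_gamma hone (σ ^ 2) T) (two_le_ceil_logb_div hε hε_lt)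
    (threshold_eq_target k σ dbar ε δ T ▸ hT_le)
  have hT_seven : 7 ≤ T := by
    have : (6 : ℝ) < T := by linarith [h.six_mul_le]
    exact_mod_cast this
  refine exists_accurateWithProb_of_horizonBounds hk hone hσ hsub hε hδ hδ_lt.le
    (eight_le_betaT hn hδ hδ_lt hT_seven) ?_ (by field_simp) h hT_seven
    (mul_exp_neg_betaT_le hn hδ hT)
  rw [one_le_div (by positivity)]
  calc ε ^ 2
    _ ≤ (4 * (1 + dbar)) ^ 2 := by gcongr
    _ = 16 * (1 + dbar) ^ 2 := by ring

theorem exists_accurateWithProb_of_threshold_le (hk : (Matrix.of k).PosSemidef)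
    (hone : ∀ a, k a a = 1) (hσ : 0 < σ) (hsub : SubmodularVarReduction k (σ ^ 2))
    (hdbar : 0 < dbar) (hε : 0 < ε) (hε_lt : ε < 4 * (1 + dbar)) (hδ : 0 < δ) (hδ_lt : δ < 1)
    (hT : 1 ≤ T) (hT_le : threshold k σ dbar ε δ T ≤ T) :
    ∃ β : ℕ → ℝ, (∃ c, 0 < c ∧ ∀ i, c ≤ β i) ∧ AccurateWithProb k σ dbar β ε δ (T ≤ ·) := by
  have hn : 1 ≤ Fintype.card D := Fintype.card_pos
  rcases lt_or_ge ((1 + dbar) ^ 2)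
    (16 * (1 + dbar) ^ 2 / ε ^ 2 * betaT (Fintype.card D) δ T) with htarget | htarget
  · exact exists_accurateWithProb_of_lt_target hk hone hσ hsub hdbar hε hε_lt hδ hδ_lt hT hT_le
      htarget
  have hsmall : 16 * betaT (Fintype.card D) δ T ≤ ε ^ 2 := by
    rw [div_mul_eq_mul_div, div_le_iff₀ (by positivity)] at htarget
    exact le_of_mul_le_mul_left (by linarith) (by positivity : 0 < (1 + dbar) ^ 2)
  have htail : Fintype.card D * Real.exp (-(betaT (Fintype.card D) δ T / 2)) ≤ 2 / 3 * δ :=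
    (mul_exp_neg_betaT_le hn hδ hT).trans
      (div_le_self (by positivity) (one_le_pow₀ (by exact_mod_cast hT)))
  obtain ⟨β, hβ, haccurate⟩ := exists_accurateWithProb_of_prior_accurate hk hone hσ hsub hdbar hε
    hε_lt hδ (betaT_pos hn hδ hδ_lt hT) hsmall htail
  exact ⟨β, hβ, haccurate.mono fun _ _ _ => trivial⟩

/- The bounds hold from the smallest admissible horizon on, which is why `β` does not depend on the
horizon. -/
theorem exists_accurateWithProb_threshold (hk : (Matrix.of k).PosSemidef)
    (hone : ∀ a, k a a = 1) (hσ : 0 < σ) (hsub : SubmodularVarReduction k (σ ^ 2))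
    (hdbar : 0 < dbar) (hε : 0 < ε) (hε_lt : ε < 4 * (1 + dbar)) (hδ : 0 < δ) (hδ_lt : δ < 1) :
    ∃ β : ℕ → ℝ, (∃ c, 0 < c ∧ ∀ i, c ≤ β i) ∧
      AccurateWithProb k σ dbar β ε δ fun T => threshold k σ dbar ε δ T ≤ T := by
  classical
  by_cases hex : ∃ T : ℕ, 1 ≤ T ∧ threshold k σ dbar ε δ T ≤ T
  · obtain ⟨hT, hT_le⟩ := Nat.find_spec hex
    obtain ⟨β, hβ, haccurate⟩ :=
      exists_accurateWithProb_of_threshold_le hk hone hσ hsub hdbar hε hε_lt hδ hδ_lt hT hT_le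
    exact ⟨β, hβ, haccurate.mono fun _ hS hS_le => Nat.find_min' hex ⟨hS, hS_le⟩⟩
  · refine ⟨fun _ => 1, ⟨1, one_pos, fun _ => le_rfl⟩, fun pb Ω _ P _ f z x _ _ => ?_⟩
    have huniv : 1 - δ ≤ P.real Set.univ := by
      rw [probReal_univ]
      linarith
    refine huniv.trans (measureReal_mono ?_)
    exact fun _ _ T hT hT_le => absurd ⟨T, hT, hT_le⟩ hex

end Threshold

section Rate

/-- The constant `K`, depending only on `δ̄`, of the upper bound on the threshold by the rate. -/
noncomputable def rateConst (dbar : ℝ) : ℝ :=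
  (96 * (1 + dbar) ^ 2 + 2 * (Real.logb 2 (8 * (1 + dbar)) + 1) + 4)
    * (Real.log (16 * (1 + dbar) ^ 2 / dbar ^ 2) + 2)

theorem logb_eight_mul_nonneg {d : ℝ} (hd : 0 ≤ d) : 0 ≤ Real.logb 2 (8 * (1 + d)) :=
  Real.logb_nonneg one_lt_two (by linarith)

theorem log_slack_nonneg {d : ℝ} (hd : 0 < d) : 0 ≤ Real.log (16 * (1 + d) ^ 2 / d ^ 2) := by
  refine Real.log_nonneg ((one_le_div (by positivity)).2 ?_)
  nlinarith

theorem rateConst_pos {dbar : ℝ} (hdbar : 0 < dbar) : 0 < rateConst dbar := by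
  have hlogb := logb_eight_mul_nonneg hdbar.le
  have hlog := log_slack_nonneg hdbar
  rw [rateConst]
  positivity

theorem mul_le_const_mul_sq {A g c l K₁ K₂ s : ℝ} (hA : 0 ≤ A) (hg : 0 ≤ g) (hc : 0 ≤ c)
    (hK₁ : 0 ≤ K₁) (hK₂ : 0 ≤ K₂) (hs : 1 ≤ s) (hcs : c ≤ K₁ + 2 * s) (hls : l ≤ K₂ + 2 * s) :
    (A * g + 2 * c) * l ≤ (A + 2 * K₁ + 4) * (K₂ + 2) * (g + 1) * s ^ 2 := by
  have hK₁s : K₁ ≤ K₁ * s := le_mul_of_one_le_right hK₁ hs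
  have hK₂s : K₂ ≤ K₂ * s := le_mul_of_one_le_right hK₂ hs
  calc (A * g + 2 * c) * l
    _ ≤ (A * g + 2 * c) * ((K₂ + 2) * s) := by
      gcongr
      linarith
    _ ≤ ((A + 2 * K₁ + 4) * (g + 1) * s) * ((K₂ + 2) * s) := by
      gcongr
      calc A * g + 2 * c
        _ ≤ A * (g + 1) * s + (2 * K₁ + 4) * 1 * s := by
          have : A * g * 1 ≤ A * (g + 1) * s := by
            gcongr
            linarith
          linarith
        _ ≤ A * (g + 1) * s + (2 * K₁ + 4) * (g + 1) * s := by
          gcongr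
          linarith
        _ = (A + 2 * K₁ + 4) * (g + 1) * s := by ring
    _ = (A + 2 * K₁ + 4) * (K₂ + 2) * (g + 1) * s ^ 2 := by ring

theorem log_le_posLog (w : ℝ) : Real.log w ≤ Real.posLog w := le_max_right _ _

theorem logb_two_le_two_mul_posLog (w : ℝ) : Real.logb 2 w ≤ 2 * Real.posLog w := by
  rw [Real.logb, div_le_iff₀ (Real.log_pos one_lt_two)]
  nlinarith [Real.log_two_gt_d9, log_le_posLog w, Real.posLog_nonneg (x := w)]

theorem ceil_logb_le {a ε : ℝ} (ha : 0 < a) (hε : 0 < ε) :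
    (⌈Real.logb 2 (a / ε)⌉ : ℝ) ≤ Real.logb 2 a + 1 + 2 * Real.posLog (1 / ε) :=
  calc (⌈Real.logb 2 (a / ε)⌉ : ℝ)
    _ ≤ Real.logb 2 (a / ε) + 1 := (Int.ceil_lt_add_one _).le
    _ = Real.logb 2 a + Real.logb 2 (1 / ε) + 1 := by
      rw [← mul_one_div, Real.logb_mul ha.ne' (by positivity)]
    _ ≤ Real.logb 2 a + 1 + 2 * Real.posLog (1 / ε) := by
      linarith [logb_two_le_two_mul_posLog (1 / ε)]

theorem logFactor_le {n : ℕ} (hn : 1 ≤ n) {d ε δ : ℝ} (hd : 0 < d) (hε : 0 < ε) {T : ℕ}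
    (hb : 0 < betaT n δ T) :
    logFactor n d ε δ T ≤ Real.log (16 * (1 + d) ^ 2 / d ^ 2) + 2 * Real.posLog (1 / ε)
      + Real.log n + Real.posLog (betaT n δ T) := by
  have hn' : (0 : ℝ) < n := Nat.cast_pos.2 hn
  calc logFactor n d ε δ T
    _ = Real.log (16 * (1 + d) ^ 2 / d ^ 2 * (1 / ε) ^ 2 * n * betaT n δ T) := by
      rw [logFactor]
      congr 1
      field_simp
    _ = Real.log (16 * (1 + d) ^ 2 / d ^ 2) + 2 * Real.log (1 / ε) + Real.log n
          + Real.log (betaT n δ T) := by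
      rw [Real.log_mul (by positivity) hb.ne', Real.log_mul (by positivity) hn'.ne',
        Real.log_mul (by positivity) (by positivity), Real.log_pow, Nat.cast_ofNat]
    _ ≤ _ := by gcongr <;> exact log_le_posLog _

variable {D : Type*} [Fintype D] {k : D → D → ℝ} {σ dbar ε δ : ℝ} {T : ℕ}

theorem threshold_eq_rate (k : D → D → ℝ) (σ dbar ε δ : ℝ) (T : ℕ) :
    threshold k σ dbar ε δ T = (96 * (1 + dbar) ^ 2 * (rate k σ ε δ T - 1)
      + 2 * (⌈Real.logb 2 (8 * (1 + dbar) / ε)⌉ : ℝ)) * logFactor (Fintype.card D) dbar ε δ T := by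
  rw [threshold, rate]
  ring

variable [Nonempty D]

theorem one_le_rate (hone : ∀ a, k a a = 1) (hσ : 0 < σ) (hδ : 0 < δ) (hδ_lt : δ < 1)
    (hT : 1 ≤ T) : 1 ≤ rate k σ ε δ T := by
  have hb := betaT_pos (Fintype.card_pos (α := D)) hδ hδ_lt hT
  have hg := half_le_C1_mul hσ (by exact_mod_cast hT) (half_log_le_gamma hone (σ ^ 2) T)
  exact le_add_of_nonneg_left
    (div_nonneg (mul_nonneg (by linarith) hb.le) (sq_nonneg ε))

theorem threshold_le_rate (hone : ∀ a, k a a = 1) (hσ : 0 < σ) (hdbar : 0 < dbar) (hε : 0 < ε)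
    (hε_lt : ε < 4 * (1 + dbar)) (hδ : 0 < δ) (hδ_lt : δ < 1) (hT : 1 ≤ T) :
    threshold k σ dbar ε δ T ≤ rateConst dbar * rate k σ ε δ T *
      (1 + Real.posLog (1 / ε) + Real.log (Fintype.card D)
        + Real.posLog (betaT (Fintype.card D) δ T)) ^ 2 := by
  have hn : 1 ≤ Fintype.card D := Fintype.card_pos
  have hrate := one_le_rate (ε := ε) hone hσ hδ hδ_lt hT
  have hlog_card : 0 ≤ Real.log (Fintype.card D) := Real.log_nonneg (by exact_mod_cast hn)
  have hlog_beta := Real.posLog_nonneg (x := betaT (Fintype.card D) δ T)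
  have hlog_eps := Real.posLog_nonneg (x := 1 / ε)
  have hceil := ceil_logb_le (a := 8 * (1 + dbar)) (by positivity) hε
  have hlogFactor := logFactor_le hn hdbar hε (betaT_pos hn hδ hδ_lt hT)
  have h := mul_le_const_mul_sq (A := 96 * (1 + dbar) ^ 2) (g := rate k σ ε δ T - 1)
    (K₁ := Real.logb 2 (8 * (1 + dbar)) + 1) (K₂ := Real.log (16 * (1 + dbar) ^ 2 / dbar ^ 2))
    (s := 1 + Real.posLog (1 / ε) + Real.log (Fintype.card D)
      + Real.posLog (betaT (Fintype.card D) δ T))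
    (by positivity) (by linarith) (by linarith [two_le_ceil_logb_div hε hε_lt])
    (by linarith [logb_eight_mul_nonneg hdbar.le]) (log_slack_nonneg hdbar) (by linarith)
    (hceil.trans (by linarith)) (hlogFactor.trans (by linarith))
  rwa [sub_add_cancel, ← threshold_eq_rate, ← rateConst] at h

theorem rate_le_threshold (hone : ∀ a, k a a = 1) (hσ : 0 < σ) (hdbar : 0 < dbar) (hε : 0 < ε)
    (hε_lt : ε < 4 * (1 + dbar)) (hδ : 0 < δ) (hδ_lt : δ < 1) (hT : 1 ≤ T)
    (hlog : 1 ≤ logFactor (Fintype.card D) dbar ε δ T) :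
    rate k σ ε δ T ≤ threshold k σ dbar ε δ T := by
  have hrate : 0 ≤ rate k σ ε δ T - 1 := sub_nonneg.2 (one_le_rate hone hσ hδ hδ_lt hT)
  have hceil := two_le_ceil_logb_div hε hε_lt
  have hslack : 1 ≤ 96 * (1 + dbar) ^ 2 := by nlinarith
  calc rate k σ ε δ T
    _ ≤ 96 * (1 + dbar) ^ 2 * (rate k σ ε δ T - 1)
          + 2 * (⌈Real.logb 2 (8 * (1 + dbar) / ε)⌉ : ℝ) := by
      linarith [le_mul_of_one_le_left hrate hslack]
    _ ≤ threshold k σ dbar ε δ T := by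
      rw [threshold_eq_rate]
      exact le_mul_of_one_le_right (by positivity) hlog

end Rate

end TruVaR

theorem corollary4 (dbar : ℝ) (hdbar : 0 < dbar) :
    ∃ K : ℝ, 0 < K ∧
      ∀ (D : Type*) [Fintype D] [Nonempty D] (k : D → D → ℝ) (σ ε δ : ℝ),
        (Matrix.of k).PosSemidef → (∀ a, k a a = 1) → 0 < σ →
        TruVaR.SubmodularVarReduction k (σ ^ 2) →
        0 < ε → ε < 4 * (1 + dbar) → 0 < δ → δ < 1 →
        -- accuracy, with `β` chosen independently of the time horizon
        (∃ β : ℕ → ℝ, (∃ b, 0 < b ∧ ∀ i, b ≤ β i) ∧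
          ∀ (pb : TruVaR.Problem) (Ω : Type*) [MeasurableSpace Ω] (P : Measure Ω)
            [IsProbabilityMeasure P] (f : D → Ω → ℝ) (z : ℕ → Ω → ℝ) (x : ℕ → Ω → D),
            TruVaR.IsModel P k (σ ^ 2) f z →
            TruVaR.IsRun pb k ⟨σ ^ 2, 1, 1 / 2, dbar, β⟩ f z x →
            1 - δ ≤ P.real {ω | ∀ T : ℕ, 1 ≤ T → TruVaR.threshold k σ dbar ε δ T ≤ (T : ℝ) →
              TruVaR.Accurate pb ε (fun a => f a ω)
                (TruVaR.runState pb k ⟨σ ^ 2, 1, 1 / 2, dbar, β⟩ f z x ω T)}) ∧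
        -- the threshold is `C₁ γ_T β_T / ε² + 1` up to constants and logarithmic factors
        (∀ T : ℕ, 1 ≤ T →
          TruVaR.threshold k σ dbar ε δ T ≤ K * TruVaR.rate k σ ε δ T *
            (1 + Real.posLog (1 / ε) + Real.log (Fintype.card D)
              + Real.posLog (TruVaR.betaT (Fintype.card D) δ T)) ^ 2 ∧
          (1 ≤ TruVaR.logFactor (Fintype.card D) dbar ε δ T →
            TruVaR.rate k σ ε δ T ≤ TruVaR.threshold k σ dbar ε δ T)) := by
  refine ⟨TruVaR.rateConst dbar, TruVaR.rateConst_pos hdbar, ?_⟩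
  intro D _ _ k σ ε δ hk hone hσ hsub hε hε_lt hδ hδ_lt
  refine ⟨?_, fun T hT => ⟨?_, ?_⟩⟩
  · exact TruVaR.exists_accurateWithProb_threshold hk hone hσ hsub hdbar hε hε_lt hδ hδ_lt
  · exact TruVaR.threshold_le_rate hone hσ hdbar hε hε_lt hδ hδ_lt hT
  · exact TruVaR.rate_le_threshold hone hσ hdbar hε hε_lt hδ hδ_lt hT
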